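/- Let $0<\Theta_i<1$, $\mathrm{Le}>1$ and $A=\frac{\Theta_i}{1-\Theta_i}\bigl(1+\frac{\Theta_i}{\mathrm{Le}(1-\Theta_i)}\bigr)$. Let $\mathcal W$ be the complex Banach space of pairs $\mathbf u=(u,v)$ of functions $\mathbb R\setminus\{0\}\to\mathbb C$ that are continuous on $(-\infty,0)$ and on $(0,\infty)$, have finite one-sided limits at $0$, and have finite norm $$\|\mathbf u\|_{\mathcal W}=\sup_{\xi<0}|e^{\xi/2}u(\xi)|+\sup_{\xi>0}|e^{\xi/2}u(\xi)|+\sup_{\xi<0}|e^{\xi/2}v(\xi)|+\sup_{\xi>0}|e^{\mathrm{Le}\,\xi/2}v(\xi)|.$$ Write $[f]=f(0^+)-f(0^-)$ and let $\chi_-$ be the characteristic function of $(-\infty,0)$. Let $L$ be the operator in $\mathcal W$ with domain $$D(L)=\Bigl\{\mathbf u\in\mathcal W:\ \mathbf u',\mathbf u''\in\mathcal W,\ [u]=[v]=0,\ [u']=-\tfrac{u(0)}{1-\Theta_i},\ [v']=\tfrac{\mathrm{Le}\,u(0)}{1-\Theta_i}\Bigr\}$$ ($\mathbf u',\mathbf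 u''$ denoting classical derivatives on $\mathbb R\setminus\{0\}$) and $$L\mathbf u=\bigl(u''+u'+A\chi_-v,\ \mathrm{Le}^{-1}v''+v'-A\chi_-v\bigr).$$ Let $\mathbf U=(\Theta^0,\Phi^0)$ be given by $\Theta^0(\xi)=1-(1-\Theta_i)e^{\frac{\Theta_i}{1-\Theta_i}\xi}$, $\Phi^0(\xi)=\frac{\Theta_i}{A(1-\Theta_i)}e^{\frac{\Theta_i}{1-\Theta_i}\xi}$ for $\xi<0$ and $\Theta^0(\xi)=\Theta_ie^{-\xi}$, $\Phi^0(\xi)=1+\bigl(\frac{\Theta_i}{A(1-\Theta_i)}-1\bigr)e^{-\mathrm{Le}\,\xi}$ for $\xi>0$. With principal square roots set $$k_{2,\lambda}=\tfrac{-1-\sqrt{1+4\lambda}}2,\quad k_{3,\lambda}=\tfrac{-\mathrm{Le}+\sqrt{\mathrm{Le}^2+4\mathrm{Le}(A+\lambda)}}2,\quad k_{6,\lambda}=\tfrac{-\mathrm{Le}-\sqrt{\mathrm{Le}^2+4\mathrm{Le}\lambda}}2,$$ $$D(\lambda;\Theta_i,\mathrm{Le})=(k_{6,\lambda}-k_{3,\lambda})(k_{3,\lambda}-k_{2,\lambda})\bigl[1-(1-\Theta_i)\sqrt{1+4\lambda}\bigr]+A\,\mathrm{Le},$$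 and $\mathcal P=\{\lambda\in\mathbb C: a\,\mathrm{Re}\,\lambda+b(\mathrm{Im}\,\lambda)^2+c\le0\}$ with $$a=\Bigl(1-\frac1{\mathrm{Le}}\Bigr)^2,\qquad b=\frac1{\mathrm{Le}},\qquad c=\frac{2A+1}2-\frac{8A+5}{4\mathrm{Le}}+\frac{1+A}{\mathrm{Le}^2}-\frac1{4\mathrm{Le}^3}.$$ Then $L$ is sectorial (that is, for some $\omega\in\mathbb R$, $\theta\in(\pi/2,\pi)$, $M>0$, the resolvent set contains $\{\lambda\ne\omega:|\arg(\lambda-\omega)|<\theta\}$ and $\|R(\lambda,L)\|\le M/|\lambda-\omega|$ there) and it generates an analytic semigroup: there are bounded operators $T(z)$ on $\mathcal W$, with $T(0)=I$, depending holomorphically on $z$ in a sector $\Sigma=\{z\neq 0:|\arg z|<\varphi\}$, $0<\varphi\le\pi/2$, with $T(z+w)=T(z)T(w)$ and $\|T(z)\|\le M'e^{\omega'\mathrm{Re}\,z}$ for $z,w\in\Sigma$, such that $R(\lambda,L)f=\int_0^\infty e^{-\lambda t}T(t)f\,dt$ for $\mathrm{Re}\,\lambda>\omega'$ and $f\in\mathcal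 W$. Moreover $$\sigma(L)=(-\infty,-\tfrac14]\ \cup\ \mathcal P\ \cup\ \{0\}\ \cup\ \{\lambda\in\mathbb C:D(\lambda;\Theta_i,\mathrm{Le})=0\};$$ $0$ is a simple isolated eigenvalue of $L$ (an isolated point of $\sigma(L)$ and a simple pole of the resolvent, with one-dimensional kernel), and the kernel of $L$ is spanned by $\mathbf U'=\frac{d\mathbf U}{d\xi}$; and a number $\lambda\notin(-\infty,-\frac14]\cup\mathcal P$ is an eigenvalue of $L$ if and only if $D(\lambda;\Theta_i,\mathrm{Le})=0$. -/

import Mathlib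

namespace Flame

open Filter Topology

noncomputable section

/-! ### Weighted spaces of piecewise continuous functions -/

/-- The jump `[u] = u(0⁺) - u(0⁻)` at the interface `ξ = 0`. -/
def jump (u : ℝ → ℂ) : ℂ := Function.rightLim u 0 - Function.leftLim u 0

/-- A function on `ℝ ∖ {0}` which is continuous on both half-lines, has finite one-sided limits
at `0`, and for which `e^{α ξ} u` is bounded on `(-∞, 0)` and `e^{β ξ} u` on `(0, ∞)`.
Such a function is represented by its unique extension to `ℝ` that is right-continuous at `0`
(so continuity on `[0, ∞)` says: continuity on `(0, ∞)`, and `u 0` is the limit at `0⁺`). -/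
structure IsWeighted (α β : ℝ) (u : ℝ → ℂ) : Prop where
  cont_neg : ContinuousOn u (Set.Iio 0)
  cont_pos : ContinuousOn u (Set.Ici 0)
  lim_neg : ∃ l : ℂ, Tendsto u (𝓝[<] 0) (𝓝 l)
  bdd_neg : ∃ C : ℝ, ∀ ξ < 0, Real.exp (α * ξ) * ‖u ξ‖ ≤ C
  bdd_pos : ∃ C : ℝ, ∀ ξ > 0, Real.exp (β * ξ) * ‖u ξ‖ ≤ C

/-- The weighted functions form a complex vector space. -/
def weightedSubmodule (α β : ℝ) : Submodule ℂ (ℝ → ℂ) where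
  carrier := {u | IsWeighted α β u}
  zero_mem' := ⟨continuousOn_const, continuousOn_const, ⟨0, tendsto_const_nhds⟩,
    ⟨0, by simp⟩, ⟨0, by simp⟩⟩
  add_mem' := by
    rintro u v ⟨h1, h2, ⟨l, hl⟩, ⟨C, hC⟩, ⟨C', hC'⟩⟩ ⟨k1, k2, ⟨m, hm⟩, ⟨K, hK⟩, ⟨K', hK'⟩⟩
    refine ⟨h1.add k1, h2.add k2, ⟨l + m, hl.add hm⟩, ⟨C + K, fun ξ hξ => ?_⟩,
      ⟨C' + K', fun ξ hξ => ?_⟩⟩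
    · refine le_trans ?_ (add_le_add (hC ξ hξ) (hK ξ hξ))
      rw [← mul_add]
      exact mul_le_mul_of_nonneg_left (norm_add_le _ _) (Real.exp_pos _).le
    · refine le_trans ?_ (add_le_add (hC' ξ hξ) (hK' ξ hξ))
      rw [← mul_add]
      exact mul_le_mul_of_nonneg_left (norm_add_le _ _) (Real.exp_pos _).le
  smul_mem' := by
    rintro c u ⟨h1, h2, ⟨l, hl⟩, ⟨C, hC⟩, ⟨C', hC'⟩⟩
    refine ⟨h1.const_smul c, h2.const_smul c, ⟨c • l, hl.const_smul c⟩,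
      ⟨‖c‖ * C, fun ξ hξ => ?_⟩, ⟨‖c‖ * C', fun ξ hξ => ?_⟩⟩
    · rw [Pi.smul_apply, norm_smul, mul_left_comm]
      exact mul_le_mul_of_nonneg_left (hC ξ hξ) (norm_nonneg _)
    · rw [Pi.smul_apply, norm_smul, mul_left_comm]
      exact mul_le_mul_of_nonneg_left (hC' ξ hξ) (norm_nonneg _)

/-- The space of weighted functions, as a type of its own (it does not carry the topology of
pointwise convergence). -/
def Weighted (α β : ℝ) : Type := weightedSubmodule α β

namespace Weighted

variable {α β : ℝ}

instance : AddCommGroup (Weighted α β) := inferInstanceAs (AddCommGroup (weightedSubmodule α β))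

instance : Module ℂ (Weighted α β) := inferInstanceAs (Module ℂ (weightedSubmodule α β))

/-- The underlying function. -/
def toFun (u : Weighted α β) : ℝ → ℂ := Subtype.val (p := fun f => f ∈ weightedSubmodule α β) u

instance : CoeFun (Weighted α β) (fun _ => ℝ → ℂ) := ⟨toFun⟩

/-- The element of the space given by a weighted function. -/
def mk (u : ℝ → ℂ) (hu : IsWeighted α β u) : Weighted α β :=
  (⟨u, hu⟩ : weightedSubmodule α β)

theorem isWeighted (u : Weighted α β) : IsWeighted α β u :=
  Subtype.property (p := fun f => f ∈ weightedSubmodule α β) u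

theorem add_apply (u v : Weighted α β) (ξ : ℝ) : (u + v) ξ = u ξ + v ξ := rfl

theorem smul_apply (c : ℂ) (u : Weighted α β) (ξ : ℝ) : (c • u) ξ = c * u ξ := rfl

theorem sub_apply (u v : Weighted α β) (ξ : ℝ) : (u - v) ξ = u ξ - v ξ := rfl

theorem ext {u v : Weighted α β} (h : ∀ ξ : ℝ, u ξ = v ξ) : u = v :=
  Subtype.ext (funext h)

theorem tendsto_pos (u : Weighted α β) : Tendsto u (𝓝[>] 0) (𝓝 (u 0)) :=
  ((u.isWeighted.cont_pos 0 Set.self_mem_Ici).mono_left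
    (nhdsWithin_mono _ Set.Ioi_subset_Ici_self))

theorem tendsto_neg (u : Weighted α β) : Tendsto u (𝓝[<] 0) (𝓝 (Function.leftLim u 0)) :=
  tendsto_leftLim_of_tendsto u.isWeighted.lim_neg

theorem ext_ne {u v : Weighted α β} (h : ∀ ξ : ℝ, ξ ≠ 0 → u ξ = v ξ) : u = v := by
  refine ext fun ξ => ?_
  by_cases hξ : ξ = 0
  · subst hξ
    refine tendsto_nhds_unique u.tendsto_pos (v.tendsto_pos.congr' ?_)
    filter_upwards [self_mem_nhdsWithin] with x hx
    exact (h x (ne_of_gt hx)).symm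
  · exact h ξ hξ

theorem jump_eq (u : Weighted α β) : jump u = u 0 - Function.leftLim u 0 := by
  rw [jump, rightLim_eq_of_tendsto u.tendsto_pos]

theorem jump_add (u v : Weighted α β) : jump (u + v : Weighted α β) = jump u + jump v := by
  have h : Function.leftLim (u + v : Weighted α β) 0 = _ :=
    leftLim_eq_of_tendsto (u.tendsto_neg.add v.tendsto_neg)
  rw [jump_eq, jump_eq, jump_eq, add_apply, h]
  ring

theorem jump_smul (c : ℂ) (u : Weighted α β) : jump (c • u : Weighted α β) = c * jump u := by
  have h : Function.leftLim (c • u : Weighted α β) 0 = _ :=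
    leftLim_eq_of_tendsto (u.tendsto_neg.const_smul c)
  rw [jump_eq, jump_eq, smul_apply, h, smul_eq_mul]
  ring

/-- `‖u‖ = sup_{ξ < 0} |e^{α ξ} u(ξ)| + sup_{ξ > 0} |e^{β ξ} u(ξ)|`. -/
instance : Norm (Weighted α β) where
  norm u := (⨆ ξ : Set.Iio (0 : ℝ), Real.exp (α * ξ) * ‖u ξ‖) +
    ⨆ ξ : Set.Ioi (0 : ℝ), Real.exp (β * ξ) * ‖u ξ‖

theorem norm_def (u : Weighted α β) : ‖u‖ =
    (⨆ ξ : Set.Iio (0 : ℝ), Real.exp (α * ξ) * ‖u ξ‖) +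
      ⨆ ξ : Set.Ioi (0 : ℝ), Real.exp (β * ξ) * ‖u ξ‖ := rfl

theorem bddAbove_neg (u : Weighted α β) :
    BddAbove (Set.range fun ξ : Set.Iio (0 : ℝ) => Real.exp (α * ξ) * ‖u ξ‖) := by
  obtain ⟨C, hC⟩ := u.isWeighted.bdd_neg
  exact ⟨C, by rintro _ ⟨ξ, rfl⟩; exact hC ξ ξ.2⟩

theorem bddAbove_pos (u : Weighted α β) :
    BddAbove (Set.range fun ξ : Set.Ioi (0 : ℝ) => Real.exp (β * ξ) * ‖u ξ‖) := by
  obtain ⟨C, hC⟩ := u.isWeighted.bdd_pos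
  exact ⟨C, by rintro _ ⟨ξ, rfl⟩; exact hC ξ ξ.2⟩

theorem sup_neg_nonneg (u : Weighted α β) :
    0 ≤ ⨆ ξ : Set.Iio (0 : ℝ), Real.exp (α * ξ) * ‖u ξ‖ :=
  Real.iSup_nonneg fun _ => by positivity

theorem sup_pos_nonneg (u : Weighted α β) :
    0 ≤ ⨆ ξ : Set.Ioi (0 : ℝ), Real.exp (β * ξ) * ‖u ξ‖ :=
  Real.iSup_nonneg fun _ => by positivity

theorem le_norm_neg (u : Weighted α β) {ξ : ℝ} (hξ : ξ < 0) :
    Real.exp (α * ξ) * ‖u ξ‖ ≤ ‖u‖ :=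
  (le_ciSup u.bddAbove_neg ⟨ξ, hξ⟩).trans (le_add_of_nonneg_right u.sup_pos_nonneg)

theorem le_norm_pos (u : Weighted α β) {ξ : ℝ} (hξ : 0 < ξ) :
    Real.exp (β * ξ) * ‖u ξ‖ ≤ ‖u‖ :=
  (le_ciSup u.bddAbove_pos ⟨ξ, hξ⟩).trans (le_add_of_nonneg_left u.sup_neg_nonneg)

theorem normCore : NormedSpace.Core ℂ (Weighted α β) where
  norm_nonneg u := add_nonneg u.sup_neg_nonneg u.sup_pos_nonneg
  norm_smul c u := by
    simp only [norm_def, smul_apply, norm_mul, mul_left_comm _ ‖c‖, mul_add]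
    rw [Real.mul_iSup_of_nonneg (norm_nonneg c), Real.mul_iSup_of_nonneg (norm_nonneg c)]
  norm_triangle u v := by
    have h1 : (⨆ ξ : Set.Iio (0 : ℝ), Real.exp (α * ξ) * ‖(u + v) ξ‖) ≤
        (⨆ ξ : Set.Iio (0 : ℝ), Real.exp (α * ξ) * ‖u ξ‖) +
          ⨆ ξ : Set.Iio (0 : ℝ), Real.exp (α * ξ) * ‖v ξ‖ := by
      have : Nonempty (Set.Iio (0 : ℝ)) := ⟨⟨-1, by simp⟩⟩
      refine ciSup_le fun ξ => ?_
      refine le_trans ?_ (add_le_add (le_ciSup u.bddAbove_neg ξ) (le_ciSup v.bddAbove_neg ξ))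
      rw [← mul_add]
      exact mul_le_mul_of_nonneg_left (norm_add_le _ _) (Real.exp_pos _).le
    have h2 : (⨆ ξ : Set.Ioi (0 : ℝ), Real.exp (β * ξ) * ‖(u + v) ξ‖) ≤
        (⨆ ξ : Set.Ioi (0 : ℝ), Real.exp (β * ξ) * ‖u ξ‖) +
          ⨆ ξ : Set.Ioi (0 : ℝ), Real.exp (β * ξ) * ‖v ξ‖ := by
      have : Nonempty (Set.Ioi (0 : ℝ)) := ⟨⟨1, by simp⟩⟩
      refine ciSup_le fun ξ => ?_
      refine le_trans ?_ (add_le_add (le_ciSup u.bddAbove_pos ξ) (le_ciSup v.bddAbove_pos ξ))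
      rw [← mul_add]
      exact mul_le_mul_of_nonneg_left (norm_add_le _ _) (Real.exp_pos _).le
    simp only [norm_def]
    linarith
  norm_eq_zero_iff u := by
    refine ⟨fun h => ext_ne fun ξ hξ => ?_, ?_⟩
    · change u ξ = 0
      rcases lt_or_gt_of_ne hξ with hξ | hξ
      · have := u.le_norm_neg hξ
        rw [h] at this
        exact norm_le_zero_iff.1 (nonpos_of_mul_nonpos_right this (Real.exp_pos _))
      · have := u.le_norm_pos hξ
        rw [h] at this
        exact norm_le_zero_iff.1 (nonpos_of_mul_nonpos_right this (Real.exp_pos _))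
    · rintro rfl
      have h : ∀ ξ : ℝ, (0 : Weighted α β) ξ = 0 := fun _ => rfl
      simp [norm_def, h]

instance : NormedAddCommGroup (Weighted α β) := NormedAddCommGroup.ofCore normCore

instance : NormedSpace ℂ (Weighted α β) := NormedSpace.ofCore normCore

/-- The weight, with value `1` at `0`. -/
def wt (α β ξ : ℝ) : ℝ := if ξ < 0 then Real.exp (α * ξ) else Real.exp (β * ξ)

theorem wt_pos (α β ξ : ℝ) : 0 < wt α β ξ := by
  unfold wt; split_ifs <;> exact Real.exp_pos _

theorem wt_mul_le (u : Weighted α β) (ξ : ℝ) : wt α β ξ * ‖u ξ‖ ≤ ‖u‖ := by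
  rcases lt_trichotomy ξ 0 with h | rfl | h
  · simpa [wt, h] using u.le_norm_neg h
  · have h1 : Tendsto (fun ξ : ℝ => Real.exp (β * ξ) * ‖u ξ‖) (𝓝[>] 0)
        (𝓝 (Real.exp (β * 0) * ‖u 0‖)) :=
      ((by fun_prop : Continuous fun ξ : ℝ => Real.exp (β * ξ)).tendsto 0 |>.mono_left
        nhdsWithin_le_nhds).mul u.tendsto_pos.norm
    simp only [wt, lt_irrefl, if_false]
    refine le_of_tendsto h1 ?_
    filter_upwards [self_mem_nhdsWithin] with x hx using u.le_norm_pos hx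
  · simpa [wt, not_lt.2 h.le] using u.le_norm_pos h

theorem norm_leftLim_le (u : Weighted α β) : ‖Function.leftLim u 0‖ ≤ ‖u‖ := by
  have h1 : Tendsto (fun ξ : ℝ => Real.exp (α * ξ) * ‖u ξ‖) (𝓝[<] 0)
      (𝓝 (Real.exp (α * 0) * ‖Function.leftLim u 0‖)) :=
    ((by fun_prop : Continuous fun ξ : ℝ => Real.exp (α * ξ)).tendsto 0 |>.mono_left
      nhdsWithin_le_nhds).mul u.tendsto_neg.norm
  have h2 := le_of_tendsto h1 (b := ‖u‖) (by
    filter_upwards [self_mem_nhdsWithin] with x hx using u.le_norm_neg hx)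
  simpa using h2

theorem leftLim_sub (u v : Weighted α β) : Function.leftLim (u - v : Weighted α β) 0 =
    Function.leftLim u 0 - Function.leftLim v 0 :=
  leftLim_eq_of_tendsto (u.tendsto_neg.sub v.tendsto_neg : Tendsto (u - v : Weighted α β) _ _)

instance : CompleteSpace (Weighted α β) := by
  refine Metric.complete_of_cauchySeq_tendsto fun F hF => ?_
  -- the weighted sequence is uniformly Cauchy
  let G : ℕ → ℝ → ℂ := fun n ξ => (wt α β ξ : ℂ) * F n ξ
  have hG : ∀ n m ξ, dist (G n ξ) (G m ξ) ≤ dist (F n) (F m) := by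
    intro n m ξ
    rw [dist_eq_norm (F n), dist_eq_norm, ← mul_sub, norm_mul, Complex.norm_real,
      Real.norm_of_nonneg (wt_pos _ _ _).le]
    exact wt_mul_le (F n - F m) ξ
  have hcau : ∀ ξ, CauchySeq fun n => G n ξ := fun ξ =>
    Metric.cauchySeq_iff.2 fun ε hε => by
      obtain ⟨N, hN⟩ := Metric.cauchySeq_iff.1 hF ε hε
      exact ⟨N, fun m hm n hn => (hG m n ξ).trans_lt (hN m hm n hn)⟩
  choose g hg using fun ξ => cauchySeq_tendsto_of_complete (hcau ξ)
  have hbound : ∀ ε > 0, ∃ N, ∀ n ≥ N, ∀ ξ, dist (G n ξ) (g ξ) ≤ ε := by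
    intro ε hε
    obtain ⟨N, hN⟩ := Metric.cauchySeq_iff.1 hF ε hε
    refine ⟨N, fun n hn ξ => le_of_tendsto (tendsto_const_nhds.dist (hg ξ)) ?_⟩
    filter_upwards [eventually_ge_atTop N] with m hm
    exact (hG n m ξ).trans (hN n hn m hm).le
  have hunif : TendstoUniformly G g atTop := by
    refine Metric.tendstoUniformly_iff.2 fun ε hε => ?_
    obtain ⟨N, hN⟩ := hbound (ε / 2) (half_pos hε)
    filter_upwards [eventually_ge_atTop N] with n hn ξ
    rw [dist_comm]
    exact (hN n hn ξ).trans_lt (half_lt_self hε)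
  have hwn : Continuous fun ξ : ℝ => ((Real.exp (α * ξ) : ℝ) : ℂ) := by fun_prop
  have hwp : Continuous fun ξ : ℝ => ((Real.exp (β * ξ) : ℝ) : ℂ) := by fun_prop
  have hgn : ContinuousOn g (Set.Iio 0) := by
    refine hunif.tendstoUniformlyOn.continuousOn (Frequently.of_forall fun n => ?_)
    refine (hwn.continuousOn.mul (F n).isWeighted.cont_neg).congr fun ξ hξ => ?_
    simp [G, wt, Set.mem_Iio.1 hξ]
  have hgp : ContinuousOn g (Set.Ici 0) := by
    refine hunif.tendstoUniformlyOn.continuousOn (Frequently.of_forall fun n => ?_)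
    refine (hwp.continuousOn.mul (F n).isWeighted.cont_pos).congr fun ξ hξ => ?_
    simp [G, wt, not_lt.2 (Set.mem_Ici.1 hξ)]
  have hlim : ∃ l, Tendsto g (𝓝[<] 0) (𝓝 l) := by
    have hc : CauchySeq fun n => Function.leftLim (F n) 0 :=
      Metric.cauchySeq_iff.2 fun ε hε => by
        obtain ⟨N, hN⟩ := Metric.cauchySeq_iff.1 hF ε hε
        refine ⟨N, fun m hm n hn => lt_of_le_of_lt ?_ (hN m hm n hn)⟩
        rw [dist_eq_norm, dist_eq_norm, ← leftLim_sub]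
        exact norm_leftLim_le _
    obtain ⟨l, hl⟩ := cauchySeq_tendsto_of_complete hc
    refine ⟨l, TendstoUniformlyOnFilter.tendsto_of_eventually_tendsto
      (hunif.tendstoUniformlyOnFilter.mono_right le_top) (Eventually.of_forall fun n => ?_) hl⟩
    have h1 : Tendsto (fun ξ : ℝ => ((Real.exp (α * ξ) : ℝ) : ℂ) * F n ξ) (𝓝[<] 0)
        (𝓝 (((Real.exp (α * 0) : ℝ) : ℂ) * Function.leftLim (F n) 0)) :=
      ((hwn.tendsto 0).mono_left nhdsWithin_le_nhds).mul (F n).tendsto_neg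
    rw [mul_zero, Real.exp_zero, Complex.ofReal_one, one_mul] at h1
    refine h1.congr' ?_
    filter_upwards [self_mem_nhdsWithin] with ξ hξ
    simp [G, wt, Set.mem_Iio.1 hξ]
  have hgb : ∃ C : ℝ, ∀ ξ, ‖g ξ‖ ≤ C := by
    obtain ⟨N, hN⟩ := hbound 1 one_pos
    refine ⟨1 + ‖F N‖, fun ξ => ?_⟩
    have h1 : ‖g ξ‖ ≤ dist (G N ξ) (g ξ) + ‖G N ξ‖ := by
      rw [dist_comm, dist_eq_norm]
      simpa using norm_add_le (g ξ - G N ξ) (G N ξ)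
    have h2 : ‖G N ξ‖ ≤ ‖F N‖ := by
      rw [norm_mul, Complex.norm_real, Real.norm_of_nonneg (wt_pos _ _ _).le]
      exact wt_mul_le _ _
    linarith [hN N le_rfl ξ]
  obtain ⟨C, hC⟩ := hgb
  let f : ℝ → ℂ := fun ξ => (wt α β ξ : ℂ)⁻¹ * g ξ
  have hfg : ∀ ξ, wt α β ξ * ‖f ξ‖ = ‖g ξ‖ := by
    intro ξ
    rw [norm_mul, norm_inv, Complex.norm_real, Real.norm_of_nonneg (wt_pos _ _ _).le,
      mul_inv_cancel_left₀ (wt_pos _ _ _).ne']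
  have hfn : Set.EqOn f (fun ξ => ((Real.exp (α * ξ) : ℝ) : ℂ)⁻¹ * g ξ) (Set.Iio 0) :=
    fun ξ hξ => by simp [f, wt, Set.mem_Iio.1 hξ]
  have hfp : Set.EqOn f (fun ξ => ((Real.exp (β * ξ) : ℝ) : ℂ)⁻¹ * g ξ) (Set.Ici 0) :=
    fun ξ hξ => by simp [f, wt, not_lt.2 (Set.mem_Ici.1 hξ)]
  have hwn' : Continuous fun ξ : ℝ => ((Real.exp (α * ξ) : ℝ) : ℂ)⁻¹ :=
    hwn.inv₀ fun ξ => Complex.ofReal_ne_zero.2 (Real.exp_pos _).ne'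
  have hwp' : Continuous fun ξ : ℝ => ((Real.exp (β * ξ) : ℝ) : ℂ)⁻¹ :=
    hwp.inv₀ fun ξ => Complex.ofReal_ne_zero.2 (Real.exp_pos _).ne'
  have hf : IsWeighted α β f := by
    refine ⟨(hwn'.continuousOn.mul hgn).congr hfn, (hwp'.continuousOn.mul hgp).congr hfp, ?_,
      ⟨C, fun ξ hξ => ?_⟩, ⟨C, fun ξ hξ => ?_⟩⟩
    · obtain ⟨l, hl⟩ := hlim
      refine ⟨_, (((hwn'.tendsto 0).mono_left nhdsWithin_le_nhds).mul hl).congr' ?_⟩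
      filter_upwards [self_mem_nhdsWithin] with ξ hξ using (hfn hξ).symm
    · have := (hfg ξ).le.trans (hC ξ)
      rwa [wt, if_pos hξ] at this
    · have := (hfg ξ).le.trans (hC ξ)
      rwa [wt, if_neg (not_lt.2 (le_of_lt hξ))] at this
  let f' : Weighted α β := mk f hf
  refine ⟨f', Metric.tendsto_atTop.2 fun ε hε => ?_⟩
  obtain ⟨N, hN⟩ := hbound (ε / 4) (by positivity)
  refine ⟨N, fun n hn => ?_⟩
  have key : ∀ ξ, wt α β ξ * ‖(F n - f') ξ‖ ≤ ε / 4 := by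
    intro ξ
    refine le_trans (le_of_eq ?_) (hN n hn ξ)
    have h1 : g ξ = (wt α β ξ : ℂ) * f ξ := by
      simp only [f]
      rw [mul_inv_cancel_left₀ (Complex.ofReal_ne_zero.2 (wt_pos _ _ _).ne')]
    rw [dist_eq_norm, h1, ← mul_sub, norm_mul, Complex.norm_real,
      Real.norm_of_nonneg (wt_pos _ _ _).le]
    rfl
  rw [dist_eq_norm, norm_def]
  have : Nonempty (Set.Iio (0 : ℝ)) := ⟨⟨-1, by simp⟩⟩
  have : Nonempty (Set.Ioi (0 : ℝ)) := ⟨⟨1, by simp⟩⟩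
  have h1 : (⨆ ξ : Set.Iio (0 : ℝ), Real.exp (α * ξ) * ‖(F n - f') ξ‖) ≤ ε / 4 :=
    ciSup_le fun ξ => by
      have := key ξ
      rwa [wt, if_pos (Set.mem_Iio.1 ξ.2)] at this
  have h2 : (⨆ ξ : Set.Ioi (0 : ℝ), Real.exp (β * ξ) * ‖(F n - f') ξ‖) ≤ ε / 4 :=
    ciSup_le fun ξ => by
      have := key ξ
      rwa [wt, if_neg (not_lt.2 (le_of_lt ξ.2))] at this
  linarith

/-- `w` is the classical derivative of `u` on `ℝ ∖ {0}`. -/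
def HasDeriv (u w : Weighted α β) : Prop := ∀ ξ : ℝ, ξ ≠ 0 → HasDerivAt u (w ξ) ξ

theorem HasDeriv.unique {u w w' : Weighted α β} (h : HasDeriv u w) (h' : HasDeriv u w') :
    w = w' :=
  ext_ne fun ξ hξ => (h ξ hξ).unique (h' ξ hξ)

theorem HasDeriv.add {u w u' w' : Weighted α β} (h : HasDeriv u w) (h' : HasDeriv u' w') :
    HasDeriv (u + u') (w + w') :=
  fun ξ hξ => (h ξ hξ).add (h' ξ hξ)

theorem HasDeriv.smul (c : ℂ) {u w : Weighted α β} (h : HasDeriv u w) :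
    HasDeriv (c • u) (c • w) :=
  fun ξ hξ => (h ξ hξ).const_smul c

theorem HasDeriv.zero : HasDeriv (0 : Weighted α β) 0 :=
  fun ξ _ => hasDerivAt_const ξ (0 : ℂ)

/-- Multiplication by the characteristic function `χ₋` of `(-∞, 0)`; since the result vanishes
on `(0, ∞)`, the weight on that half-line is immaterial. -/
def chiNeg (α β β' : ℝ) : Weighted α β →ₗ[ℂ] Weighted α β' where
  toFun v := mk (fun ξ => if ξ < 0 then v ξ else 0) (by
    have hn : Set.EqOn (fun ξ : ℝ => if ξ < 0 then v ξ else 0) v (Set.Iio 0) :=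
      fun ξ hξ => if_pos hξ
    have hp : Set.EqOn (fun ξ : ℝ => if ξ < 0 then v ξ else 0) (fun _ => 0) (Set.Ici 0) :=
      fun ξ hξ => if_neg (not_lt.2 hξ)
    refine ⟨v.isWeighted.cont_neg.congr hn, continuousOn_const.congr hp, ?_, ?_,
      ⟨0, fun ξ hξ => ?_⟩⟩
    · refine ⟨_, v.tendsto_neg.congr' ?_⟩
      filter_upwards [self_mem_nhdsWithin] with ξ hξ using (hn hξ).symm
    · obtain ⟨C, hC⟩ := v.isWeighted.bdd_neg
      exact ⟨C, fun ξ hξ => by simpa [hξ] using hC ξ hξ⟩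
    · simp [not_lt.2 (le_of_lt hξ)])
  map_add' u v := ext fun ξ => by
    change (if ξ < 0 then u ξ + v ξ else 0) = (if ξ < 0 then u ξ else 0) + if ξ < 0 then v ξ else 0
    split_ifs <;> simp
  map_smul' c u := ext fun ξ => by
    change (if ξ < 0 then c * u ξ else 0) = c * if ξ < 0 then u ξ else 0
    split_ifs <;> simp

end Weighted

/-! ### The space `𝒲` and the realization `L` -/

/-- The space `𝒲` of pairs `𝐮 = (u, v)`: both components have weight `e^{ξ/2}` on `(-∞, 0)`; on
`(0, ∞)` the weights are `e^{ξ/2}` for `u` and `e^{Le ξ/2}` for `v`. The norm is the sum of the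
four weighted suprema. -/
abbrev W (Le : ℝ) : Type := WithLp 1 (Weighted (1 / 2) (1 / 2) × Weighted (1 / 2) (Le / 2))

theorem norm_W {Le : ℝ} (U : W Le) : ‖U‖ =
    (⨆ ξ : Set.Iio (0 : ℝ), Real.exp (1 / 2 * ξ) * ‖U.fst ξ‖) +
    (⨆ ξ : Set.Ioi (0 : ℝ), Real.exp (1 / 2 * ξ) * ‖U.fst ξ‖) +
    ((⨆ ξ : Set.Iio (0 : ℝ), Real.exp (1 / 2 * ξ) * ‖U.snd ξ‖) +
    ⨆ ξ : Set.Ioi (0 : ℝ), Real.exp (Le / 2 * ξ) * ‖U.snd ξ‖) := by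
  rw [WithLp.prod_norm_eq_of_L1, Weighted.norm_def, Weighted.norm_def]

/-- The normalizing factor `A = Θᵢ/(1-Θᵢ) · (1 + Θᵢ/(Le (1-Θᵢ)))`. -/
def coeffA (Θi Le : ℝ) : ℝ := Θi / (1 - Θi) * (1 + Θi / (Le * (1 - Θi)))

/-- `U' = V` and `V' = Z` on `ℝ ∖ {0}`, and `U` satisfies the interface conditions
`[u] = [v] = 0`, `[u'] = -u(0)/(1-Θᵢ)`, `[v'] = Le u(0)/(1-Θᵢ)`. -/
structure IsDomainTriple (Θi Le : ℝ) (U V Z : W Le) : Prop where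
  deriv_fst : Weighted.HasDeriv U.fst V.fst
  deriv_snd : Weighted.HasDeriv U.snd V.snd
  deriv2_fst : Weighted.HasDeriv V.fst Z.fst
  deriv2_snd : Weighted.HasDeriv V.snd Z.snd
  jump_fst : jump U.fst = 0
  jump_snd : jump U.snd = 0
  jump_deriv_fst : jump V.fst = -(U.fst 0 / (1 - Θi))
  jump_deriv_snd : jump V.snd = Le * U.fst 0 / (1 - Θi)

theorem IsDomainTriple.add {Θi Le : ℝ} {U V Z U' V' Z' : W Le}
    (h : IsDomainTriple Θi Le U V Z) (h' : IsDomainTriple Θi Le U' V' Z') :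
    IsDomainTriple Θi Le (U + U') (V + V') (Z + Z') where
  deriv_fst := h.deriv_fst.add h'.deriv_fst
  deriv_snd := h.deriv_snd.add h'.deriv_snd
  deriv2_fst := h.deriv2_fst.add h'.deriv2_fst
  deriv2_snd := h.deriv2_snd.add h'.deriv2_snd
  jump_fst := by rw [WithLp.add_fst, Weighted.jump_add, h.jump_fst, h'.jump_fst, add_zero]
  jump_snd := by rw [WithLp.add_snd, Weighted.jump_add, h.jump_snd, h'.jump_snd, add_zero]
  jump_deriv_fst := by
    rw [WithLp.add_fst, Weighted.jump_add, h.jump_deriv_fst, h'.jump_deriv_fst, WithLp.add_fst,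
      Weighted.add_apply]
    ring
  jump_deriv_snd := by
    rw [WithLp.add_snd, Weighted.jump_add, h.jump_deriv_snd, h'.jump_deriv_snd, WithLp.add_fst,
      Weighted.add_apply]
    ring

theorem IsDomainTriple.smul {Θi Le : ℝ} (c : ℂ) {U V Z : W Le}
    (h : IsDomainTriple Θi Le U V Z) : IsDomainTriple Θi Le (c • U) (c • V) (c • Z) where
  deriv_fst := h.deriv_fst.smul c
  deriv_snd := h.deriv_snd.smul c
  deriv2_fst := h.deriv2_fst.smul c
  deriv2_snd := h.deriv2_snd.smul c
  jump_fst := by rw [WithLp.smul_fst, Weighted.jump_smul, h.jump_fst, mul_zero]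
  jump_snd := by rw [WithLp.smul_snd, Weighted.jump_smul, h.jump_snd, mul_zero]
  jump_deriv_fst := by
    rw [WithLp.smul_fst, Weighted.jump_smul, h.jump_deriv_fst, WithLp.smul_fst,
      Weighted.smul_apply]
    ring
  jump_deriv_snd := by
    rw [WithLp.smul_snd, Weighted.jump_smul, h.jump_deriv_snd, WithLp.smul_fst,
      Weighted.smul_apply]
    ring

theorem IsDomainTriple.zero (Θi Le : ℝ) : IsDomainTriple Θi Le (0 : W Le) 0 0 := by
  have h0 : jump (0 : Weighted (1 / 2) (1 / 2)) = 0 := by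
    simpa using Weighted.jump_smul 0 (0 : Weighted (1 / 2) (1 / 2))
  have h1 : jump (0 : Weighted (1 / 2) (Le / 2)) = 0 := by
    simpa using Weighted.jump_smul 0 (0 : Weighted (1 / 2) (Le / 2))
  have h2 : (0 : Weighted (1 / 2) (1 / 2)) 0 = 0 := rfl
  refine ⟨.zero, .zero, .zero, .zero, h0, h1, ?_, ?_⟩
  · rw [WithLp.zero_fst, h0, h2]; simp
  · rw [WithLp.zero_snd, WithLp.zero_fst, h1, h2]; simp

theorem IsDomainTriple.unique {Θi Le : ℝ} {U V Z V' Z' : W Le}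
    (h : IsDomainTriple Θi Le U V Z) (h' : IsDomainTriple Θi Le U V' Z') : V = V' ∧ Z = Z' := by
  obtain ⟨⟨V₁, V₂⟩⟩ := V
  obtain ⟨⟨V₁', V₂'⟩⟩ := V'
  obtain ⟨⟨Z₁, Z₂⟩⟩ := Z
  obtain ⟨⟨Z₁', Z₂'⟩⟩ := Z'
  obtain rfl : V₁ = V₁' := h.deriv_fst.unique h'.deriv_fst
  obtain rfl : V₂ = V₂' := h.deriv_snd.unique h'.deriv_snd
  obtain rfl : Z₁ = Z₁' := h.deriv2_fst.unique h'.deriv2_fst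
  obtain rfl : Z₂ = Z₂' := h.deriv2_snd.unique h'.deriv2_snd
  exact ⟨rfl, rfl⟩

/-- The domain `D(L)`. -/
def domainL (Θi Le : ℝ) : Submodule ℂ (W Le) where
  carrier := {U | ∃ V Z : W Le, IsDomainTriple Θi Le U V Z}
  zero_mem' := ⟨0, 0, .zero Θi Le⟩
  add_mem' := fun ⟨V, Z, h⟩ ⟨V', Z', h'⟩ => ⟨V + V', Z + Z', h.add h'⟩
  smul_mem' := fun c _ ⟨V, Z, h⟩ => ⟨c • V, c • Z, h.smul c⟩

/-- The formal differential operator, applied to `U` with `U' = V` and `U'' = Z`: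
`(u'' + u' + A χ₋ v, Le⁻¹ v'' + v' - A χ₋ v)`. -/
def formalL (Θi Le : ℝ) (U V Z : W Le) : W Le :=
  WithLp.toLp 1
    (Z.fst + V.fst + (coeffA Θi Le : ℂ) • Weighted.chiNeg (1 / 2) (Le / 2) (1 / 2) U.snd,
      (Le : ℂ)⁻¹ • Z.snd + V.snd
        - (coeffA Θi Le : ℂ) • Weighted.chiNeg (1 / 2) (Le / 2) (Le / 2) U.snd)

theorem formalL_add (Θi Le : ℝ) (U V Z U' V' Z' : W Le) :
    formalL Θi Le (U + U') (V + V') (Z + Z') = formalL Θi Le U V Z + formalL Θi Le U' V' Z' := by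
  simp only [formalL, ← WithLp.toLp_add, WithLp.add_fst, WithLp.add_snd, map_add, Prod.mk_add_mk]
  congr 2 <;> module

theorem formalL_smul (Θi Le : ℝ) (c : ℂ) (U V Z : W Le) :
    formalL Θi Le (c • U) (c • V) (c • Z) = c • formalL Θi Le U V Z := by
  simp only [formalL, ← WithLp.toLp_smul, WithLp.smul_fst, WithLp.smul_snd, map_smul,
    Prod.smul_mk]
  congr 2 <;> module

/-- The first derivative of an element of `D(L)`. -/
def derivL {Θi Le : ℝ} (U : domainL Θi Le) : W Le := Classical.choose U.2

/-- The second derivative of an element of `D(L)`. -/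
def derivL2 {Θi Le : ℝ} (U : domainL Θi Le) : W Le :=
  Classical.choose (Classical.choose_spec U.2)

theorem isDomainTriple_derivL {Θi Le : ℝ} (U : domainL Θi Le) :
    IsDomainTriple Θi Le U (derivL U) (derivL2 U) :=
  Classical.choose_spec (Classical.choose_spec U.2)

/-- The realization `L` in `𝒲`, with domain `D(L)`. -/
def L (Θi Le : ℝ) : W Le →ₗ.[ℂ] W Le where
  domain := domainL Θi Le
  toFun :=
    { toFun := fun U => formalL Θi Le U (derivL U) (derivL2 U)
      map_add' := fun U U' => by
        obtain ⟨h1, h2⟩ := (isDomainTriple_derivL (U + U')).unique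
          ((isDomainTriple_derivL U).add (isDomainTriple_derivL U'))
        rw [h1, h2]
        exact formalL_add _ _ _ _ _ _ _ _
      map_smul' := fun c U => by
        obtain ⟨h1, h2⟩ := (isDomainTriple_derivL (c • U)).unique
          ((isDomainTriple_derivL U).smul c)
        rw [h1, h2]
        exact formalL_smul _ _ _ _ _ _ }

theorem L_apply {Θi Le : ℝ} {U V Z : W Le} (h : IsDomainTriple Θi Le U V Z)
    (hU : U ∈ (L Θi Le).domain) : L Θi Le ⟨U, hU⟩ = formalL Θi Le U V Z := by
  have hU' : U ∈ domainL Θi Le := hU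
  obtain ⟨h1, h2⟩ := (isDomainTriple_derivL ⟨U, hU'⟩).unique h
  exact congrArg₂ (formalL Θi Le U) h1 h2

/-! ### Unbounded operators: resolvent, spectrum, sectoriality, analytic semigroups -/

section Operators

variable {X : Type*} [NormedAddCommGroup X] [NormedSpace ℂ X]

/-- The bounded operator `R` is the two-sided inverse of `lam - A : D(A) → X`. -/
def IsResolventOf (A : X →ₗ.[ℂ] X) (lam : ℂ) (R : X →L[ℂ] X) : Prop :=
  (∀ f : X, ∃ h : R f ∈ A.domain, lam • R f - A ⟨R f, h⟩ = f) ∧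
    ∀ x : A.domain, R (lam • (x : X) - A x) = x

/-- The resolvent set of an unbounded operator. -/
def opResolventSet (A : X →ₗ.[ℂ] X) : Set ℂ := {lam | ∃ R : X →L[ℂ] X, IsResolventOf A lam R}

/-- The spectrum of an unbounded operator. -/
def opSpectrum (A : X →ₗ.[ℂ] X) : Set ℂ := (opResolventSet A)ᶜ

open Classical in
/-- The resolvent operator `R(lam, A)` (and `0` if `lam` is in the spectrum). -/
def opResolvent (A : X →ₗ.[ℂ] X) (lam : ℂ) : X →L[ℂ] X :=
  if h : ∃ R : X →L[ℂ] X, IsResolventOf A lam R then h.choose else 0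

/-- The eigenspace `ker (lam - A)`. -/
def opEigenspace (A : X →ₗ.[ℂ] X) (lam : ℂ) : Submodule ℂ X where
  carrier := {x | ∃ h : x ∈ A.domain, A ⟨x, h⟩ = lam • x}
  zero_mem' := ⟨A.domain.zero_mem, by
    rw [smul_zero]
    exact A.map_zero⟩
  add_mem' := by
    rintro x y ⟨hx, hx'⟩ ⟨hy, hy'⟩
    refine ⟨A.domain.add_mem hx hy, ?_⟩
    rw [smul_add, ← hx', ← hy', ← A.map_add]
    rfl
  smul_mem' := by
    rintro c x ⟨hx, hx'⟩
    refine ⟨A.domain.smul_mem c hx, ?_⟩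
    rw [smul_comm, ← hx', ← A.map_smul]
    rfl

/-- `lam` is an eigenvalue of `A`. -/
def IsEigenvalue (A : X →ₗ.[ℂ] X) (lam : ℂ) : Prop := opEigenspace A lam ≠ ⊥

/-- `lam₀` is a simple isolated eigenvalue: it is isolated in the spectrum, its eigenspace is
one-dimensional, and it is a simple pole of the resolvent; equivalently, it is an isolated point
of the spectrum of algebraic multiplicity one. -/
structure IsSimpleIsolatedEigenvalue (A : X →ₗ.[ℂ] X) (lam₀ : ℂ) : Prop where
  isolated : ∀ᶠ lam in 𝓝[≠] lam₀, lam ∈ opResolventSet A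
  finrank_eigenspace : Module.finrank ℂ (opEigenspace A lam₀) = 1
  simple_pole : meromorphicOrderAt (opResolvent A) lam₀ = ((-1 : ℤ) : WithTop ℤ)

/-- `A` is sectorial: there are `ω ∈ ℝ`, `θ ∈ (π/2, π)` and `M > 0` such that the resolvent set
contains `{lam ≠ ω : |arg (lam - ω)| < θ}`, and `‖R(lam, A)‖ ≤ M / |lam - ω|` there. The domain is
not required to be dense. -/
def IsSectorial (A : X →ₗ.[ℂ] X) : Prop :=
  ∃ ω θ M : ℝ, Real.pi / 2 < θ ∧ θ < Real.pi ∧ 0 < M ∧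
    ∀ lam : ℂ, lam ≠ ω → |(lam - ω).arg| < θ →
      lam ∈ opResolventSet A ∧ ‖opResolvent A lam‖ ≤ M / ‖lam - ω‖

/-- The open sector `{z ≠ 0 : |arg z| < φ}`. -/
def sector (φ : ℝ) : Set ℂ := {z | z ≠ 0 ∧ |z.arg| < φ}

/-- `A` generates an analytic semigroup: there is a family `T` of bounded operators, with
`T 0 = 1`, holomorphic for the operator norm in an open sector around `(0, ∞)`, exponentially
bounded and multiplicative there, whose Laplace transform is the resolvent of `A`. Since `A` need
not be densely defined, `T` need not be strongly continuous at `0`. -/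
def GeneratesAnalyticSemigroup (A : X →ₗ.[ℂ] X) : Prop :=
  ∃ (T : ℂ → X →L[ℂ] X) (φ ω M : ℝ), 0 < φ ∧ φ ≤ Real.pi / 2 ∧
    T 0 = 1 ∧
    (∀ z ∈ sector φ, ∀ w ∈ sector φ, T (z + w) = T z * T w) ∧
    DifferentiableOn ℂ T (sector φ) ∧
    (∀ z ∈ sector φ, ‖T z‖ ≤ M * Real.exp (ω * z.re)) ∧
    ∀ lam : ℂ, ω < lam.re → lam ∈ opResolventSet A ∧
      ∀ f : X, opResolvent A lam f =
        ∫ t in Set.Ioi (0 : ℝ), Complex.exp (-lam * t) • T t f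

end Operators

/-! ### The travelling wave, the region `𝒫`, and the dispersion relation -/

/-- Temperature profile `Θ⁰` of the travelling wave. -/
def waveTheta (Θi z : ℝ) : ℝ :=
  if z < 0 then 1 - (1 - Θi) * Real.exp (Θi / (1 - Θi) * z) else Θi * Real.exp (-z)

/-- Concentration profile `Φ⁰` of the travelling wave. -/
def wavePhi (Θi Le z : ℝ) : ℝ :=
  if z < 0 then Θi / (coeffA Θi Le * (1 - Θi)) * Real.exp (Θi / (1 - Θi) * z)
  else 1 + (Θi / (coeffA Θi Le * (1 - Θi)) - 1) * Real.exp (-Le * z)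

/-- `E ∈ 𝒲` is the derivative `d𝐔/dξ` of the travelling wave `𝐔 = (Θ⁰, Φ⁰)`. -/
def IsWaveDerivative (Θi Le : ℝ) (E : W Le) : Prop :=
  ∀ ξ : ℝ, ξ ≠ 0 → HasDerivAt (fun z : ℝ => (waveTheta Θi z : ℂ)) (E.fst ξ) ξ ∧
    HasDerivAt (fun z : ℝ => (wavePhi Θi Le z : ℂ)) (E.snd ξ) ξ

/-- The half-line `(-∞, -1/4]`. -/
def halfLine : Set ℂ := {lam | lam.im = 0 ∧ lam.re ≤ -(1 / 4)}

/-- The closed parabolic region `𝒫`. -/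
def regionP (Θi Le : ℝ) : Set ℂ :=
  {lam | (1 - 1 / Le) ^ 2 * lam.re + 1 / Le * lam.im ^ 2 +
    ((2 * coeffA Θi Le + 1) / 2 - (8 * coeffA Θi Le + 5) / (4 * Le)
      + (1 + coeffA Θi Le) / Le ^ 2 - 1 / (4 * Le ^ 3)) ≤ 0}

/-- Principal square root. -/
def csqrt (z : ℂ) : ℂ := z ^ (1 / 2 : ℂ)

def H1 (lam : ℂ) : ℂ := csqrt (1 + 4 * lam)

def H2 (Θi Le : ℝ) (lam : ℂ) : ℂ := csqrt (Le ^ 2 + 4 * Le * (coeffA Θi Le + lam))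

def H3 (Le : ℝ) (lam : ℂ) : ℂ := csqrt (Le ^ 2 + 4 * Le * lam)

def k2 (lam : ℂ) : ℂ := (-1 - H1 lam) / 2

def k3 (Θi Le : ℝ) (lam : ℂ) : ℂ := (-Le + H2 Θi Le lam) / 2

def k6 (Le : ℝ) (lam : ℂ) : ℂ := (-Le - H3 Le lam) / 2

/-- The dispersion relation `D(lam; Θᵢ, Le)`. -/
def dispersion (Θi Le : ℝ) (lam : ℂ) : ℂ :=
  (k6 Le lam - k3 Θi Le lam) * (k3 Θi Le lam - k2 lam) *
    (1 - (1 - Θi) * csqrt (1 + 4 * lam)) + coeffA Θi Le * Le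

end

end Flame

namespace Flame
open Filter Topology MeasureTheory

/-! ### A scalar inversion integral -/

/-! On each half-line the equation `lam U - L U = F` has constant coefficients, with exponents k1,
k2 for the first component and k3, k4 (left) or k5, k6 (right) for the second. Adding the exponent
of the weight to the real parts gives plus or minus half the real part of a square root, with one
exception: for the second component on the left the weight is not centred between the exponents, and
Re k3 + 1/2 = (Re H2 - (Le - 1))/2. This quantity is positive exactly off 𝒫 (`mem_regionP_iff`),
while Re H1 and Re H3 are positive off the half-line.

Off the half-line and 𝒫, each second-order operator therefore splits into two first-order factors,
one whose bounded solution is unique and one admitting any value at the interface. The solution is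
determined, with estimates, by F and the two numbers a = u(0), b = v(0) (`apriori`,
`AuxSolution.exists_triple`). The jump conditions become a 2×2 linear system for (a, b) whose
determinant is, up to nonvanishing factors, the dispersion function D (`dispersion_eq`). If D ≠ 0,
Cramer's rule gives the resolvent with norm at most C(1 + 1/|D|); if D = 0, a null vector of the
system gives an eigenfunction.

The half-line lies in the spectrum because of explicit oscillating eigenfunctions, and the interior
of 𝒫 because no solution exists for the right-hand side (χ₋, 0); closedness of the spectrum supplies
the boundaries. At 0 the function D has a simple zero, so the resolvent is O(1/|lam|) there;
together with the eigenvector given by the wave derivative this is a simple pole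
(`meromorphicOrderAt_opResolvent`). Eigenfunctions are determined by u(0), so the kernel is a line.

In a sector the square roots have real part of order |lam - ω|^(1/2), the interface system is
diagonally dominant, and the a priori estimates give sectoriality. The semigroup comes from a
general theorem for sectorial pseudo-resolvents, without density of the domain: it is an inverse
Laplace integral of the squared resolvent, whose properties are obtained after multiplication by a
resolvent operator. -/

theorem integrableOn_Ioi_mul_exp_neg :
    IntegrableOn (fun t : ℝ => t * Real.exp (-t)) (Set.Ioi 0) := by
  have h := Real.GammaIntegral_convergent (s := 2) (by norm_num)
  refine h.congr_fun (fun t _ => ?_) measurableSet_Ioi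
  norm_num [mul_comm]

/-- The integrand has an elementary antiderivative. Taken along Re c = 1, this exhibits (1 + is)⁻²
as a Fourier transform. -/
theorem integral_Ioi_mul_exp_neg_mul {c : ℂ} (hc : c.re = 1) :
    ∫ t in Set.Ioi (0 : ℝ), (t : ℂ) * Complex.exp (-(c * t)) = (c ^ 2)⁻¹ := by
  have hc0 : c ≠ 0 := by rintro rfl; simp at hc
  have hn : ∀ t : ℝ, ‖Complex.exp (-(c * t))‖ = Real.exp (-t) := fun t => by
    rw [Complex.norm_exp]; simp [hc]
  have hd : ∀ t : ℝ, HasDerivAt (fun t : ℝ => -((t : ℂ) / c + 1 / c ^ 2) * Complex.exp (-(c * t)))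
      ((t : ℂ) * Complex.exp (-(c * t))) t := by
    intro t
    have h1 : HasDerivAt (fun t : ℝ => (t : ℂ)) 1 t := Complex.ofRealCLM.hasDerivAt
    have h2 := ((h1.div_const c).add_const (1 / c ^ 2)).neg.mul ((h1.const_mul c).neg.cexp)
    refine h2.congr_deriv ?_
    simp only [Pi.neg_apply]
    field_simp
    ring
  have hlim : Tendsto (fun t : ℝ => -((t : ℂ) / c + 1 / c ^ 2) * Complex.exp (-(c * t)))
      atTop (𝓝 0) := by
    rw [tendsto_zero_iff_norm_tendsto_zero]
    have h1 : Tendsto (fun t : ℝ => t ^ 1 * Real.exp (-t)) atTop (𝓝 0) :=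
      Real.tendsto_pow_mul_exp_neg_atTop_nhds_zero 1
    have h0 : Tendsto (fun t : ℝ => t ^ 0 * Real.exp (-t)) atTop (𝓝 0) :=
      Real.tendsto_pow_mul_exp_neg_atTop_nhds_zero 0
    have h2 := (h1.const_mul (1 / ‖c‖)).add (h0.const_mul (1 / ‖c‖ ^ 2))
    simp only [mul_zero, add_zero] at h2
    refine squeeze_zero' (Eventually.of_forall fun _ => norm_nonneg _) ?_ h2
    filter_upwards [eventually_ge_atTop 0] with t ht
    rw [norm_mul, hn, norm_neg]
    have h3 : ‖(t : ℂ) / c + 1 / c ^ 2‖ ≤ t / ‖c‖ + 1 / ‖c‖ ^ 2 := by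
      refine (norm_add_le _ _).trans (le_of_eq ?_)
      rw [norm_div, norm_div, norm_pow, Complex.norm_real, Real.norm_of_nonneg ht, norm_one]
    calc _ ≤ (t / ‖c‖ + 1 / ‖c‖ ^ 2) * Real.exp (-t) := by gcongr
      _ = _ := by ring
  have hinteg : IntegrableOn (fun t : ℝ => (t : ℂ) * Complex.exp (-(c * t))) (Set.Ioi 0) := by
    refine integrableOn_Ioi_mul_exp_neg.mono' (by fun_prop) ?_
    refine (ae_restrict_mem measurableSet_Ioi).mono fun t ht => ?_
    rw [norm_mul, hn, Complex.norm_real, Real.norm_of_nonneg (le_of_lt ht)]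
  rw [integral_Ioi_of_hasDerivAt_of_tendsto' (fun t _ => hd t) hinteg hlim]
  simp

theorem norm_one_add_mul_I_sq (s : ℝ) : ‖1 + s * Complex.I‖ ^ 2 = 1 + s ^ 2 := by
  rw [← Complex.normSq_eq_norm_sq, Complex.normSq_apply]; simp; ring

theorem one_add_mul_I_ne_zero (s : ℝ) : 1 + s * Complex.I ≠ 0 := fun h => by
  have := congrArg Complex.re h; simp at this

theorem integrable_inv_one_add_mul_I_sq :
    Integrable (fun s : ℝ => ((1 + s * Complex.I) ^ 2)⁻¹) := by
  refine integrable_inv_one_add_sq.mono'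
    (Continuous.aestronglyMeasurable (Continuous.inv₀ (by fun_prop)
      fun s => pow_ne_zero 2 (one_add_mul_I_ne_zero s))) (ae_of_all _ fun s => ?_)
  rw [norm_inv, norm_pow, norm_one_add_mul_I_sq]

/-- Fourier inversion at t = 1 for the function t e^{-t} on (0, ∞). The square makes the transform
absolutely integrable, and the value fixes the normalizing constant e/(2π) of `semigroup`. -/
theorem integral_exp_mul_inv_sq :
    ∫ s : ℝ, Complex.exp (s * Complex.I) * ((1 + s * Complex.I) ^ 2)⁻¹ =
      2 * Real.pi * Complex.exp (-1) := by
  let f : ℝ → ℂ := Set.indicator (Set.Ioi 0) fun t => ((t * Real.exp (-t) : ℝ) : ℂ)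
  have hf : Integrable f := by
    rw [integrable_indicator_iff measurableSet_Ioi]
    exact integrableOn_Ioi_mul_exp_neg.ofReal
  have hF : ∀ x : ℝ, FourierTransform.fourier f x =
      ((1 + ((2 * Real.pi * x : ℝ) : ℂ) * Complex.I) ^ 2)⁻¹ := by
    intro x
    rw [Real.fourier_real_eq_integral_exp_smul,
      ← integral_Ioi_mul_exp_neg_mul (c := 1 + ((2 * Real.pi * x : ℝ) : ℂ) * Complex.I) (by simp),
      ← integral_indicator measurableSet_Ioi]
    congr 1
    ext t
    by_cases ht : t ∈ Set.Ioi (0 : ℝ)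
    · simp only [f, Set.indicator_of_mem ht, smul_eq_mul]
      push_cast
      rw [mul_left_comm, ← Complex.exp_add]
      congr 2
      ring
    · simp only [f, Set.indicator_of_notMem ht, smul_zero]
  have hpi : (2 * Real.pi) ≠ 0 := by positivity
  have hFi : Integrable (FourierTransform.fourier f) := by
    rw [show FourierTransform.fourier f = _ from funext hF]
    exact integrable_inv_one_add_mul_I_sq.comp_mul_left' hpi
  have hc : ContinuousAt f 1 := by
    have : ContinuousAt (fun t : ℝ => ((t * Real.exp (-t) : ℝ) : ℂ)) 1 := by fun_prop
    refine this.congr ?_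
    filter_upwards [Ioi_mem_nhds (zero_lt_one' ℝ)] with t ht
    exact (Set.indicator_of_mem (s := Set.Ioi (0 : ℝ)) ht
      fun t : ℝ => ((t * Real.exp (-t) : ℝ) : ℂ)).symm
  have h := hf.fourierInv_fourier_eq hFi hc
  rw [Real.fourierInv_eq'] at h
  have h2 : ∀ v : ℝ, Complex.exp (((2 * Real.pi * inner ℝ v 1 : ℝ) : ℂ) * Complex.I) •
      FourierTransform.fourier f v = (fun s : ℝ => Complex.exp (s * Complex.I) *
        ((1 + s * Complex.I) ^ 2)⁻¹) (2 * Real.pi * v) := fun v => by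
    rw [hF]; simp
  rw [integral_congr_ae (ae_of_all _ h2), Measure.integral_comp_mul_left
    (fun s : ℝ => Complex.exp (s * Complex.I) * ((1 + s * Complex.I) ^ 2)⁻¹)] at h
  have h3 : f 1 = Complex.exp (-1) := by
    simp [f]
  rw [h3, abs_of_pos (by positivity)] at h
  rw [← h, Complex.real_smul]
  push_cast
  rw [← mul_assoc, mul_inv_cancel₀ (by exact_mod_cast hpi), one_mul]

/-! ### Analytic semigroups from pseudo-resolvents -/

/-- A pseudo-resolvent `J` on the sector `{ν : re ν > -δ |ν|}`, with the bound `M / |ν|`. -/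
structure IsSectorialPseudoResolvent {𝔸 : Type*} [NormedRing 𝔸] [NormedAlgebra ℂ 𝔸]
    (J : ℂ → 𝔸) (δ M : ℝ) : Prop where
  δ_pos : 0 < δ
  δ_lt_one : δ < 1
  M_pos : 0 < M
  hasDerivAt : ∀ ν : ℂ, -δ * ‖ν‖ < ν.re → HasDerivAt J (-(J ν * J ν)) ν
  identity : ∀ ν ν' : ℂ, -δ * ‖ν‖ < ν.re → -δ * ‖ν'‖ < ν'.re →
    J ν - J ν' = (ν' - ν) • (J ν * J ν')
  norm_le : ∀ ν : ℂ, -δ * ‖ν‖ < ν.re → ‖J ν‖ ≤ M / ‖ν‖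

/-- The sector of all `z` such that `μ / z` is in the sector of `J` whenever `re μ > 0`. -/
def timeSector (δ : ℝ) : Set ℂ := {z | Real.sqrt (1 - δ ^ 2) * ‖z‖ < z.re}

theorem isOpen_timeSector (δ : ℝ) : IsOpen (timeSector δ) :=
  isOpen_lt (by fun_prop) Complex.continuous_re

theorem add_mem_timeSector {δ : ℝ} {z w : ℂ} (hz : z ∈ timeSector δ) (hw : w ∈ timeSector δ) :
    z + w ∈ timeSector δ := by
  simp only [timeSector, Set.mem_ofPred_eq, Complex.add_re] at *
  have := mul_le_mul_of_nonneg_left (norm_add_le z w) (Real.sqrt_nonneg (1 - δ ^ 2))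
  linarith

theorem smul_mem_timeSector {δ : ℝ} {z : ℂ} (hz : z ∈ timeSector δ) {x : ℝ} (hx : 0 < x) :
    (x : ℂ) * z ∈ timeSector δ := by
  simp only [timeSector, Set.mem_ofPred_eq] at *
  rw [norm_mul, Complex.re_ofReal_mul, Complex.norm_real, Real.norm_of_nonneg hx.le,
    mul_left_comm]
  exact mul_lt_mul_of_pos_left hz hx

theorem ofReal_mem_timeSector {δ : ℝ} (hδ : 0 < δ) {t : ℝ} (ht : 0 < t) :
    (t : ℂ) ∈ timeSector δ := by
  simp only [timeSector, Set.mem_ofPred_eq, Complex.norm_real, Complex.ofReal_re,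
    Real.norm_of_nonneg ht.le]
  have : Real.sqrt (1 - δ ^ 2) < 1 := by
    rw [Real.sqrt_lt' one_pos]; nlinarith
  nlinarith

theorem re_pos_of_mem_timeSector {δ : ℝ} {z : ℂ} (hz : z ∈ timeSector δ) : 0 < z.re :=
  (mul_nonneg (Real.sqrt_nonneg _) (norm_nonneg _)).trans_lt hz

theorem ne_zero_of_mem_timeSector {δ : ℝ} {z : ℂ} (hz : z ∈ timeSector δ) : z ≠ 0 := by
  rintro rfl; exact lt_irrefl _ (re_pos_of_mem_timeSector hz)

/-- A point z of the time sector has Re z > 0 and |Im z| ≤ δ|z|. Since μ / z is μ times the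
conjugate of z over |z|², its real part has numerator Re μ Re z + Im μ Im z, which exceeds -δ|μ||z|.
-/
theorem div_mem_sector {δ : ℝ} (hδ : 0 < δ) (hδ1 : δ < 1) {z μ : ℂ} (hz : z ∈ timeSector δ)
    (hμ : 0 < μ.re) : -δ * ‖μ / z‖ < (μ / z).re := by
  have hz0 := ne_zero_of_mem_timeSector hz
  have hzr := re_pos_of_mem_timeSector hz
  have hn : 0 < ‖z‖ := norm_pos_iff.2 hz0
  have hns : Complex.normSq z = ‖z‖ ^ 2 := Complex.normSq_eq_norm_sq z
  have h1 : |z.im| ≤ δ * ‖z‖ := by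
    refine abs_le_of_sq_le_sq ?_ (by positivity)
    have h2 : (1 - δ ^ 2) * ‖z‖ ^ 2 ≤ z.re ^ 2 := by
      have h3 : (Real.sqrt (1 - δ ^ 2) * ‖z‖) ^ 2 ≤ z.re ^ 2 :=
        pow_le_pow_left₀ (by positivity) (le_of_lt hz) 2
      rwa [mul_pow, Real.sq_sqrt (by nlinarith)] at h3
    have h4 : ‖z‖ ^ 2 = z.re ^ 2 + z.im ^ 2 := by
      rw [← hns, Complex.normSq_apply]; ring
    nlinarith
  have h5 : -(δ * ‖μ‖ * ‖z‖) < μ.re * z.re + μ.im * z.im := by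
    have h6 : |μ.im * z.im| ≤ ‖μ‖ * (δ * ‖z‖) := by
      rw [abs_mul]; exact mul_le_mul (Complex.abs_im_le_norm μ) h1 (abs_nonneg _) (norm_nonneg _)
    have h7 := neg_abs_le (μ.im * z.im)
    have h8 : 0 < μ.re * z.re := mul_pos hμ hzr
    nlinarith
  rw [Complex.div_re, norm_div, hns, ← add_div, ← mul_div_assoc, div_lt_div_iff₀ hn (by positivity)]
  nlinarith [mul_lt_mul_of_pos_right h5 hn]

/-! ### The semigroup of a sectorial pseudo-resolvent. -/

namespace IsSectorialPseudoResolvent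

variable {𝔸 : Type*} [NormedRing 𝔸] [NormedAlgebra ℂ 𝔸] {J : ℂ → 𝔸} {δ M : ℝ}

noncomputable section

/-- The operator `(μ - z A)⁻¹`, `μ = 1 + i s`, for the pseudo-resolvent of `A`. -/
def kern (J : ℂ → 𝔸) (z : ℂ) (s : ℝ) : 𝔸 := z⁻¹ • J ((1 + s * Complex.I) / z)

/-- The semigroup, as the inverse Laplace transform of the squared resolvent. -/
def semigroup (J : ℂ → 𝔸) (z : ℂ) : 𝔸 :=
  ((Real.exp 1 / (2 * Real.pi) : ℝ) : ℂ) •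
    ∫ s : ℝ, Complex.exp (s * Complex.I) • (kern J z s * kern J z s)

variable (h : IsSectorialPseudoResolvent J δ M)

include h

theorem div_mem {z : ℂ} (hz : z ∈ timeSector δ) (s : ℝ) :
    -δ * ‖(1 + s * Complex.I) / z‖ < ((1 + s * Complex.I) / z).re :=
  div_mem_sector h.δ_pos h.δ_lt_one hz (by simp)

/-- The factor z⁻¹ in `kern` compensates the scaling of the resolvent bound, so the estimate does
not depend on z. Hence one integrable majorant serves for the bound on the semigroup and for the
limit z → 0. -/
theorem norm_kern_le {z : ℂ} (hz : z ∈ timeSector δ) (s : ℝ) :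
    ‖kern J z s‖ ≤ M / ‖1 + s * Complex.I‖ := by
  have hz0 : 0 < ‖z‖ := norm_pos_iff.2 (ne_zero_of_mem_timeSector hz)
  have h2 : 0 < ‖1 + s * Complex.I‖ := norm_pos_iff.2 (one_add_mul_I_ne_zero s)
  rw [kern, norm_smul, norm_inv]
  calc ‖z‖⁻¹ * ‖J ((1 + s * Complex.I) / z)‖
      ≤ ‖z‖⁻¹ * (M / ‖(1 + s * Complex.I) / z‖) := by
        gcongr; exact h.norm_le _ (h.div_mem hz s)
    _ = _ := by rw [norm_div]; field_simp

omit h in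
theorem one_le_norm_one_add_mul_I (s : ℝ) : 1 ≤ ‖1 + s * Complex.I‖ := by
  simpa using (Complex.abs_re_le_norm (1 + s * Complex.I))

theorem norm_kern_le' {z : ℂ} (hz : z ∈ timeSector δ) (s : ℝ) : ‖kern J z s‖ ≤ M :=
  (h.norm_kern_le hz s).trans (div_le_self h.M_pos.le (one_le_norm_one_add_mul_I s))

theorem norm_kern_mul_kern_le {z : ℂ} (hz : z ∈ timeSector δ) (s : ℝ) :
    ‖kern J z s * kern J z s‖ ≤ M ^ 2 * (1 + s ^ 2)⁻¹ := by
  have := h.norm_kern_le hz s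
  have := h.M_pos
  calc _ ≤ ‖kern J z s‖ * ‖kern J z s‖ := norm_mul_le _ _
    _ ≤ (M / ‖1 + s * Complex.I‖) * (M / ‖1 + s * Complex.I‖) := by gcongr
    _ = M ^ 2 * (‖1 + s * Complex.I‖ ^ 2)⁻¹ := by ring
    _ = _ := by rw [norm_one_add_mul_I_sq]

theorem hasDerivAt_kern_right {z : ℂ} (hz : z ∈ timeSector δ) (s : ℝ) :
    HasDerivAt (kern J z) (-Complex.I • (kern J z s * kern J z s)) s := by
  have h1 : HasDerivAt (fun s : ℝ => (1 + s * Complex.I) / z) (Complex.I / z) s := by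
    have := (((Complex.ofRealCLM.hasDerivAt (x := s)).mul_const Complex.I).const_add 1).div_const z
    simpa using this
  have h2 := ((h.hasDerivAt _ (h.div_mem hz s)).scomp s h1).const_smul z⁻¹
  refine h2.congr_deriv ?_
  simp only [kern, smul_mul_smul_comm, smul_neg, smul_smul]
  rw [neg_mul, neg_smul]
  congr 2
  field_simp

theorem continuous_kern {z : ℂ} (hz : z ∈ timeSector δ) : Continuous (kern J z) :=
  continuous_iff_continuousAt.2 fun s => (h.hasDerivAt_kern_right hz s).continuousAt

/-- For K = (μ - zA)⁻¹ the derivative in z is K A K, and zAK = μK - 1. The formula is written with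
μK - 1 because a pseudo-resolvent comes without an operator A. -/
theorem hasDerivAt_kern_left {z : ℂ} (hz : z ∈ timeSector δ) (s : ℝ) :
    HasDerivAt (fun z => kern J z s)
      (z⁻¹ • (kern J z s * ((1 + s * Complex.I) • kern J z s - 1))) z := by
  have hz0 := ne_zero_of_mem_timeSector hz
  have h1 : HasDerivAt (fun z : ℂ => (1 + s * Complex.I) / z) (-(1 + s * Complex.I) / z ^ 2) z := by
    have := (hasDerivAt_inv hz0).const_mul (1 + s * Complex.I)
    refine (this.congr_deriv ?_)
    ring
  have h2 := (hasDerivAt_inv hz0).smul ((h.hasDerivAt _ (h.div_mem hz s)).scomp z h1)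
  refine h2.congr_deriv ?_
  simp only [kern, mul_sub, mul_one, smul_sub, mul_smul_comm, smul_mul_assoc, smul_smul, smul_neg,
    Function.comp]
  rw [sub_eq_add_neg, ← neg_smul, ← neg_smul]
  congr 2 <;> field_simp

theorem integrable_kern_mul_kern {z : ℂ} (hz : z ∈ timeSector δ) :
    Integrable fun s : ℝ => Complex.exp (s * Complex.I) • (kern J z s * kern J z s) := by
  have hc := h.continuous_kern hz
  refine (integrable_inv_one_add_sq.const_mul (M ^ 2)).mono'
    (Continuous.aestronglyMeasurable (by fun_prop)) (ae_of_all _ fun s => ?_)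
  rw [norm_smul, Complex.norm_exp_ofReal_mul_I, one_mul]
  exact h.norm_kern_mul_kern_le hz s

theorem norm_semigroup_le {z : ℂ} (hz : z ∈ timeSector δ) :
    ‖semigroup J z‖ ≤ Real.exp 1 / (2 * Real.pi) * (M ^ 2 * Real.pi) := by
  rw [semigroup, norm_smul, Complex.norm_real, Real.norm_of_nonneg (by positivity)]
  gcongr
  rw [← integral_univ_inv_one_add_sq, ← integral_const_mul]
  refine norm_integral_le_of_norm_le (integrable_inv_one_add_sq.const_mul (M ^ 2))
    (ae_of_all _ fun s => ?_)
  rw [norm_smul, Complex.norm_exp_ofReal_mul_I, one_mul]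
  exact h.norm_kern_mul_kern_le hz s

/-- The derivative of the integrand with respect to the time variable. -/
theorem hasDerivAt_semigroup [CompleteSpace 𝔸] {z : ℂ} (hz : z ∈ timeSector δ) :
    (Integrable fun s : ℝ => Complex.exp (s * Complex.I) • ((2 * z⁻¹) •
      (kern J z s * kern J z s * ((1 + s * Complex.I) • kern J z s - 1)))) ∧
    HasDerivAt (semigroup J) (((Real.exp 1 / (2 * Real.pi) : ℝ) : ℂ) •
      ∫ s : ℝ, Complex.exp (s * Complex.I) • ((2 * z⁻¹) •
        (kern J z s * kern J z s * ((1 + s * Complex.I) • kern J z s - 1)))) z := by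
  have hz0 : 0 < ‖z‖ := norm_pos_iff.2 (ne_zero_of_mem_timeSector hz)
  -- Keeping |w| above |z|/2 bounds the factor w⁻¹ of the derivative, so that one majorant works on
  -- a whole neighbourhood of z.
  have hs : timeSector δ ∩ {w : ℂ | ‖z‖ / 2 < ‖w‖} ∈ 𝓝 z :=
    ((isOpen_timeSector δ).inter (isOpen_lt continuous_const continuous_norm)).mem_nhds
      ⟨hz, by simpa using half_lt_self hz0⟩
  have hbound : ∀ s : ℝ, ∀ w ∈ timeSector δ ∩ {w : ℂ | ‖z‖ / 2 < ‖w‖},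
      ‖Complex.exp (s * Complex.I) • ((2 * w⁻¹) •
        (kern J w s * kern J w s * ((1 + s * Complex.I) • kern J w s - 1)))‖ ≤
      (4 / ‖z‖ * (M + ‖(1 : 𝔸)‖) * M ^ 2) * (1 + s ^ 2)⁻¹ := by
    rintro s w ⟨hw, hw'⟩
    have hw0 : 0 < ‖w‖ := norm_pos_iff.2 (ne_zero_of_mem_timeSector hw)
    have hμ : 0 < ‖1 + s * Complex.I‖ := norm_pos_iff.2 (one_add_mul_I_ne_zero s)
    rw [norm_smul, Complex.norm_exp_ofReal_mul_I, one_mul, norm_smul]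
    have h1 : ‖2 * w⁻¹‖ ≤ 4 / ‖z‖ := by
      rw [norm_mul, norm_inv, Complex.norm_ofNat, ← div_eq_mul_inv, div_le_div_iff₀ hw0 hz0]
      have : ‖z‖ / 2 < ‖w‖ := hw'
      linarith
    have h2 : ‖(1 + s * Complex.I) • kern J w s - 1‖ ≤ M + ‖(1 : 𝔸)‖ := by
      refine (norm_sub_le _ _).trans (add_le_add ?_ le_rfl)
      rw [norm_smul]
      calc _ ≤ ‖1 + s * Complex.I‖ * (M / ‖1 + s * Complex.I‖) := by
            gcongr; exact h.norm_kern_le hw s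
        _ = M := mul_div_cancel₀ _ hμ.ne'
    calc _ ≤ 4 / ‖z‖ * (M ^ 2 * (1 + s ^ 2)⁻¹ * (M + ‖(1 : 𝔸)‖)) := by
          gcongr
          refine (norm_mul_le _ _).trans ?_
          have := h.norm_kern_mul_kern_le hw s
          have := h.M_pos
          gcongr
      _ = _ := by ring
  have hc := h.continuous_kern hz
  have key := hasDerivAt_integral_of_dominated_loc_of_deriv_le (𝕜 := ℂ) (μ := volume)
    (F := fun z (s : ℝ) => Complex.exp (s * Complex.I) • (kern J z s * kern J z s))
    (F' := fun z (s : ℝ) => Complex.exp (s * Complex.I) • ((2 * z⁻¹) •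
        (kern J z s * kern J z s * ((1 + s * Complex.I) • kern J z s - 1))))
    (x₀ := z) hs ?_ (h.integrable_kern_mul_kern hz) (Continuous.aestronglyMeasurable (by fun_prop))
    (ae_of_all _ hbound) (integrable_inv_one_add_sq.const_mul _) (ae_of_all _ ?_)
  · exact ⟨key.1, key.2.const_smul ((Real.exp 1 / (2 * Real.pi) : ℝ) : ℂ)⟩
  · filter_upwards [hs] with w hw
    exact (h.integrable_kern_mul_kern hw.1).aestronglyMeasurable
  · rintro s w ⟨hw, -⟩
    have h1 := h.hasDerivAt_kern_left hw s
    refine ((h1.mul h1).const_smul (Complex.exp (s * Complex.I))).congr_deriv ?_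
    congr 1
    simp only [smul_mul_assoc, mul_smul_comm, mul_smul, mul_sub, sub_mul, mul_one,
      mul_assoc, ← two_smul ℂ]

/-- Integration by parts along the vertical line. -/
theorem integral_kern_cube [CompleteSpace 𝔸] {z : ℂ} (hz : z ∈ timeSector δ) :
    (Integrable fun s : ℝ => Complex.exp (s * Complex.I) •
      (kern J z s * kern J z s * kern J z s)) ∧
    (2 : ℂ) • ∫ s : ℝ, Complex.exp (s * Complex.I) • (kern J z s * kern J z s * kern J z s) =
      ∫ s : ℝ, Complex.exp (s * Complex.I) • (kern J z s * kern J z s) := by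
  have hc := h.continuous_kern hz
  have hi2 := h.integrable_kern_mul_kern hz
  have hi3 : Integrable fun s : ℝ => Complex.exp (s * Complex.I) •
      (kern J z s * kern J z s * kern J z s) := by
    refine (integrable_inv_one_add_sq.const_mul (M ^ 2 * M)).mono'
      (Continuous.aestronglyMeasurable (by fun_prop)) (ae_of_all _ fun s => ?_)
    rw [norm_smul, Complex.norm_exp_ofReal_mul_I, one_mul, mul_right_comm]
    exact (norm_mul_le _ _).trans (mul_le_mul (h.norm_kern_mul_kern_le hz s)
      (h.norm_kern_le' hz s) (norm_nonneg _) (by positivity))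
  refine ⟨hi3, ?_⟩
  -- With K' = -iK², the derivative of e^{is}K² is i e^{is}(K² - 2K³). Since e^{is}K² tends to 0 at
  -- both ends, its integral vanishes.
  have hd : ∀ s : ℝ, HasDerivAt
      (fun s : ℝ => Complex.exp (s * Complex.I) • (kern J z s * kern J z s))
      (Complex.I • (Complex.exp (s * Complex.I) • (kern J z s * kern J z s)) -
        (Complex.I * 2) • (Complex.exp (s * Complex.I) •
          (kern J z s * kern J z s * kern J z s))) s := by
    intro s
    have h1 := h.hasDerivAt_kern_right hz s
    have h2 := ((Complex.ofRealCLM.hasDerivAt (x := s)).mul_const Complex.I).cexp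
    refine (h2.smul (h1.mul h1)).congr_deriv ?_
    simp only [smul_mul_assoc, mul_smul_comm, Complex.ofRealCLM_apply, Complex.ofReal_one, one_mul,
      mul_assoc, neg_smul, Pi.mul_apply, mul_neg, neg_mul]
    module
  have hlim : ∀ l : Filter ℝ, Tendsto (fun s : ℝ => (1 + s ^ 2)⁻¹) l (𝓝 0) →
      Tendsto (fun s : ℝ => Complex.exp (s * Complex.I) • (kern J z s * kern J z s)) l (𝓝 0) := by
    intro l hl
    refine squeeze_zero_norm (fun s => ?_) (by simpa using hl.const_mul (M ^ 2))
    rw [norm_smul, Complex.norm_exp_ofReal_mul_I, one_mul]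
    exact h.norm_kern_mul_kern_le hz s
  have htop : Tendsto (fun s : ℝ => (1 + s ^ 2)⁻¹) atTop (𝓝 0) :=
    tendsto_inv_atTop_zero.comp (tendsto_atTop_add_const_left _ _ (tendsto_pow_atTop two_ne_zero))
  have hbot : Tendsto (fun s : ℝ => (1 + s ^ 2)⁻¹) atBot (𝓝 0) := by
    have := htop.comp tendsto_neg_atBot_atTop
    simpa [Function.comp_def] using this
  have := integral_of_hasDerivAt_of_tendsto hd ((hi2.smul Complex.I).sub (hi3.smul (Complex.I * 2)))
    (hlim _ hbot) (hlim _ htop)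
  have h5 : ∫ s : ℝ, (Complex.I • (Complex.exp (s * Complex.I) • (kern J z s * kern J z s)) -
        (Complex.I * 2) • (Complex.exp (s * Complex.I) •
          (kern J z s * kern J z s * kern J z s))) = Complex.I •
        (∫ s : ℝ, Complex.exp (s * Complex.I) • (kern J z s * kern J z s)) - Complex.I • ((2 : ℂ) •
        ∫ s : ℝ, Complex.exp (s * Complex.I) • (kern J z s * kern J z s * kern J z s)) := by
    refine (integral_sub (hi2.smul Complex.I) (hi3.smul (Complex.I * 2))).trans ?_
    simp only [Pi.smul_apply, integral_smul, mul_smul]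
  rw [h5, ← smul_sub, sub_zero] at this
  exact (sub_eq_zero.1 ((smul_eq_zero_iff_right Complex.I_ne_zero).1 this)).symm

/-- Formally both sides are J(lam) A K: on the left AK = z⁻¹(μK - 1), on the right A J(lam) = lam
J(lam) - 1. The resolvent identity at lam and μ/z proves it without A. -/
theorem mul_kern {z lam : ℂ} (hz : z ∈ timeSector δ) (hlam : -δ * ‖lam‖ < lam.re) (s : ℝ) :
    J lam * (z⁻¹ • ((1 + s * Complex.I) • kern J z s - 1)) =
      (lam • J lam - 1) * kern J z s := by
  have hz0 := ne_zero_of_mem_timeSector hz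
  have h1 := h.identity lam _ hlam (h.div_mem hz s)
  set ν := (1 + s * Complex.I) / z
  have hμ : 1 + s * Complex.I = ν * z := by simp only [ν]; field_simp
  have h2 : (1 + s * Complex.I) • kern J z s = ν • J ν := by
    rw [hμ, kern, smul_smul]
    congr 1
    field_simp
  rw [h2]
  simp only [kern, mul_smul_comm, mul_sub, sub_mul, mul_one, one_mul, smul_mul_assoc]
  congr 1
  change ν • (J lam * J ν) - J lam = lam • (J lam * J ν) - J ν
  have h3 : ν • (J lam * J ν) - lam • (J lam * J ν) = J lam - J ν := by rw [← sub_smul, h1]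
  rw [sub_eq_sub_iff_add_eq_add] at h3 ⊢
  rw [h3, add_comm]

/-- Comparing the resolvent identity with the one obtained by exchanging the two points shows that
ν' - ν times the commutator is zero; if ν = ν' there is nothing to prove. -/
theorem commute {ν ν' : ℂ} (hν : -δ * ‖ν‖ < ν.re) (hν' : -δ * ‖ν'‖ < ν'.re) :
    Commute (J ν) (J ν') := by
  have h1 := h.identity ν ν' hν hν'
  have h2 := h.identity ν' ν hν' hν
  have h3 : (ν' - ν) • (J ν * J ν' - J ν' * J ν) = 0 := by
    rw [smul_sub, ← h1, sub_eq_zero, ← neg_sub (J _), h2, ← neg_smul, neg_sub]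
  rcases smul_eq_zero.1 h3 with h4 | h4
  · rw [sub_eq_zero.1 h4]
  · exact sub_eq_zero.1 h4

/-- This is T' = AT, multiplied by J(lam) so that only bounded operators occur. Under the integral,
J(lam) ∂_z(K²) = 2(lam J(lam) - 1)K³ by `mul_kern`, and `integral_kern_cube` replaces the integral
of 2 e^{is}K³ by that of e^{is}K². -/
theorem mul_deriv_semigroup [CompleteSpace 𝔸] {z lam : ℂ} (hz : z ∈ timeSector δ)
    (hlam : -δ * ‖lam‖ < lam.re) :
    J lam * deriv (semigroup J) z = (lam • J lam - 1) * semigroup J z := by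
  obtain ⟨hi, hd⟩ := h.hasDerivAt_semigroup hz
  obtain ⟨hi3, h3⟩ := h.integral_kern_cube hz
  rw [hd.deriv, semigroup, mul_smul_comm, mul_smul_comm, ← integral_const_mul_of_integrable hi,
    ← h3, mul_smul_comm, ← integral_const_mul_of_integrable hi3]
  congr 1
  rw [← integral_smul]
  refine integral_congr_ae (ae_of_all _ fun s => ?_)
  have hcomm : Commute (J lam) (kern J z s) := (h.commute hlam (h.div_mem hz s)).smul_right _
  have h4 := h.mul_kern hz hlam s
  have h5 : J lam * (kern J z s * kern J z s * (z⁻¹ • ((1 + s * Complex.I) • kern J z s - 1))) =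
      (lam • J lam - 1) * (kern J z s * kern J z s * kern J z s) := by
    rw [← mul_assoc, (hcomm.mul_right hcomm).eq, mul_assoc, h4, ← mul_assoc, ← mul_assoc]
    congr 1
    exact ((((hcomm.smul_left lam).sub_left (Commute.one_left _)).mul_right
      ((hcomm.smul_left lam).sub_left (Commute.one_left _))).eq).symm
  simp only [mul_smul_comm] at h5 ⊢
  rw [← h5, mul_smul]
  exact smul_comm _ _ _

theorem commute_semigroup [CompleteSpace 𝔸] {z : ℂ} (hz : z ∈ timeSector δ) {a : 𝔸}
    (ha : ∀ ν : ℂ, -δ * ‖ν‖ < ν.re → Commute a (J ν)) : Commute a (semigroup J z) := by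
  refine Commute.smul_right ?_ _
  have hi := h.integrable_kern_mul_kern hz
  rw [commute_iff_eq, ← integral_const_mul_of_integrable hi, ← integral_mul_const_of_integrable hi]
  refine integral_congr_ae (ae_of_all _ fun s => ?_)
  have h1 : Commute a (kern J z s) := (ha _ (h.div_mem hz s)).smul_right _
  exact (h1.mul_right h1).smul_right _

/-- The semigroup itself need not converge at 0; multiplied by J(lam) it does. The resolvent
identity gives J(lam)K = (μ - z lam)⁻¹(J(lam) - zK), hence J(lam)K² → μ⁻²J(lam) pointwise in s.
Dominated convergence reduces the limit to the scalar integral `integral_exp_mul_inv_sq`. -/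
theorem tendsto_mul_semigroup [CompleteSpace 𝔸] {lam : ℂ} (hlam : -δ * ‖lam‖ < lam.re) :
    Tendsto (fun z => J lam * semigroup J z) (𝓝[timeSector δ] 0) (𝓝 (J lam)) := by
  have hlim : Tendsto (fun z => ∫ s : ℝ, J lam * (Complex.exp (s * Complex.I) •
      (kern J z s * kern J z s))) (𝓝[timeSector δ] 0)
      (𝓝 (∫ s : ℝ, (Complex.exp (s * Complex.I) * ((1 + s * Complex.I) ^ 2)⁻¹) • J lam)) := by
    refine tendsto_integral_filter_of_dominated_convergence
      (fun s => ‖J lam‖ * (M ^ 2 * (1 + s ^ 2)⁻¹)) ?_ ?_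
      ((integrable_inv_one_add_sq.const_mul _).const_mul _) (ae_of_all _ fun s => ?_)
    · filter_upwards [self_mem_nhdsWithin] with z hz
      exact ((h.integrable_kern_mul_kern hz).const_mul _).aestronglyMeasurable
    · filter_upwards [self_mem_nhdsWithin] with z hz
      refine ae_of_all _ fun s => (norm_mul_le _ _).trans ?_
      gcongr
      rw [norm_smul, Complex.norm_exp_ofReal_mul_I, one_mul]
      exact h.norm_kern_mul_kern_le hz s
    · have hμ := one_add_mul_I_ne_zero s
      set μ : ℂ := 1 + s * Complex.I with hμdef
      have hid : ∀ᶠ z in 𝓝[timeSector δ] 0,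
          J lam * kern J z s = (μ - z * lam)⁻¹ • (J lam - z • kern J z s) := by
        have h1 : ∀ᶠ z in 𝓝 (0 : ℂ), μ - z * lam ≠ 0 := by
          have : ContinuousAt (fun z => μ - z * lam) 0 := by fun_prop
          exact this.eventually_ne (by simpa using hμ)
        filter_upwards [self_mem_nhdsWithin, nhdsWithin_le_nhds h1] with z hz hz1
        have hz0 := ne_zero_of_mem_timeSector hz
        have h2 := h.identity lam _ hlam (h.div_mem hz s)
        rw [eq_inv_smul_iff₀ hz1, kern, smul_smul, mul_inv_cancel₀ hz0, one_smul, h2,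
          mul_smul_comm, smul_smul]
        congr 1
        field_simp
        rw [hμdef]
      have hzK : Tendsto (fun z => z • kern J z s) (𝓝[timeSector δ] 0) (𝓝 0) := by
        refine squeeze_zero_norm' (a := fun z => ‖z‖ * M) ?_ ?_
        · filter_upwards [self_mem_nhdsWithin] with z hz
          rw [norm_smul]
          gcongr
          exact h.norm_kern_le' hz s
        · have : Tendsto (fun z : ℂ => ‖z‖ * M) (𝓝 0) (𝓝 (‖(0 : ℂ)‖ * M)) :=
            Continuous.tendsto (by fun_prop) 0
          simpa using this.mono_left nhdsWithin_le_nhds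
      have hinv : Tendsto (fun z => (μ - z * lam)⁻¹) (𝓝[timeSector δ] 0) (𝓝 μ⁻¹) := by
        have : ContinuousAt (fun z => (μ - z * lam)⁻¹) 0 :=
          ContinuousAt.inv₀ (by fun_prop) (by simpa using hμ)
        simpa using this.tendsto.mono_left nhdsWithin_le_nhds
      have hK1 : Tendsto (fun z => J lam * kern J z s) (𝓝[timeSector δ] 0) (𝓝 (μ⁻¹ • J lam)) := by
        have := hinv.smul ((tendsto_const_nhds (x := J lam)).sub hzK)
        rw [sub_zero] at this
        exact this.congr' (hid.mono fun z hz => hz.symm)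
      have hzKK : Tendsto (fun z => z • kern J z s * kern J z s) (𝓝[timeSector δ] 0) (𝓝 0) := by
        refine squeeze_zero_norm' (a := fun z => ‖z • kern J z s‖ * M) ?_
          (by simpa using hzK.norm.mul_const M)
        filter_upwards [self_mem_nhdsWithin] with z hz
        refine (norm_mul_le _ _).trans ?_
        gcongr
        exact h.norm_kern_le' hz s
      have hK2 := hinv.smul (hK1.sub hzKK)
      rw [sub_zero, smul_smul, ← mul_inv, ← sq] at hK2
      have hK3 := hK2.const_smul (Complex.exp (s * Complex.I))
      rw [smul_smul] at hK3
      refine hK3.congr' (hid.mono fun z hz => ?_)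
      simp only
      rw [mul_smul_comm, ← mul_assoc (J lam), hz, smul_mul_assoc (μ - z * lam)⁻¹, sub_mul, hz]
  have h2 := hlim.const_smul ((Real.exp 1 / (2 * Real.pi) : ℝ) : ℂ)
  rw [integral_smul_const, integral_exp_mul_inv_sq, smul_smul] at h2
  have h3 : ((Real.exp 1 / (2 * Real.pi) : ℝ) : ℂ) * (2 * Real.pi * Complex.exp (-1)) = 1 := by
    have : (Real.pi : ℂ) ≠ 0 := by exact_mod_cast Real.pi_ne_zero
    push_cast
    field_simp
    rw [← Complex.exp_add]
    simp
  rw [h3, one_smul] at h2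
  refine h2.congr' ?_
  filter_upwards [self_mem_nhdsWithin] with z hz
  rw [semigroup, mul_smul_comm, ← integral_const_mul_of_integrable (h.integrable_kern_mul_kern hz)]

theorem hasDerivAt_mul_semigroup [CompleteSpace 𝔸] {z lam : ℂ} (hz : z ∈ timeSector δ)
    (hlam : -δ * ‖lam‖ < lam.re) :
    HasDerivAt (fun z => J lam * semigroup J z) ((lam • J lam - 1) * semigroup J z) z := by
  rw [← h.mul_deriv_semigroup hz hlam]
  exact (h.hasDerivAt_semigroup hz).2.differentiableAt.hasDerivAt.const_mul _

omit h in
theorem re_pos_mem {lam : ℂ} (hδ : 0 < δ) (hlam : 0 < lam.re) : -δ * ‖lam‖ < lam.re := by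
  have := mul_nonneg hδ.le (norm_nonneg lam)
  linarith

/-- The Laplace transform of the semigroup is the resolvent. -/
theorem laplace_semigroup [CompleteSpace 𝔸] {lam : ℂ} (hlam : 0 < lam.re) :
    IntegrableOn (fun t : ℝ => Complex.exp (-lam * t) • semigroup J t) (Set.Ioi 0) ∧
    ∫ t in Set.Ioi (0 : ℝ), Complex.exp (-lam * t) • semigroup J t = J lam := by
  have hlamS := re_pos_mem h.δ_pos hlam
  have hn : ∀ t : ℝ, ‖Complex.exp (-lam * t)‖ = Real.exp (-lam.re * t) := fun t => by
    rw [Complex.norm_exp]; simp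
  have hcont : ContinuousOn (fun t : ℝ => Complex.exp (-lam * t) • semigroup J t) (Set.Ioi 0) := by
    refine ContinuousOn.smul (by fun_prop) fun t ht => ?_
    exact ((h.hasDerivAt_semigroup (ofReal_mem_timeSector h.δ_pos ht)).2.continuousAt.comp
      Complex.continuous_ofReal.continuousAt).continuousWithinAt
  have hinteg : IntegrableOn (fun t : ℝ => Complex.exp (-lam * t) • semigroup J t) (Set.Ioi 0) := by
    refine ((exp_neg_integrableOn_Ioi 0 hlam).mul_const
      (Real.exp 1 / (2 * Real.pi) * (M ^ 2 * Real.pi))).mono'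
      (hcont.aestronglyMeasurable measurableSet_Ioi)
      ((ae_restrict_mem measurableSet_Ioi).mono fun t ht => ?_)
    rw [norm_smul, hn]
    gcongr
    exact h.norm_semigroup_le (ofReal_mem_timeSector h.δ_pos ht)
  refine ⟨hinteg, ?_⟩
  classical
  -- Because (J T)' = (lam J - 1)T, the function -e^{-lam t} J(lam) T(t) is an antiderivative of the
  -- integrand. At t = 0 it is redefined as its limit, since `semigroup J 0` is 0 by the convention
  -- 0⁻¹ = 0.
  let F : ℝ → 𝔸 := fun t => if t = 0 then -J lam else
    -(Complex.exp (-lam * t) • (J lam * semigroup J t))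
  have hFe : ∀ t ∈ Set.Ioi (0 : ℝ), -(Complex.exp (-lam * t) • (J lam * semigroup J t)) = F t :=
    fun t ht => by simp only [F, if_neg (ne_of_gt (Set.mem_Ioi.1 ht))]
  have h0 : ContinuousWithinAt F (Set.Ici 0) 0 := by
    rw [← continuousWithinAt_Ioi_iff_Ici]
    have h1 : Tendsto (fun t : ℝ => (t : ℂ)) (𝓝[>] 0) (𝓝[timeSector δ] 0) := by
      refine tendsto_nhdsWithin_iff.2 ⟨?_, ?_⟩
      · exact (Complex.continuous_ofReal.tendsto 0).mono_left nhdsWithin_le_nhds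
      · filter_upwards [self_mem_nhdsWithin] with t ht using ofReal_mem_timeSector h.δ_pos ht
    have h2 := (h.tendsto_mul_semigroup hlamS).comp h1
    have h3 : Tendsto (fun t : ℝ => Complex.exp (-lam * t)) (𝓝[>] 0) (𝓝 1) := by
      have : Tendsto (fun t : ℝ => Complex.exp (-lam * t)) (𝓝 0) (𝓝 _) :=
        Continuous.tendsto (by fun_prop) 0
      simpa using this.mono_left nhdsWithin_le_nhds
    have h4 := (h3.smul h2).neg
    rw [one_smul] at h4
    have h5 : F 0 = -J lam := if_pos rfl
    rw [ContinuousWithinAt, h5]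
    refine h4.congr' ?_
    filter_upwards [self_mem_nhdsWithin] with t ht using hFe t ht
  have hderiv : ∀ t ∈ Set.Ioi (0 : ℝ),
      HasDerivAt F (Complex.exp (-lam * t) • semigroup J t) t := by
    intro t ht
    have h1 : HasDerivAt (fun t : ℝ => (t : ℂ)) 1 t := Complex.ofRealCLM.hasDerivAt
    have h2 := (h.hasDerivAt_mul_semigroup (ofReal_mem_timeSector h.δ_pos ht) hlamS).scomp t h1
    have h3 := ((h1.const_mul (-lam)).cexp.smul h2).neg
    refine (h3.congr_of_eventuallyEq ?_).congr_deriv ?_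
    · filter_upwards [Ioi_mem_nhds ht] with x hx using (hFe x hx).symm
    · simp only [sub_mul, one_mul, smul_mul_assoc, mul_one]
      simp only [Function.comp]
      module
  have htop : Tendsto F atTop (𝓝 0) := by
    refine squeeze_zero_norm' (a := fun t => Real.exp (-lam.re * t) *
      (‖J lam‖ * (Real.exp 1 / (2 * Real.pi) * (M ^ 2 * Real.pi)))) ?_ ?_
    · filter_upwards [eventually_gt_atTop 0] with t ht
      rw [← hFe t ht, norm_neg, norm_smul, hn]
      gcongr
      refine (norm_mul_le _ _).trans ?_
      gcongr
      exact h.norm_semigroup_le (ofReal_mem_timeSector h.δ_pos ht)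
    · have h1 : Tendsto (fun t : ℝ => Real.exp (-lam.re * t)) atTop (𝓝 0) := by
        refine Real.tendsto_exp_atBot.comp ?_
        exact (tendsto_const_mul_atBot_of_neg (by linarith)).2 tendsto_id
      simpa using h1.mul_const _
  rw [integral_Ioi_of_hasDerivAt_of_tendsto h0 hderiv hinteg htop]
  simp [F]

/-- The function x ↦ T(z + (1 - x)w) J(lam) T(xw) has zero derivative on (0, 1] by
`mul_deriv_semigroup`. Its limit at 0 is T(z + w)J(lam) and its value at 1 is J(lam)T(z)T(w). Since
J(lam) commutes with T, the hypothesis `hinj` allows it to be cancelled. -/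
theorem semigroup_add [CompleteSpace 𝔸] {z w lam : ℂ} (hz : z ∈ timeSector δ)
    (hw : w ∈ timeSector δ) (hlam : -δ * ‖lam‖ < lam.re)
    (hinj : ∀ a : 𝔸, J lam * a = 0 → a = 0) :
    semigroup J (z + w) = semigroup J z * semigroup J w := by
  let G : ℝ → 𝔸 := fun x => semigroup J (z + ((1 - x : ℝ) : ℂ) * w) *
    (J lam * semigroup J (x * w))
  have hmem : ∀ x ∈ Set.Ioc (0 : ℝ) 1, z + ((1 - x : ℝ) : ℂ) * w ∈ timeSector δ := by
    intro x hx
    rcases hx.2.eq_or_lt with rfl | h1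
    · simpa using hz
    · exact add_mem_timeSector hz (smul_mem_timeSector hw (by linarith))
  have hmem' : ∀ x ∈ Set.Ioc (0 : ℝ) 1, (x : ℂ) * w ∈ timeSector δ :=
    fun x hx => smul_mem_timeSector hw hx.1
  have hG : ∀ x ∈ Set.Ioc (0 : ℝ) 1, HasDerivAt G 0 x := by
    intro x hx
    have h1 : HasDerivAt (fun x : ℝ => (x : ℂ)) 1 x := Complex.ofRealCLM.hasDerivAt
    have h2 : HasDerivAt (fun x : ℝ => z + ((1 - x : ℝ) : ℂ) * w) (-w) x := by
      have := ((h1.const_sub 1).mul_const w).const_add z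
      simpa using this
    have h3 : HasDerivAt (fun x : ℝ => (x : ℂ) * w) w x := by simpa using h1.mul_const w
    have hd := h.hasDerivAt_semigroup (hmem x hx)
    have h4 := (hd.2.differentiableAt.hasDerivAt).scomp x h2
    have h5 := (h.hasDerivAt_mul_semigroup (hmem' x hx) hlam).scomp x h3
    refine (h4.mul h5).congr_deriv ?_
    simp only [Function.comp]
    have c1 : Commute (J lam) (semigroup J (z + ((1 - x : ℝ) : ℂ) * w)) :=
      h.commute_semigroup (hmem x hx) fun ν hν => h.commute hlam hν
    have c2 : Commute (J lam) (semigroup J (x * w)) :=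
      h.commute_semigroup (hmem' x hx) fun ν hν => h.commute hlam hν
    have c3 : Commute (J lam) (deriv (semigroup J) (z + ((1 - x : ℝ) : ℂ) * w)) := by
      have e1 := hd.2.differentiableAt.hasDerivAt.const_mul (J lam)
      have e2 := hd.2.differentiableAt.hasDerivAt.mul_const (J lam)
      refine e1.unique (e2.congr_of_eventuallyEq ?_)
      filter_upwards [(isOpen_timeSector δ).mem_nhds (hmem x hx)] with y hy
      exact h.commute_semigroup hy fun ν hν => h.commute hlam hν
    have c4 : Commute (lam • J lam - 1) (semigroup J (z + ((1 - x : ℝ) : ℂ) * w)) :=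
      (c1.smul_left lam).sub_left (Commute.one_left _)
    rw [smul_mul_assoc, mul_smul_comm, ← mul_assoc, ← c3.eq, h.mul_deriv_semigroup (hmem x hx) hlam,
      ← mul_assoc, ← c4.eq, neg_smul, neg_add_cancel]
  have hconst : ∀ x ∈ Set.Ioc (0 : ℝ) 1, G x = G 1 := by
    intro x hx
    have hsub : Set.Icc x 1 ⊆ Set.Ioc 0 1 := fun y hy => ⟨hx.1.trans_le hy.1, hy.2⟩
    refine ((constant_of_derivWithin_zero (f := G) (a := x) (b := 1)
      (fun y hy => (hG y (hsub hy)).differentiableAt.differentiableWithinAt)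
      (fun y hy => ?_)) 1 ⟨hx.2, le_rfl⟩).symm
    have hy' : y ∈ Set.Icc x 1 := Set.Ico_subset_Icc_self hy
    exact (hG y (hsub hy')).hasDerivWithinAt.derivWithin
      (uniqueDiffOn_Icc (hy.1.trans_lt hy.2) y hy')
  have hlim : Tendsto G (𝓝[>] 0) (𝓝 (semigroup J (z + w) * J lam)) := by
    have h1 : Tendsto (fun x : ℝ => (x : ℂ) * w) (𝓝[>] 0) (𝓝[timeSector δ] 0) := by
      refine tendsto_nhdsWithin_iff.2 ⟨?_, ?_⟩
      · have : Tendsto (fun x : ℝ => (x : ℂ) * w) (𝓝 0) (𝓝 _) := Continuous.tendsto (by fun_prop) 0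
        simpa using this.mono_left nhdsWithin_le_nhds
      · filter_upwards [self_mem_nhdsWithin] with t ht using smul_mem_timeSector hw ht
    have h2 := (h.tendsto_mul_semigroup hlam).comp h1
    have h3 : Tendsto (fun x : ℝ => z + ((1 - x : ℝ) : ℂ) * w) (𝓝[>] 0) (𝓝 (z + w)) := by
      have : Tendsto (fun x : ℝ => z + ((1 - x : ℝ) : ℂ) * w) (𝓝 0) (𝓝 _) :=
        Continuous.tendsto (by fun_prop) 0
      simpa using this.mono_left nhdsWithin_le_nhds
    exact ((h.hasDerivAt_semigroup (add_mem_timeSector hz hw)).2.continuousAt.tendsto.comp h3).mul h2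
  have hlim' : Tendsto G (𝓝[>] 0) (𝓝 (G 1)) := by
    refine tendsto_const_nhds.congr' ?_
    filter_upwards [Ioc_mem_nhdsGT (zero_lt_one' ℝ)] with x hx using (hconst x hx).symm
  have h6 := tendsto_nhds_unique hlim hlim'
  have c1 : ∀ {y : ℂ}, y ∈ timeSector δ → Commute (J lam) (semigroup J y) := fun hy =>
    h.commute_semigroup hy fun ν hν => h.commute hlam hν
  have h7 : G 1 = J lam * (semigroup J z * semigroup J w) := by
    simp only [G, sub_self, Complex.ofReal_zero, zero_mul, add_zero, Complex.ofReal_one, one_mul]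
    rw [← mul_assoc, ← (c1 hz).eq, mul_assoc]
  rw [h7, ← (c1 (add_mem_timeSector hz hw)).eq] at h6
  exact sub_eq_zero.1 (hinj _ (by rw [mul_sub, h6, sub_self]))

end

end IsSectorialPseudoResolvent

/-! ### Resolvents of unbounded operators -/

section Resolvents

variable {X : Type*} [NormedAddCommGroup X] [NormedSpace ℂ X] {A : X →ₗ.[ℂ] X}

theorem isResolventOf_opResolvent {lam : ℂ} (h : lam ∈ opResolventSet A) :
    IsResolventOf A lam (opResolvent A lam) := by
  have h' : ∃ R : X →L[ℂ] X, IsResolventOf A lam R := h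
  rw [opResolvent, dif_pos h']
  exact h'.choose_spec

theorem IsResolventOf.unique {lam : ℂ} {R R' : X →L[ℂ] X} (h : IsResolventOf A lam R)
    (h' : IsResolventOf A lam R') : R = R' := by
  ext f
  obtain ⟨hd, hf⟩ := h'.1 f
  have := h.2 ⟨R' f, hd⟩
  rwa [hf] at this

theorem IsResolventOf.mem {lam : ℂ} {R : X →L[ℂ] X} (h : IsResolventOf A lam R) :
    lam ∈ opResolventSet A := ⟨R, h⟩

theorem IsResolventOf.opResolvent_eq {lam : ℂ} {R : X →L[ℂ] X} (h : IsResolventOf A lam R) :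
    opResolvent A lam = R := (isResolventOf_opResolvent h.mem).unique h

theorem IsResolventOf.sub_eq {lam μ : ℂ} {R R' : X →L[ℂ] X} (h : IsResolventOf A lam R)
    (h' : IsResolventOf A μ R') : R - R' = (μ - lam) • (R * R') := by
  ext f
  obtain ⟨hd, hf⟩ := h'.1 f
  have h1 := h.2 ⟨R' f, hd⟩
  have h2 : lam • R' f - A ⟨R' f, hd⟩ = f + (lam - μ) • R' f := by
    linear_combination (norm := module) hf
  rw [h2, map_add, map_smul] at h1
  change R f - R' f = (μ - lam) • R (R' f)
  change R f + (lam - μ) • R (R' f) = R' f at h1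
  linear_combination (norm := module) h1

theorem IsResolventOf.injective {lam : ℂ} {R : X →L[ℂ] X} (h : IsResolventOf A lam R) {f : X}
    (hf : R f = 0) : f = 0 := by
  obtain ⟨hd, h1⟩ := h.1 f
  have h2 : (⟨R f, hd⟩ : A.domain) = 0 := Subtype.ext hf
  rw [h2, A.map_zero, hf] at h1
  simpa using h1.symm

theorem IsResolventOf.apply_of_mem_opEigenspace {lam μ : ℂ} {R : X →L[ℂ] X}
    (h : IsResolventOf A lam R) {x : X} (hx : x ∈ opEigenspace A μ) : (lam - μ) • R x = x := by
  obtain ⟨hd, h1⟩ := hx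
  have h2 := h.2 ⟨x, hd⟩
  rw [h1, ← sub_smul, map_smul] at h2
  exact h2

theorem IsResolventOf.opEigenspace_eq_bot {lam : ℂ} {R : X →L[ℂ] X} (h : IsResolventOf A lam R) :
    opEigenspace A lam = ⊥ := by
  rw [Submodule.eq_bot_iff]
  intro x hx
  have := h.apply_of_mem_opEigenspace hx
  simpa using this.symm

/-- A priori bounds and surjectivity give the resolvent. -/
theorem mem_opResolventSet_of_bound {lam : ℂ} {C : ℝ}
    (hC : ∀ x : A.domain, ‖(x : X)‖ ≤ C * ‖lam • (x : X) - A x‖)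
    (hs : ∀ f : X, ∃ x : A.domain, lam • (x : X) - A x = f) :
    lam ∈ opResolventSet A ∧ (0 ≤ C → ‖opResolvent A lam‖ ≤ C) := by
  choose g hg using hs
  have hinj : ∀ x y : A.domain, lam • (x : X) - A x = lam • (y : X) - A y → x = y := by
    intro x y hxy
    have h1 := hC (x - y)
    have h2 : lam • ((x - y : A.domain) : X) - A (x - y) = 0 := by
      rw [A.map_sub, AddSubgroupClass.coe_sub, smul_sub, sub_sub_sub_comm, hxy, sub_self]
    rw [h2, norm_zero, mul_zero] at h1
    exact sub_eq_zero.1 (Subtype.ext (norm_le_zero_iff.1 h1))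
  let R₀ : X →ₗ[ℂ] X :=
    { toFun := fun f => g f
      map_add' := fun f f' => by
        have : g (f + f') = g f + g f' := hinj _ _ (by
          rw [hg, A.map_add, Submodule.coe_add, smul_add, add_sub_add_comm, hg, hg])
        rw [this, Submodule.coe_add]
      map_smul' := fun c f => by
        have : g (c • f) = c • g f := hinj _ _ (by
          rw [hg, A.map_smul, Submodule.coe_smul, smul_comm, ← smul_sub, hg])
        rw [this, Submodule.coe_smul, RingHom.id_apply] }
  have hR₀ : ∀ f, ‖R₀ f‖ ≤ C * ‖f‖ := fun f => by
    have := hC (g f)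
    rwa [hg] at this
  have hR : IsResolventOf A lam (R₀.mkContinuous C hR₀) := by
    refine ⟨fun f => ⟨(g f).2, hg f⟩, fun x => ?_⟩
    exact congrArg Subtype.val (hinj (g (lam • (x : X) - A x)) x (hg _))
  refine ⟨hR.mem, fun h0 => ?_⟩
  rw [hR.opResolvent_eq]
  exact LinearMap.mkContinuous_norm_le _ h0 _

theorem isUnit_one_add_smul_eventually [CompleteSpace X] (R : X →L[ℂ] X) (lam₀ : ℂ) :
    ∀ᶠ lam in 𝓝 lam₀, IsUnit (1 + (lam - lam₀) • R) := by
  have h1 : ContinuousAt (fun lam : ℂ => 1 + (lam - lam₀) • R) lam₀ := by fun_prop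
  refine h1.eventually (p := IsUnit) ?_
  simp only [sub_self, zero_smul, add_zero]
  exact Units.isOpen.mem_nhds isUnit_one

/-- On the domain, lam - A = (1 + (lam - lam₀)R)(lam₀ - A). So the resolvent at lam is R times the
inverse of the first factor, which commutes with R. -/
theorem IsResolventOf.perturb {lam₀ lam : ℂ} {R : X →L[ℂ] X} (h : IsResolventOf A lam₀ R)
    (hu : IsUnit (1 + (lam - lam₀) • R)) :
    IsResolventOf A lam (R * Ring.inverse (1 + (lam - lam₀) • R)) := by
  set B := 1 + (lam - lam₀) • R with hB
  have h1 : B * Ring.inverse B = 1 := Ring.mul_inverse_cancel B hu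
  have h2 : Ring.inverse B * B = 1 := Ring.inverse_mul_cancel B hu
  have hc : Commute R B := (Commute.one_right R).add_right ((Commute.refl R).smul_right _)
  have hc' : R * Ring.inverse B = Ring.inverse B * R := by
    calc R * Ring.inverse B = Ring.inverse B * B * R * Ring.inverse B := by rw [h2, one_mul]
      _ = Ring.inverse B * R * (B * Ring.inverse B) := by
        rw [mul_assoc _ B, ← hc.eq, mul_assoc, mul_assoc, mul_assoc]
      _ = _ := by rw [h1, mul_one]
  refine ⟨fun f => ?_, fun x => ?_⟩
  · obtain ⟨hd, hf⟩ := h.1 (Ring.inverse B f)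
    refine ⟨hd, ?_⟩
    change lam • R (Ring.inverse B f) - A ⟨R (Ring.inverse B f), hd⟩ = f
    have h3 : B (Ring.inverse B f) = f := congrArg (fun T : X →L[ℂ] X => T f) h1
    have h4 : B (Ring.inverse B f) = Ring.inverse B f + (lam - lam₀) • R (Ring.inverse B f) := rfl
    linear_combination (norm := module) hf + h3 - h4
  · rw [hc']
    change Ring.inverse B (R _) = _
    have h3 : R (lam • (x : X) - A x) = B x := by
      have h4 : lam • (x : X) - A x = (lam₀ • (x : X) - A x) + (lam - lam₀) • (x : X) := by module
      rw [h4, map_add, h.2, map_smul]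
      rfl
    rw [h3]
    exact congrArg (fun T : X →L[ℂ] X => T x) h2

theorem isOpen_opResolventSet [CompleteSpace X] : IsOpen (opResolventSet A) := by
  refine isOpen_iff_mem_nhds.2 fun lam₀ h => ?_
  filter_upwards [isUnit_one_add_smul_eventually (opResolvent A lam₀) lam₀] with lam hlam
  exact ((isResolventOf_opResolvent h).perturb hlam).mem

/-- The perturbation formula gives continuity; the resolvent identity then identifies the difference
quotient with -R(lam)R(lam₀). -/
theorem hasDerivAt_opResolvent [CompleteSpace X] {lam₀ : ℂ} (h : lam₀ ∈ opResolventSet A) :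
    HasDerivAt (opResolvent A) (-(opResolvent A lam₀ * opResolvent A lam₀)) lam₀ := by
  have hcont : ContinuousAt (opResolvent A) lam₀ := by
    have h1 : ContinuousAt (fun lam : ℂ =>
        opResolvent A lam₀ * Ring.inverse (1 + (lam - lam₀) • opResolvent A lam₀)) lam₀ := by
      refine ContinuousAt.mul continuousAt_const ?_
      refine ContinuousAt.comp (g := Ring.inverse)
        (f := fun lam : ℂ => 1 + (lam - lam₀) • opResolvent A lam₀) ?_ (by fun_prop)
      simpa using NormedRing.inverse_continuousAt (1 : (X →L[ℂ] X)ˣ)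
    refine h1.congr ?_
    filter_upwards [isUnit_one_add_smul_eventually (opResolvent A lam₀) lam₀] with lam hlam
    exact ((isResolventOf_opResolvent h).perturb hlam).opResolvent_eq.symm
  rw [hasDerivAt_iff_tendsto_slope]
  have h2 : Tendsto (fun lam => -(opResolvent A lam * opResolvent A lam₀)) (𝓝[≠] lam₀)
      (𝓝 (-(opResolvent A lam₀ * opResolvent A lam₀))) :=
    ((hcont.tendsto.mul_const _).neg).mono_left nhdsWithin_le_nhds
  refine h2.congr' ?_
  filter_upwards [self_mem_nhdsWithin,
    nhdsWithin_le_nhds (isOpen_opResolventSet.mem_nhds h)] with lam hne hlam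
  have hne' : lam - lam₀ ≠ 0 := sub_ne_zero.2 hne
  rw [slope_def_module, (isResolventOf_opResolvent hlam).sub_eq (isResolventOf_opResolvent h),
    smul_smul, ← neg_sub lam lam₀, mul_neg, inv_mul_cancel₀ hne', neg_one_smul]

/-- The spectrum is closed. -/
theorem mem_opSpectrum_of_frequently [CompleteSpace X] {lam : ℂ}
    (h : ∃ᶠ μ in 𝓝 lam, μ ∈ opSpectrum A) : lam ∈ opSpectrum A := by
  intro h'
  exact h (Filter.mem_of_superset (isOpen_opResolventSet.mem_nhds h') fun μ hμ hμ' => hμ' hμ)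

/-- An eigenvalue at which the resolvent grows at most like `1 / |lam - lam₀|` is a simple pole. -/
theorem meromorphicOrderAt_opResolvent [CompleteSpace X] {lam₀ : ℂ} {x : X}
    (hx : x ∈ opEigenspace A lam₀) (hx0 : x ≠ 0) {C : ℝ}
    (hC : ∀ᶠ lam in 𝓝[≠] lam₀, lam ∈ opResolventSet A ∧
      ‖opResolvent A lam‖ ≤ C / ‖lam - lam₀‖) :
    meromorphicOrderAt (opResolvent A) lam₀ = ((-1 : ℤ) : WithTop ℤ) := by
  obtain ⟨s, hs, hsC⟩ := mem_nhdsWithin_iff_exists_mem_nhds_inter.1 hC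
  let g : ℂ → X →L[ℂ] X := fun lam => (lam - lam₀) • opResolvent A lam
  have hsC' : ∀ lam ∈ s \ {lam₀}, lam ∈ opResolventSet A ∧
      ‖opResolvent A lam‖ ≤ C / ‖lam - lam₀‖ := fun lam hlam => hsC hlam
  have hd : DifferentiableOn ℂ g (s \ {lam₀}) := fun lam hlam =>
    (((differentiableAt_id.sub_const lam₀).smul
      (hasDerivAt_opResolvent (hsC' lam hlam).1).differentiableAt)).differentiableWithinAt
  have hbdd : BddAbove (norm ∘ g '' (s \ {lam₀})) := by
    refine ⟨C, ?_⟩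
    rintro _ ⟨lam, hlam, rfl⟩
    have h0 : 0 < ‖lam - lam₀‖ := norm_pos_iff.2 (sub_ne_zero.2 hlam.2)
    have := (hsC' lam hlam).2
    rw [le_div_iff₀ h0] at this
    simp only [Function.comp, g, norm_smul]
    linarith
  -- Riemann's removable singularity theorem for (lam - lam₀)R(lam), which is bounded near lam₀.
  have hG := Complex.differentiableOn_update_limUnder_of_bddAbove hs hd hbdd
  set G := Function.update g lam₀ (limUnder (𝓝[≠] lam₀) g) with hGdef
  have hGa : AnalyticAt ℂ G lam₀ := hG.analyticAt hs
  have hGe : ∀ lam ∈ s \ {lam₀}, G lam = g lam := fun lam hlam => by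
    rw [hGdef, Function.update_of_ne hlam.2]
  have hev : ∀ᶠ lam in 𝓝[≠] lam₀, lam ∈ s \ {lam₀} := by
    filter_upwards [self_mem_nhdsWithin, nhdsWithin_le_nhds hs] with lam h1 h2 using ⟨h2, h1⟩
  have hRG : ∀ᶠ lam in 𝓝[≠] lam₀, opResolvent A lam = (lam - lam₀) ^ (-1 : ℤ) • G lam := by
    filter_upwards [hev] with lam hlam
    rw [hGe lam hlam, zpow_neg_one, inv_smul_smul₀ (sub_ne_zero.2 hlam.2)]
  have hmer : MeromorphicAt (opResolvent A) lam₀ := by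
    have h1 : MeromorphicAt (fun lam => (lam - lam₀) ^ (-1 : ℤ) • G lam) lam₀ :=
      ((MeromorphicAt.id lam₀).sub (MeromorphicAt.const lam₀ lam₀)).zpow (-1) |>.smul
        hGa.meromorphicAt
    exact h1.congr (hRG.mono fun lam hlam => hlam.symm)
  rw [meromorphicOrderAt_eq_int_iff hmer]
  -- The order is exactly -1: on the eigenvector, (lam - lam₀)R(lam)x = x off lam₀, so G(lam₀)x = x
  -- ≠ 0.
  refine ⟨G, hGa, fun h0 => hx0 ?_, hRG⟩
  have h1 : Tendsto (fun lam => G lam x) (𝓝[≠] lam₀) (𝓝 (G lam₀ x)) :=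
    ((hGa.continuousAt.clm_apply continuousAt_const).tendsto).mono_left nhdsWithin_le_nhds
  have h2 : Tendsto (fun lam => G lam x) (𝓝[≠] lam₀) (𝓝 x) := by
    refine tendsto_const_nhds.congr' ?_
    filter_upwards [hev] with lam hlam
    rw [hGe lam hlam]
    exact ((isResolventOf_opResolvent (hsC' lam hlam).1).apply_of_mem_opEigenspace hx).symm
  have h3 := tendsto_nhds_unique h2 h1
  rw [h3, h0]
  rfl

/-- Sectorial operators generate analytic semigroups. -/
theorem IsSectorial.generatesAnalyticSemigroup [CompleteSpace X] (h : IsSectorial A) :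
    GeneratesAnalyticSemigroup A := by
  obtain ⟨ω, θ, M, hθ, hθ', hM, hR⟩ := h
  -- With δ = -cos θ, the condition |arg ν| < θ reads Re ν > -δ|ν|, and the time sector has
  -- half-angle θ - π/2 because cos(θ - π/2) = sin θ = √(1 - δ²).
  have hsin : Real.cos (θ - Real.pi / 2) = Real.sqrt (1 - (-Real.cos θ) ^ 2) := by
    rw [Real.cos_sub_pi_div_two, neg_sq, ← Real.sin_sq, Real.sqrt_sq]
    exact Real.sin_nonneg_of_nonneg_of_le_pi (by linarith [Real.pi_pos]) hθ'.le
  set δ := -Real.cos θ with hδ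
  have hδ0 : 0 < δ := by
    have := Real.cos_neg_of_pi_div_two_lt_of_lt hθ (by linarith [Real.pi_pos])
    linarith
  have hδ1 : δ < 1 := by
    have := Real.strictAntiOn_cos ⟨by linarith [Real.pi_pos], hθ'.le⟩
      ⟨Real.pi_pos.le, le_rfl⟩ hθ'
    rw [Real.cos_pi] at this
    linarith
  have hmem : ∀ ν : ℂ, -δ * ‖ν‖ < ν.re → (ω + ν ∈ opResolventSet A) ∧
      ‖opResolvent A (ω + ν)‖ ≤ M / ‖ν‖ := by
    intro ν hν
    have hν0 : ν ≠ 0 := by rintro rfl; simp at hν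
    have h1 := hR (ω + ν) (by simpa using hν0) (by
      rw [add_sub_cancel_left]
      by_contra hcon
      have h2 := Real.strictAntiOn_cos.antitoneOn ⟨by linarith [Real.pi_pos], hθ'.le⟩
        ⟨abs_nonneg _, Complex.abs_arg_le_pi ν⟩ (not_lt.1 hcon)
      rw [Real.cos_abs, Complex.cos_arg hν0, div_le_iff₀ (norm_pos_iff.2 hν0)] at h2
      simp only [hδ, neg_neg] at hν
      linarith)
    rwa [add_sub_cancel_left] at h1
  let J : ℂ → X →L[ℂ] X := fun ν => opResolvent A (ω + ν)
  have hJ : IsSectorialPseudoResolvent J δ M :=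
    { δ_pos := hδ0
      δ_lt_one := hδ1
      M_pos := hM
      hasDerivAt := fun ν hν => by
        simpa [J, Function.comp_def] using (hasDerivAt_opResolvent (hmem ν hν).1).scomp ν
          ((hasDerivAt_id ν).const_add (ω : ℂ))
      identity := fun ν ν' hν hν' => by
        have := (isResolventOf_opResolvent (hmem ν hν).1).sub_eq
          (isResolventOf_opResolvent (hmem ν' hν').1)
        rwa [add_sub_add_left_eq_sub] at this
      norm_le := fun ν hν => (hmem ν hν).2 }
  have hsec : ∀ z ∈ sector (θ - Real.pi / 2), z ∈ timeSector δ := by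
    rintro z ⟨hz0, hz⟩
    have h2 := Real.strictAntiOn_cos ⟨abs_nonneg _, Complex.abs_arg_le_pi z⟩
      ⟨by linarith, by linarith [Real.pi_pos]⟩ hz
    rw [Real.cos_abs, Complex.cos_arg hz0, lt_div_iff₀ (norm_pos_iff.2 hz0), hsin] at h2
    exact h2
  -- The factor e^{ωz} undoes the shift by ω. The value at 0 has to be prescribed, since the
  -- integral formula yields 0 there.
  open Classical in
  refine ⟨fun z => if z = 0 then 1 else
      Complex.exp (ω * z) • IsSectorialPseudoResolvent.semigroup J z,
    θ - Real.pi / 2, ω, Real.exp 1 / (2 * Real.pi) * (M ^ 2 * Real.pi),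
    by linarith, by linarith, if_pos rfl, fun z hz w hw => ?_, fun z hz => ?_, fun z hz => ?_,
    fun lam hlam => ?_⟩
  · have hz' := hsec z hz
    have hw' := hsec w hw
    simp only [if_neg (ne_zero_of_mem_timeSector (add_mem_timeSector hz' hw')), if_neg hz.1,
      if_neg hw.1]
    have h1 : -δ * ‖(1 : ℂ)‖ < (1 : ℂ).re := by simp; linarith
    rw [hJ.semigroup_add hz' hw' h1 (fun a ha => ?_), smul_mul_smul_comm, ← Complex.exp_add, mul_add]
    ext f
    exact (isResolventOf_opResolvent (hmem 1 h1).1).injective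
      (congrArg (fun T : X →L[ℂ] X => T f) ha)
  · have h1 : DifferentiableAt ℂ
        (fun z => Complex.exp (ω * z) • IsSectorialPseudoResolvent.semigroup J z) z :=
      (by fun_prop : DifferentiableAt ℂ (fun z : ℂ => Complex.exp (ω * z)) z).smul
        (hJ.hasDerivAt_semigroup (hsec z hz)).2.differentiableAt
    refine (h1.congr_of_eventuallyEq ?_).differentiableWithinAt
    filter_upwards [isOpen_ne.mem_nhds hz.1] with w hw
    rw [if_neg hw]
  · simp only [if_neg hz.1]
    rw [norm_smul, Complex.norm_exp, mul_comm]
    simp only [Complex.re_ofReal_mul]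
    gcongr
    exact hJ.norm_semigroup_le (hsec z hz)
  · have h0 : 0 < (lam - ω).re := by simpa using hlam
    have hS := IsSectorialPseudoResolvent.re_pos_mem hδ0 h0
    refine ⟨by simpa using (hmem _ hS).1, fun f => ?_⟩
    obtain ⟨hi, hL⟩ := hJ.laplace_semigroup h0
    have h2 : J (lam - ω) = opResolvent A lam := by simp [J]
    rw [← h2, ← hL, ContinuousLinearMap.integral_apply hi]
    refine setIntegral_congr_fun measurableSet_Ioi fun t ht => ?_
    have ht0 : (t : ℂ) ≠ 0 := by exact_mod_cast (ne_of_gt (Set.mem_Ioi.1 ht))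
    simp only [if_neg ht0]
    rw [smul_apply, smul_apply, smul_smul,
      ← Complex.exp_add]
    congr 2
    ring

end Resolvents

/-! ### First-order equations on weighted half-lines -/

theorem norm_cexp_mul_ofReal (a : ℂ) (x : ℝ) : ‖Complex.exp (a * x)‖ = Real.exp (a.re * x) := by
  rw [Complex.norm_exp]; simp

theorem hasDerivAt_cexp_mul_ofReal (a : ℂ) (x : ℝ) :
    HasDerivAt (fun x : ℝ => Complex.exp (a * x)) (a * Complex.exp (a * x)) x := by
  have h := ((Complex.ofRealCLM.hasDerivAt (x := x)).const_mul a).cexp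
  refine h.congr_deriv ?_
  simp [mul_comm]

/-- Passes from y to e^{-ax}y, whose derivative is e^{-ax}f when y' = ay + f. The estimates then
depend only on the sign of Re a + β. -/
theorem exp_mul_norm_eq {a : ℂ} {β x : ℝ} {y : ℂ} :
    Real.exp (β * x) * ‖y‖ = Real.exp ((a.re + β) * x) * ‖Complex.exp (-a * x) * y‖ := by
  rw [norm_mul, norm_cexp_mul_ofReal, ← mul_assoc, ← Real.exp_add, Complex.neg_re]
  congr 2
  ring

/-- Variation of constants, as an estimate. -/
theorem norm_exp_mul_sub_le {a : ℂ} {β F : ℝ} {y f : ℝ → ℂ} (ha : a.re + β ≠ 0)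
    (hy : ∀ x > 0, HasDerivAt y (a * y x + f x) x)
    (hf : ∀ x > 0, Real.exp (β * x) * ‖f x‖ ≤ F) {s t : ℝ} (hs : 0 < s) (hst : s ≤ t) :
    ‖Complex.exp (-a * t) * y t - Complex.exp (-a * s) * y s‖ ≤
      F / (a.re + β) * (Real.exp (-(a.re + β) * s) - Real.exp (-(a.re + β) * t)) := by
  have hd : ∀ x : ℝ, 0 < x →
      HasDerivAt (fun x : ℝ => Complex.exp (-a * x) * y x - Complex.exp (-a * s) * y s)
      (Complex.exp (-a * x) * f x) x := by
    intro x hx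
    refine (((hasDerivAt_cexp_mul_ofReal (-a) x).mul (hy x hx)).sub_const _).congr_deriv ?_
    ring
  -- The comparison function is the primitive of F e^{-(Re a + β)x} vanishing at s. The same formula
  -- covers both signs of Re a + β.
  have hB : ∀ x : ℝ, HasDerivAt (fun x : ℝ => F / (a.re + β) *
      (Real.exp (-(a.re + β) * s) - Real.exp (-(a.re + β) * x)))
      (F * Real.exp (-(a.re + β) * x)) x := by
    intro x
    have h1 := (((hasDerivAt_id x).const_mul (-(a.re + β))).exp.const_sub
      (Real.exp (-(a.re + β) * s))).const_mul (F / (a.re + β))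
    refine h1.congr_deriv ?_
    simp only [id]
    field_simp
  refine image_norm_le_of_norm_deriv_right_le_deriv_boundary
    (f := fun x : ℝ => Complex.exp (-a * x) * y x - Complex.exp (-a * s) * y s) (a := s) (b := t)
    (fun x hx => (hd x (hs.trans_le hx.1)).continuousAt.continuousWithinAt)
    (fun x hx => (hd x (hs.trans_le hx.1)).hasDerivWithinAt) (by simp) (fun x => hB x)
    (fun x hx => ?_) ⟨hst, le_rfl⟩
  have h1 := hf x (hs.trans_le hx.1)
  rw [exp_mul_norm_eq (a := a)] at h1
  have h2 := mul_le_mul_of_nonneg_left h1 (Real.exp_pos (-(a.re + β) * x)).le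
  rw [← mul_assoc, ← Real.exp_add, neg_mul, neg_add_cancel, Real.exp_zero, one_mul] at h2
  rw [mul_comm F]
  rwa [← neg_mul] at h2

/-- Solutions with the growing exponential are bounded by the right-hand side, provided that
their decay relative to it is known at infinity. -/
theorem right_growing_bound_of_tendsto {a : ℂ} {β F : ℝ} {y f : ℝ → ℂ} (ha : 0 < a.re + β)
    (hy : ∀ x > 0, HasDerivAt y (a * y x + f x) x)
    (hlim : Tendsto (fun x : ℝ => Complex.exp (-a * x) * y x) atTop (𝓝 0))
    (hf : ∀ x > 0, Real.exp (β * x) * ‖f x‖ ≤ F) {x : ℝ} (hx : 0 < x) :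
    Real.exp (β * x) * ‖y x‖ ≤ F / (a.re + β) := by
  have hF : 0 ≤ F := le_trans (by positivity) (hf 1 one_pos)
  have h1 : ‖(0 : ℂ) - Complex.exp (-a * x) * y x‖ ≤
      F / (a.re + β) * Real.exp (-(a.re + β) * x) := by
    refine le_of_tendsto (hlim.sub_const _).norm ?_
    filter_upwards [eventually_ge_atTop x] with t ht
    refine (norm_exp_mul_sub_le ha.ne' hy hf hx ht).trans ?_
    gcongr
    linarith [Real.exp_pos (-(a.re + β) * t)]
  rw [zero_sub, norm_neg] at h1
  rw [exp_mul_norm_eq (a := a)]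
  calc _ ≤ Real.exp ((a.re + β) * x) * (F / (a.re + β) * Real.exp (-(a.re + β) * x)) := by gcongr
    _ = F / (a.re + β) * (Real.exp ((a.re + β) * x) * Real.exp (-(a.re + β) * x)) := by ring
    _ = _ := by rw [← Real.exp_add, neg_mul, add_neg_cancel, Real.exp_zero, mul_one]

/-- A weighted bound on y makes e^{-ax}y decay like e^{-(Re a + β)x}, so the solution is pinned down
at infinity. The constant Y is used only qualitatively and drops out of the estimate; no value at
the interface enters either. -/
theorem right_growing_bound {a : ℂ} {β F Y : ℝ} {y f : ℝ → ℂ} (ha : 0 < a.re + β)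
    (hy : ∀ x > 0, HasDerivAt y (a * y x + f x) x)
    (hyb : ∀ x > 0, Real.exp (β * x) * ‖y x‖ ≤ Y)
    (hf : ∀ x > 0, Real.exp (β * x) * ‖f x‖ ≤ F) {x : ℝ} (hx : 0 < x) :
    Real.exp (β * x) * ‖y x‖ ≤ F / (a.re + β) := by
  refine right_growing_bound_of_tendsto ha hy ?_ hf hx
  refine squeeze_zero_norm' (a := fun t => Real.exp (-(a.re + β) * t) * Y) ?_ ?_
  · filter_upwards [eventually_gt_atTop 0] with t ht
    have h1 := hyb t ht
    rw [exp_mul_norm_eq (a := a)] at h1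
    have h2 := mul_le_mul_of_nonneg_left h1 (Real.exp_pos (-(a.re + β) * t)).le
    rwa [← mul_assoc, ← Real.exp_add, neg_mul, neg_add_cancel, Real.exp_zero, one_mul,
      ← neg_mul] at h2
  · have h1 : Tendsto (fun t : ℝ => Real.exp (-(a.re + β) * t)) atTop (𝓝 0) := by
      refine Real.tendsto_exp_atBot.comp ?_
      exact (tendsto_const_mul_atBot_of_neg (by linarith)).2 tendsto_id
    simpa using h1.mul_const Y

/-- Here e^{ax} is itself admissible in the weight, so the value at 0 is free and enters the bound;
variation of constants starts from s → 0⁺. -/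
theorem right_decaying_bound {a : ℂ} {β F : ℝ} {y f : ℝ → ℂ} {y₀ : ℂ} (ha : a.re + β < 0)
    (hy : ∀ x > 0, HasDerivAt y (a * y x + f x) x) (h0 : Tendsto y (𝓝[>] 0) (𝓝 y₀))
    (hf : ∀ x > 0, Real.exp (β * x) * ‖f x‖ ≤ F) {x : ℝ} (hx : 0 < x) :
    Real.exp (β * x) * ‖y x‖ ≤ ‖y₀‖ + F / -(a.re + β) := by
  have hF : 0 ≤ F := le_trans (by positivity) (hf 1 one_pos)
  have hc : Tendsto (fun s : ℝ => Complex.exp (-a * s) * y s) (𝓝[>] 0) (𝓝 y₀) := by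
    have h1 : Tendsto (fun s : ℝ => Complex.exp (-a * s)) (𝓝 0) (𝓝 _) :=
      Continuous.tendsto (by fun_prop) 0
    simpa using (h1.mono_left nhdsWithin_le_nhds).mul h0
  have h1 : ‖Complex.exp (-a * x) * y x - y₀‖ ≤
      F / -(a.re + β) * Real.exp (-(a.re + β) * x) := by
    refine le_of_tendsto (hc.const_sub _).norm ?_
    filter_upwards [Ioc_mem_nhdsGT hx] with s hs
    refine (norm_exp_mul_sub_le ha.ne hy hf hs.1 hs.2).trans ?_
    have h2 : 0 ≤ F / -(a.re + β) := div_nonneg hF (by linarith)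
    have h3 : F / (a.re + β) = -(F / -(a.re + β)) := by rw [div_neg, neg_neg]
    rw [h3]
    nlinarith [mul_nonneg h2 (Real.exp_pos (-(a.re + β) * s)).le]
  have h2 : ‖Complex.exp (-a * x) * y x‖ ≤
      ‖y₀‖ + F / -(a.re + β) * Real.exp (-(a.re + β) * x) := by
    have := norm_add_le (Complex.exp (-a * x) * y x - y₀) y₀
    rw [sub_add_cancel] at this
    linarith
  have h4 : Real.exp ((a.re + β) * x) ≤ 1 := Real.exp_le_one_iff.2 (by nlinarith)
  rw [exp_mul_norm_eq (a := a)]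
  calc _ ≤ Real.exp ((a.re + β) * x) *
        (‖y₀‖ + F / -(a.re + β) * Real.exp (-(a.re + β) * x)) := by gcongr
    _ = Real.exp ((a.re + β) * x) * ‖y₀‖ +
        F / -(a.re + β) * (Real.exp ((a.re + β) * x) * Real.exp (-(a.re + β) * x)) := by ring
    _ ≤ 1 * ‖y₀‖ + F / -(a.re + β) := by
      rw [← Real.exp_add, neg_mul, add_neg_cancel, Real.exp_zero, mul_one]
      gcongr
    _ = _ := by rw [one_mul]

/-- Continuous on `[0, ∞)`, with weighted bound. -/
def IsRight (β : ℝ) (y : ℝ → ℂ) : Prop :=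
  ContinuousOn y (Set.Ici 0) ∧ ∃ C : ℝ, ∀ x > 0, Real.exp (β * x) * ‖y x‖ ≤ C

/-- Continuous on `(-∞, 0]`, with weighted bound. -/
def IsLeft (α : ℝ) (y : ℝ → ℂ) : Prop :=
  ContinuousOn y (Set.Iic 0) ∧ ∃ C : ℝ, ∀ x < 0, Real.exp (α * x) * ‖y x‖ ≤ C

theorem exists_integrating_factor {f : ℝ → ℂ} (hf : ContinuousOn f (Set.Ici 0)) (a : ℂ) :
    ∃ G : ℝ → ℂ, G 0 = 0 ∧ Continuous G ∧
      (∀ x : ℝ, 0 < x → HasDerivAt G (Complex.exp (-a * x) * f x) x) ∧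
      ∀ x : ℝ, 0 < x → G x = ∫ s in (0 : ℝ)..x, Complex.exp (-a * s) * f s := by
  -- Freezing f at f(0) on the negative axis makes the integrand continuous on ℝ, so its primitive
  -- is differentiable everywhere and no endpoint case arises.
  have hg : Continuous fun s : ℝ => Complex.exp (-a * s) * f (max s 0) := by
    refine Continuous.mul (by fun_prop) ?_
    exact hf.comp_continuous (by fun_prop) fun x => Set.mem_Ici.2 (le_max_right _ _)
  have hd : ∀ x : ℝ, HasDerivAt (fun x => ∫ s in (0 : ℝ)..x, Complex.exp (-a * s) * f (max s 0))
      (Complex.exp (-a * x) * f (max x 0)) x := fun x => hg.integral_hasStrictDerivAt 0 x |>.hasDerivAt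
  refine ⟨_, intervalIntegral.integral_same,
    continuous_iff_continuousAt.2 fun x => (hd x).continuousAt, fun x hx => ?_, fun x hx => ?_⟩
  · have := hd x
    rwa [max_eq_left hx.le] at this
  · refine intervalIntegral.integral_congr fun s hs => ?_
    rw [Set.uIcc_of_le hx.le] at hs
    simp only [max_eq_left hs.1]

theorem hasDerivAt_integrating_factor {G f : ℝ → ℂ} {a : ℂ} {x : ℝ} (c : ℂ)
    (h : HasDerivAt G (Complex.exp (-a * x) * f x) x) :
    HasDerivAt (fun x : ℝ => Complex.exp (a * x) * (c + G x))
      (a * (Complex.exp (a * x) * (c + G x)) + f x) x := by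
  refine ((hasDerivAt_cexp_mul_ofReal a x).mul (h.const_add c)).congr_deriv ?_
  have : Complex.exp (a * x) * Complex.exp (-a * x) = 1 := by
    rw [← Complex.exp_add, neg_mul, add_neg_cancel, Complex.exp_zero]
  linear_combination (f x) * this

theorem exists_right_decaying {a : ℂ} {β : ℝ} {f : ℝ → ℂ} (ha : a.re + β < 0) (hf : IsRight β f)
    (y₀ : ℂ) : ∃ y : ℝ → ℂ, IsRight β y ∧ y 0 = y₀ ∧
      ∀ x > 0, HasDerivAt y (a * y x + f x) x := by
  obtain ⟨hfc, F, hF⟩ := hf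
  obtain ⟨G, hG0, hGc, hG, -⟩ := exists_integrating_factor hfc a
  have hd := fun x hx => hasDerivAt_integrating_factor y₀ (hG x hx)
  have hc : Continuous fun x : ℝ => Complex.exp (a * x) * (y₀ + G x) := by fun_prop
  refine ⟨fun x => Complex.exp (a * x) * (y₀ + G x), ⟨hc.continuousOn, _,
    fun x hx => right_decaying_bound ha hd ((hc.tendsto 0).mono_left nhdsWithin_le_nhds) hF hx⟩,
    by simp [hG0], hd⟩

theorem exists_right_growing {a : ℂ} {β : ℝ} {f : ℝ → ℂ} (ha : 0 < a.re + β) (hf : IsRight β f) :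
    ∃ y : ℝ → ℂ, IsRight β y ∧ ∀ x > 0, HasDerivAt y (a * y x + f x) x := by
  obtain ⟨hfc, F, hF⟩ := hf
  obtain ⟨G, hG0, hGc, hG, hGi⟩ := exists_integrating_factor hfc a
  have hinteg : IntegrableOn (fun s : ℝ => Complex.exp (-a * s) * f s) (Set.Ioi 0) := by
    refine ((exp_neg_integrableOn_Ioi 0 ha).const_mul F).mono' ?_ ?_
    · refine ContinuousOn.aestronglyMeasurable ?_ measurableSet_Ioi
      exact ContinuousOn.mul (by fun_prop) (hfc.mono Set.Ioi_subset_Ici_self)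
    · refine (ae_restrict_mem measurableSet_Ioi).mono fun x hx => ?_
      have h1 := hF x hx
      rw [exp_mul_norm_eq (a := a)] at h1
      have h2 := mul_le_mul_of_nonneg_left h1 (Real.exp_pos (-(a.re + β) * x)).le
      rw [← mul_assoc, ← Real.exp_add, neg_mul, neg_add_cancel, Real.exp_zero, one_mul] at h2
      rw [mul_comm F]
      rwa [← neg_mul] at h2
  -- This constant of integration makes e^{-ax}y vanish at infinity, which a growing exponential
  -- requires.
  set c := -∫ s in Set.Ioi (0 : ℝ), Complex.exp (-a * s) * f s with hcdef
  have hlim : Tendsto (fun x => c + G x) atTop (𝓝 0) := by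
    have h1 := (intervalIntegral_tendsto_integral_Ioi 0 hinteg tendsto_id).const_add c
    rw [hcdef, neg_add_cancel, ← hcdef] at h1
    refine h1.congr' ?_
    filter_upwards [eventually_gt_atTop 0] with x hx
    rw [hGi x hx, id]
  have hd := fun x hx => hasDerivAt_integrating_factor c (hG x hx)
  have hc : Continuous fun x : ℝ => Complex.exp (a * x) * (c + G x) := by fun_prop
  refine ⟨fun x => Complex.exp (a * x) * (c + G x), ⟨hc.continuousOn, _,
    fun x hx => right_growing_bound_of_tendsto ha hd ?_ hF hx⟩, hd⟩
  refine hlim.congr fun x => ?_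
  rw [← mul_assoc, ← Complex.exp_add, neg_mul, neg_add_cancel, Complex.exp_zero, one_mul]

/-! Reflection to the left half-line. -/

theorem hasDerivAt_reflect {a : ℂ} {y f : ℝ → ℂ} (hy : ∀ x < 0, HasDerivAt y (a * y x + f x) x) :
    ∀ x > 0, HasDerivAt (fun x => y (-x)) (-a * y (-x) + -f (-x)) x := by
  intro x hx
  have := (hy (-x) (by linarith)).scomp x (hasDerivAt_neg x)
  refine this.congr_deriv ?_
  simp only [neg_smul, one_smul]
  ring

theorem left_bound_reflect {α C : ℝ} {y : ℝ → ℂ} (h : ∀ x < 0, Real.exp (α * x) * ‖y x‖ ≤ C) :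
    ∀ x > 0, Real.exp (-α * x) * ‖y (-x)‖ ≤ C := fun x hx => by
  simpa using h (-x) (by linarith)

theorem left_growing_bound {a : ℂ} {α F Y : ℝ} {y f : ℝ → ℂ} (ha : a.re + α < 0)
    (hy : ∀ x < 0, HasDerivAt y (a * y x + f x) x)
    (hyb : ∀ x < 0, Real.exp (α * x) * ‖y x‖ ≤ Y)
    (hf : ∀ x < 0, Real.exp (α * x) * ‖f x‖ ≤ F) {x : ℝ} (hx : x < 0) :
    Real.exp (α * x) * ‖y x‖ ≤ F / -(a.re + α) := by
  have h := right_growing_bound (a := -a) (β := -α) (y := fun x => y (-x)) (f := fun x => -f (-x))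
    (by rw [Complex.neg_re]; linarith) (hasDerivAt_reflect hy) (left_bound_reflect hyb)
    (by simpa only [norm_neg] using left_bound_reflect hf) (x := -x) (by linarith)
  simpa [add_comm] using h

theorem left_decaying_bound {a : ℂ} {α F : ℝ} {y f : ℝ → ℂ} {y₀ : ℂ} (ha : 0 < a.re + α)
    (hy : ∀ x < 0, HasDerivAt y (a * y x + f x) x) (h0 : Tendsto y (𝓝[<] 0) (𝓝 y₀))
    (hf : ∀ x < 0, Real.exp (α * x) * ‖f x‖ ≤ F) {x : ℝ} (hx : x < 0) :
    Real.exp (α * x) * ‖y x‖ ≤ ‖y₀‖ + F / (a.re + α) := by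
  have ht : Tendsto (fun x : ℝ => -x) (𝓝[>] 0) (𝓝[<] 0) := by
    simpa using tendsto_neg_nhdsGT (a := (0 : ℝ))
  have h := right_decaying_bound (a := -a) (β := -α) (y := fun x => y (-x)) (f := fun x => -f (-x))
    (by rw [Complex.neg_re]; linarith) (hasDerivAt_reflect hy) (h0.comp ht)
    (by simpa only [norm_neg] using left_bound_reflect hf) (x := -x) (by linarith)
  simpa [add_comm] using h

theorem IsLeft.reflect {α : ℝ} {f : ℝ → ℂ} (hf : IsLeft α f) : IsRight (-α) fun x => -f (-x) := by
  obtain ⟨h1, C, h2⟩ := hf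
  refine ⟨(h1.comp continuousOn_neg fun x hx => ?_).neg, C, ?_⟩
  · simpa using hx
  · simpa only [norm_neg] using left_bound_reflect h2

theorem IsRight.reflect {α : ℝ} {f : ℝ → ℂ} (hf : IsRight (-α) f) : IsLeft α fun x => f (-x) := by
  obtain ⟨h1, C, h2⟩ := hf
  refine ⟨h1.comp continuousOn_neg fun x hx => ?_, C, fun x hx => ?_⟩
  · simpa using hx
  · simpa using h2 (-x) (by linarith)

theorem hasDerivAt_reflect_of_right {a : ℂ} {y f : ℝ → ℂ}
    (hy : ∀ x > 0, HasDerivAt y (-a * y x + -f (-x)) x) :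
    ∀ x < 0, HasDerivAt (fun x => y (-x)) (a * y (-x) + f x) x := by
  intro x hx
  have := (hy (-x) (by linarith)).scomp x (hasDerivAt_neg x)
  refine this.congr_deriv ?_
  simp only [neg_smul, one_smul, neg_neg]
  ring

theorem exists_left_decaying {a : ℂ} {α : ℝ} {f : ℝ → ℂ} (ha : 0 < a.re + α) (hf : IsLeft α f)
    (y₀ : ℂ) : ∃ y : ℝ → ℂ, IsLeft α y ∧ y 0 = y₀ ∧
      ∀ x < 0, HasDerivAt y (a * y x + f x) x := by
  obtain ⟨y, h1, h2, h3⟩ := exists_right_decaying (a := -a) (β := -α)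
    (by rw [Complex.neg_re]; linarith) hf.reflect y₀
  exact ⟨_, h1.reflect, by simpa using h2, hasDerivAt_reflect_of_right h3⟩

theorem exists_left_growing {a : ℂ} {α : ℝ} {f : ℝ → ℂ} (ha : a.re + α < 0) (hf : IsLeft α f) :
    ∃ y : ℝ → ℂ, IsLeft α y ∧ ∀ x < 0, HasDerivAt y (a * y x + f x) x := by
  obtain ⟨y, h1, h3⟩ := exists_right_growing (a := -a) (β := -α)
    (by rw [Complex.neg_re]; linarith) hf.reflect
  exact ⟨_, h1.reflect, hasDerivAt_reflect_of_right h3⟩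

/-! Closure properties and gluing. -/

theorem IsRight.add {β : ℝ} {y z : ℝ → ℂ} (hy : IsRight β y) (hz : IsRight β z) :
    IsRight β fun x => y x + z x := by
  obtain ⟨h1, C, h2⟩ := hy
  obtain ⟨h3, D, h4⟩ := hz
  refine ⟨h1.add h3, C + D, fun x hx => ?_⟩
  have := mul_le_mul_of_nonneg_left (norm_add_le (y x) (z x)) (Real.exp_pos (β * x)).le
  linarith [h2 x hx, h4 x hx]

theorem IsRight.const_mul {β : ℝ} {y : ℝ → ℂ} (c : ℂ) (hy : IsRight β y) :
    IsRight β fun x => c * y x := by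
  obtain ⟨h1, C, h2⟩ := hy
  refine ⟨continuousOn_const.mul h1, ‖c‖ * C, fun x hx => ?_⟩
  rw [norm_mul, mul_left_comm]
  exact mul_le_mul_of_nonneg_left (h2 x hx) (norm_nonneg _)

theorem IsLeft.add {β : ℝ} {y z : ℝ → ℂ} (hy : IsLeft β y) (hz : IsLeft β z) :
    IsLeft β fun x => y x + z x := by
  obtain ⟨h1, C, h2⟩ := hy
  obtain ⟨h3, D, h4⟩ := hz
  refine ⟨h1.add h3, C + D, fun x hx => ?_⟩
  have := mul_le_mul_of_nonneg_left (norm_add_le (y x) (z x)) (Real.exp_pos (β * x)).le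
  linarith [h2 x hx, h4 x hx]

theorem IsLeft.const_mul {β : ℝ} {y : ℝ → ℂ} (c : ℂ) (hy : IsLeft β y) :
    IsLeft β fun x => c * y x := by
  obtain ⟨h1, C, h2⟩ := hy
  refine ⟨continuousOn_const.mul h1, ‖c‖ * C, fun x hx => ?_⟩
  rw [norm_mul, mul_left_comm]
  exact mul_le_mul_of_nonneg_left (h2 x hx) (norm_nonneg _)

theorem isLeft_cexp {α : ℝ} {a : ℂ} (ha : 0 ≤ a.re + α) :
    IsLeft α fun x => Complex.exp (a * x) := by
  refine ⟨by fun_prop, 1, fun x hx => ?_⟩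
  rw [norm_cexp_mul_ofReal, ← Real.exp_add]
  exact Real.exp_le_one_iff.2 (by nlinarith)

theorem isRight_cexp {β : ℝ} {a : ℂ} (ha : a.re + β ≤ 0) :
    IsRight β fun x => Complex.exp (a * x) := by
  refine ⟨by fun_prop, 1, fun x hx => ?_⟩
  rw [norm_cexp_mul_ofReal, ← Real.exp_add]
  exact Real.exp_le_one_iff.2 (by nlinarith)

/-! ### Extension from the left half-line, and gluing of two half-line functions. -/

namespace Weighted

variable {α β : ℝ}

theorem isRight (u : Weighted α β) : IsRight β u :=
  ⟨u.isWeighted.cont_pos, u.isWeighted.bdd_pos⟩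

/-- The continuous extension of the restriction to the left half-line. -/
noncomputable def leftExt (u : Weighted α β) (ξ : ℝ) : ℂ :=
  if ξ < 0 then u ξ else Function.leftLim u 0

theorem leftExt_of_neg (u : Weighted α β) {ξ : ℝ} (h : ξ < 0) : leftExt u ξ = u ξ := if_pos h

theorem isLeft (u : Weighted α β) : IsLeft α (leftExt u) := by
  refine ⟨fun ξ hξ => ?_, ?_⟩
  · rcases (Set.mem_Iic.1 hξ).eq_or_lt with rfl | h
    · rw [← continuousWithinAt_Iio_iff_Iic, ContinuousWithinAt]
      have h0 : leftExt u 0 = Function.leftLim u 0 := if_neg (lt_irrefl _)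
      rw [h0]
      refine u.tendsto_neg.congr' ?_
      filter_upwards [self_mem_nhdsWithin] with x hx using (u.leftExt_of_neg hx).symm
    · refine ContinuousAt.continuousWithinAt ?_
      refine (u.isWeighted.cont_neg.continuousAt (Iio_mem_nhds h)).congr ?_
      filter_upwards [Iio_mem_nhds h] with x hx using (u.leftExt_of_neg hx).symm
  · obtain ⟨C, hC⟩ := u.isWeighted.bdd_neg
    exact ⟨C, fun ξ hξ => by rw [u.leftExt_of_neg hξ]; exact hC ξ hξ⟩

theorem norm_zero_le (u : Weighted α β) {C : ℝ}
    (h : ∀ ξ > 0, Real.exp (β * ξ) * ‖u ξ‖ ≤ C) : ‖u 0‖ ≤ C := by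
  have h1 : Tendsto (fun ξ : ℝ => Real.exp (β * ξ) * ‖u ξ‖) (𝓝[>] 0)
      (𝓝 (Real.exp (β * 0) * ‖u 0‖)) :=
    ((by fun_prop : Continuous fun ξ : ℝ => Real.exp (β * ξ)).tendsto 0 |>.mono_left
      nhdsWithin_le_nhds).mul u.tendsto_pos.norm
  have h2 := le_of_tendsto h1 (b := C) (by
    filter_upwards [self_mem_nhdsWithin] with x hx using h x hx)
  simpa using h2

theorem norm_le_of_bounds (u : Weighted α β) {C D : ℝ}
    (hC : ∀ ξ < 0, Real.exp (α * ξ) * ‖u ξ‖ ≤ C) (hD : ∀ ξ > 0, Real.exp (β * ξ) * ‖u ξ‖ ≤ D) :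
    ‖u‖ ≤ C + D := by
  have : Nonempty (Set.Iio (0 : ℝ)) := ⟨⟨-1, by simp⟩⟩
  have : Nonempty (Set.Ioi (0 : ℝ)) := ⟨⟨1, by simp⟩⟩
  rw [norm_def]
  exact add_le_add (ciSup_le fun ξ => hC ξ ξ.2) (ciSup_le fun ξ => hD ξ ξ.2)

theorem isWeighted_glue {l r : ℝ → ℂ} (hl : IsLeft α l) (hr : IsRight β r) :
    IsWeighted α β fun ξ => if ξ < 0 then l ξ else r ξ := by
  obtain ⟨h1, C, h2⟩ := hl
  obtain ⟨h3, D, h4⟩ := hr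
  refine ⟨(h1.mono Set.Iio_subset_Iic_self).congr fun ξ hξ => if_pos hξ,
    h3.congr fun ξ hξ => if_neg (not_lt.2 hξ), ⟨l 0, ?_⟩, ⟨C, fun ξ hξ => ?_⟩,
    ⟨D, fun ξ hξ => ?_⟩⟩
  · have : Tendsto l (𝓝[<] 0) (𝓝 (l 0)) :=
      (h1 0 Set.self_mem_Iic).mono_left (nhdsWithin_mono _ Set.Iio_subset_Iic_self)
    refine this.congr' ?_
    filter_upwards [self_mem_nhdsWithin] with x hx using (if_pos hx).symm
  · simp only [if_pos hξ]; exact h2 ξ hξ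
  · simp only [if_neg (not_lt.2 (le_of_lt hξ))]; exact h4 ξ hξ

/-- The element that is `l` on the left and `r` on the right half-line. -/
noncomputable def glue {l r : ℝ → ℂ} (hl : IsLeft α l) (hr : IsRight β r) : Weighted α β :=
  mk _ (isWeighted_glue hl hr)

variable {l r l' r' : ℝ → ℂ}

theorem glue_of_neg (hl : IsLeft α l) (hr : IsRight β r) {ξ : ℝ} (h : ξ < 0) :
    glue hl hr ξ = l ξ := if_pos h

theorem glue_of_nonneg (hl : IsLeft α l) (hr : IsRight β r) {ξ : ℝ} (h : 0 ≤ ξ) :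
    glue hl hr ξ = r ξ := if_neg (not_lt.2 h)

theorem leftLim_glue (hl : IsLeft α l) (hr : IsRight β r) :
    Function.leftLim (glue hl hr) 0 = l 0 := by
  have : Tendsto l (𝓝[<] 0) (𝓝 (l 0)) :=
    (hl.1 0 Set.self_mem_Iic).mono_left (nhdsWithin_mono _ Set.Iio_subset_Iic_self)
  refine leftLim_eq_of_tendsto (this.congr' ?_)
  filter_upwards [self_mem_nhdsWithin] with x hx using (glue_of_neg hl hr hx).symm

theorem jump_glue (hl : IsLeft α l) (hr : IsRight β r) : jump (glue hl hr) = r 0 - l 0 := by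
  rw [jump_eq, leftLim_glue, glue_of_nonneg hl hr le_rfl]

theorem hasDeriv_glue (hl : IsLeft α l) (hr : IsRight β r) (hl' : IsLeft α l')
    (hr' : IsRight β r') (h : ∀ ξ < 0, HasDerivAt l (l' ξ) ξ) (h' : ∀ ξ > 0, HasDerivAt r (r' ξ) ξ) :
    HasDeriv (glue hl hr) (glue hl' hr') := by
  intro ξ hξ
  rcases lt_or_gt_of_ne hξ with hξ | hξ
  · rw [glue_of_neg hl' hr' hξ]
    refine (h ξ hξ).congr_of_eventuallyEq ?_
    filter_upwards [Iio_mem_nhds hξ] with x hx using glue_of_neg hl hr hx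
  · rw [glue_of_nonneg hl' hr' hξ.le]
    refine (h' ξ hξ).congr_of_eventuallyEq ?_
    filter_upwards [Ioi_mem_nhds hξ] with x hx using glue_of_nonneg hl hr (le_of_lt hx)

end Weighted

/-! ### Square roots and characteristic exponents -/

theorem csqrt_sq (z : ℂ) : csqrt z ^ 2 = z := by
  simp [csqrt]

theorem csqrt_re_nonneg (z : ℂ) : 0 ≤ (csqrt z).re := by
  by_cases hz : z = 0
  · simp [csqrt, hz]
  · rw [csqrt, Complex.cpow_def_of_ne_zero hz, Complex.exp_re]
    refine mul_nonneg (Real.exp_pos _).le (Real.cos_nonneg_of_neg_pi_div_two_le_of_le ?_ ?_)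
    all_goals
      have h1 : (Complex.log z * (1 / 2)).im = z.arg / 2 := by
        rw [show (1 / 2 : ℂ) = ((1 / 2 : ℝ) : ℂ) by norm_num, Complex.im_mul_ofReal,
          Complex.log_im]
        ring
      rw [h1]
      linarith [Complex.neg_pi_lt_arg z, Complex.arg_le_pi z]

/-- For a square root x + iy one has |z| = x² + y² and Re z = x² - y². This is the source of the
growth of the decay rates in a sector. -/
theorem csqrt_re_sq (z : ℂ) : (csqrt z).re ^ 2 = (‖z‖ + z.re) / 2 := by
  have h1 : ‖z‖ = (csqrt z).re ^ 2 + (csqrt z).im ^ 2 := by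
    rw [← csqrt_sq z, norm_pow, csqrt_sq, ← Complex.normSq_eq_norm_sq, Complex.normSq_apply]
    ring
  have h2 : z.re = (csqrt z).re ^ 2 - (csqrt z).im ^ 2 := by
    conv_lhs => rw [← csqrt_sq z]
    rw [sq, Complex.mul_re]
    ring
  rw [h1, h2]
  ring

theorem csqrt_re_pos {z : ℂ} (h : z ∈ Complex.slitPlane) : 0 < (csqrt z).re := by
  refine lt_of_le_of_ne (csqrt_re_nonneg z) fun h0 => ?_
  have h1 := csqrt_re_sq z
  rw [← h0] at h1
  rcases Complex.mem_slitPlane_iff.1 h with h2 | h2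
  · linarith [norm_nonneg z]
  · have h3 := Complex.abs_re_lt_norm.2 h2
    have h4 := neg_abs_le z.re
    linarith

theorem csqrt_ofReal_sq {x : ℝ} (hx : 0 ≤ x) : csqrt ((x : ℂ) ^ 2) = x := by
  have h1 : (csqrt ((x : ℂ) ^ 2) - x) * (csqrt ((x : ℂ) ^ 2) + x) = 0 := by
    linear_combination csqrt_sq ((x : ℂ) ^ 2)
  rcases mul_eq_zero.1 h1 with h2 | h2
  · exact sub_eq_zero.1 h2
  · have h3 := congrArg Complex.re h2
    simp only [Complex.add_re, Complex.ofReal_re, Complex.zero_re] at h3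
    have h4 := csqrt_re_nonneg ((x : ℂ) ^ 2)
    have h5 : x = 0 := by linarith
    subst h5
    simp [csqrt]

theorem hasDerivAt_csqrt {z : ℂ} (h : z ∈ Complex.slitPlane) :
    HasDerivAt csqrt (1 / (2 * csqrt z)) z := by
  have h1 := (hasDerivAt_id z).cpow_const (c := (1 / 2 : ℂ)) h
  refine h1.congr_deriv ?_
  have hz : z ≠ 0 := Complex.slitPlane_ne_zero h
  have hs : csqrt z ≠ 0 := fun h0 => hz (by rw [← csqrt_sq z, h0]; simp)
  have h2 : z ^ (1 / 2 - 1 : ℂ) = csqrt z / z := by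
    rw [Complex.cpow_sub _ _ hz, Complex.cpow_one, csqrt]
  simp only [id, mul_one]
  rw [h2]
  nth_rewrite 2 [← csqrt_sq z]
  field_simp

noncomputable section

/-- The exponents that are conjugate to `k2`, `k3` and `k6`. -/
def k1 (lam : ℂ) : ℂ := (-1 + H1 lam) / 2

def k4 (Θi Le : ℝ) (lam : ℂ) : ℂ := (-Le - H2 Θi Le lam) / 2

def k5 (Le : ℝ) (lam : ℂ) : ℂ := (-Le + H3 Le lam) / 2

end

theorem H1_sq (lam : ℂ) : H1 lam ^ 2 = 1 + 4 * lam := csqrt_sq _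

theorem H2_sq (Θi Le : ℝ) (lam : ℂ) :
    H2 Θi Le lam ^ 2 = Le ^ 2 + 4 * Le * (coeffA Θi Le + lam) := csqrt_sq _

theorem H3_sq (Le : ℝ) (lam : ℂ) : H3 Le lam ^ 2 = Le ^ 2 + 4 * Le * lam := csqrt_sq _

/-- Vieta's relations for k² + k = lam, k² + Le k = Le(A + lam) and k² + Le k = Le lam. They are
what allows the second-order equations to be factored into first-order ones. -/
theorem k1_add_k2 (lam : ℂ) : k1 lam + k2 lam = -1 := by simp only [k1, k2]; ring

theorem k1_mul_k2 (lam : ℂ) : k1 lam * k2 lam = -lam := by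
  simp only [k1, k2]; linear_combination (-1 / 4) * H1_sq lam

theorem k3_add_k4 (Θi Le : ℝ) (lam : ℂ) : k3 Θi Le lam + k4 Θi Le lam = -Le := by
  simp only [k3, k4]; ring

theorem k3_mul_k4 (Θi Le : ℝ) (lam : ℂ) :
    k3 Θi Le lam * k4 Θi Le lam = -(Le * (coeffA Θi Le + lam)) := by
  simp only [k3, k4]; linear_combination (-1 / 4) * H2_sq Θi Le lam

theorem k5_add_k6 (Le : ℝ) (lam : ℂ) : k5 Le lam + k6 Le lam = -Le := by
  simp only [k5, k6]; ring

theorem k5_mul_k6 (Le : ℝ) (lam : ℂ) : k5 Le lam * k6 Le lam = -(Le * lam) := by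
  simp only [k5, k6]; linear_combination (-1 / 4) * H3_sq Le lam

theorem re_div_two (z : ℂ) : (z / 2).re = z.re / 2 := by
  simp

/-- Positions of the exponents relative to the weights. For the pairs k1, k2 and k5, k6 the weight
is centred and the margins are opposite. For k3, k4 the sum is -Le while the weight exponent is 1/2,
which shifts the margins by (Le - 1)/2 and produces 𝒫. -/
theorem k1_re (lam : ℂ) : (k1 lam).re + 1 / 2 = (H1 lam).re / 2 := by
  rw [k1, re_div_two]; simp; ring

theorem k2_re (lam : ℂ) : (k2 lam).re + 1 / 2 = -((H1 lam).re / 2) := by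
  rw [k2, re_div_two]; simp; ring

theorem k3_re (Θi Le : ℝ) (lam : ℂ) :
    (k3 Θi Le lam).re + 1 / 2 = ((H2 Θi Le lam).re - (Le - 1)) / 2 := by
  rw [k3, re_div_two]; simp; ring

theorem k4_re (Θi Le : ℝ) (lam : ℂ) :
    (k4 Θi Le lam).re + 1 / 2 = -(((H2 Θi Le lam).re + (Le - 1)) / 2) := by
  rw [k4, re_div_two]; simp; ring

theorem k5_re (Le : ℝ) (lam : ℂ) : (k5 Le lam).re + Le / 2 = (H3 Le lam).re / 2 := by
  rw [k5, re_div_two]; simp; ring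

theorem k6_re (Le : ℝ) (lam : ℂ) : (k6 Le lam).re + Le / 2 = -((H3 Le lam).re / 2) := by
  rw [k6, re_div_two]; simp; ring

theorem coeffA_pos {Θi Le : ℝ} (h0 : 0 < Θi) (h1 : Θi < 1) (hLe : 1 < Le) :
    0 < coeffA Θi Le := by
  have : 0 < 1 - Θi := by linarith
  unfold coeffA
  positivity

theorem mem_slitPlane_H1 {lam : ℂ} (h : lam ∉ halfLine) : 1 + 4 * lam ∈ Complex.slitPlane := by
  rw [Complex.mem_slitPlane_iff]
  by_cases him : lam.im = 0
  · left
    have : ¬lam.re ≤ -(1 / 4) := fun hr => h ⟨him, hr⟩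
    simp
    linarith
  · right
    simpa using him

/-- The cut of H3 is (-∞, -Le/4], contained in the half-line because Le > 1. -/
theorem mem_slitPlane_H3 {Le : ℝ} (hLe : 1 < Le) {lam : ℂ} (h : lam ∉ halfLine) :
    (Le : ℂ) ^ 2 + 4 * Le * lam ∈ Complex.slitPlane := by
  have hre : ((Le : ℂ) ^ 2 + 4 * Le * lam).re = Le ^ 2 + 4 * Le * lam.re := by
    simp [sq]
  have him' : ((Le : ℂ) ^ 2 + 4 * Le * lam).im = 4 * Le * lam.im := by
    simp [sq]
  rw [Complex.mem_slitPlane_iff, hre, him']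
  by_cases him : lam.im = 0
  · left
    have : ¬lam.re ≤ -(1 / 4) := fun hr => h ⟨him, hr⟩
    nlinarith
  · right
    positivity

theorem H1_re_pos {lam : ℂ} (h : lam ∉ halfLine) : 0 < (H1 lam).re :=
  csqrt_re_pos (mem_slitPlane_H1 h)

theorem H3_re_pos {Le : ℝ} (hLe : 1 < Le) {lam : ℂ} (h : lam ∉ halfLine) : 0 < (H3 Le lam).re :=
  csqrt_re_pos (mem_slitPlane_H3 hLe h)

/-- The defining expression of `𝒫`, in terms of the square root `H2`. -/
theorem regionP_expr {Θi Le : ℝ} (hLe : 1 < Le) (lam : ℂ) :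
    4 * Le ^ 3 * ((1 - 1 / Le) ^ 2 * lam.re + 1 / Le * lam.im ^ 2 +
      ((2 * coeffA Θi Le + 1) / 2 - (8 * coeffA Θi Le + 5) / (4 * Le)
        + (1 + coeffA Θi Le) / Le ^ 2 - 1 / (4 * Le ^ 3))) =
    ((H2 Θi Le lam).re ^ 2 - (Le - 1) ^ 2) * ((Le - 1) ^ 2 + (H2 Θi Le lam).im ^ 2) := by
  have h := H2_sq Θi Le lam
  have hre := congrArg Complex.re h
  have him := congrArg Complex.im h
  have hL : ((Le : ℂ) ^ 2) = ((Le ^ 2 : ℝ) : ℂ) := by push_cast; ring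
  have hL' : (4 * Le : ℂ) = ((4 * Le : ℝ) : ℂ) := by push_cast; ring
  rw [sq, hL, hL', Complex.add_re, Complex.re_ofReal_mul, Complex.mul_re, Complex.add_re,
    Complex.ofReal_re, Complex.ofReal_re] at hre
  rw [sq, hL, hL', Complex.add_im, Complex.im_ofReal_mul, Complex.mul_im, Complex.add_im,
    Complex.ofReal_im, Complex.ofReal_im] at him
  generalize (H2 Θi Le lam).re = x at *
  generalize (H2 Θi Le lam).im = y at *
  generalize coeffA Θi Le = A at *
  -- The equation for H2² is solved for lam in terms of x = Re H2 and y = Im H2; the claim then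
  -- becomes a polynomial identity in x, y, A and Le after clearing denominators.
  have hy : lam.im = x * y / (2 * Le) := by
    field_simp
    linarith
  have hx : lam.re = (x * x - y * y - Le ^ 2) / (4 * Le) - A := by
    field_simp
    linarith
  rw [hx, hy]
  field_simp
  ring

/-- In `regionP_expr` the last factor is positive since Le > 1, and Re H2 ≥ 0, so the sign is that
of Re H2 - (Le - 1). Thus 𝒫 is where e^{k3 ξ} fails to decay, in the weight, at -∞. -/
theorem mem_regionP_iff {Θi Le : ℝ} (hLe : 1 < Le) (lam : ℂ) :
    lam ∈ regionP Θi Le ↔ (H2 Θi Le lam).re ≤ Le - 1 := by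
  have h := regionP_expr (Θi := Θi) hLe lam
  have hx : 0 ≤ (H2 Θi Le lam).re := csqrt_re_nonneg _
  have h4 : 0 < 4 * Le ^ 3 := by positivity
  have hm : 0 < Le - 1 := by linarith
  have h5 : 0 < (Le - 1) ^ 2 + (H2 Θi Le lam).im ^ 2 := by positivity
  rw [regionP, Set.mem_ofPred_eq]
  constructor
  · intro h1
    by_contra h2
    have h3 : 0 < (H2 Θi Le lam).re ^ 2 - (Le - 1) ^ 2 := by nlinarith
    have := mul_pos h3 h5
    rw [← h] at this
    nlinarith
  · intro h1
    have h3 : (H2 Θi Le lam).re ^ 2 - (Le - 1) ^ 2 ≤ 0 := by nlinarith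
    have := mul_nonpos_of_nonpos_of_nonneg h3 h5.le
    rw [← h] at this
    exact nonpos_of_mul_nonpos_right this h4

/-! ### Exponents and dispersion relation near zero. -/

theorem zero_notMem_halfLine : (0 : ℂ) ∉ halfLine := by
  rintro ⟨-, h⟩
  norm_num at h

theorem H1_zero : H1 0 = 1 := by
  have := csqrt_ofReal_sq (zero_le_one' ℝ)
  simpa [H1] using this

theorem H3_zero {Le : ℝ} (hLe : 1 < Le) : H3 Le 0 = Le := by
  have := csqrt_ofReal_sq (zero_le_one.trans hLe.le)
  simpa [H3] using this

/-- The choice of A makes Le² + 4 Le A the square of Le + 2ρ, with ρ = Θi/(1 - Θi). Hence k3 at 0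
equals ρ, the exponent of the wave on the left. -/
theorem H2_zero {Θi Le : ℝ} (h0 : 0 < Θi) (h1 : Θi < 1) (hLe : 1 < Le) :
    H2 Θi Le 0 = ((Le + 2 * (Θi / (1 - Θi)) : ℝ) : ℂ) := by
  have hr : 0 < 1 - Θi := by linarith
  have hle : Le ≠ 0 := by linarith
  have h2 : ((Le + 2 * (Θi / (1 - Θi)) : ℝ)) ^ 2 = Le ^ 2 + 4 * Le * coeffA Θi Le := by
    unfold coeffA
    field_simp
    ring
  rw [← csqrt_ofReal_sq (x := Le + 2 * (Θi / (1 - Θi))) (by positivity), H2, add_zero]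
  congr 1
  rw [← Complex.ofReal_pow (Le + 2 * (Θi / (1 - Θi))), h2]
  push_cast
  ring

theorem zero_notMem_regionP {Θi Le : ℝ} (h0 : 0 < Θi) (h1 : Θi < 1) (hLe : 1 < Le) :
    (0 : ℂ) ∉ regionP Θi Le := by
  have hr : 0 < Θi / (1 - Θi) := div_pos h0 (by linarith)
  rw [mem_regionP_iff hLe, H2_zero h0 h1 hLe, Complex.ofReal_re]
  linarith

theorem slitPlane_H2_zero {Θi Le : ℝ} (h0 : 0 < Θi) (h1 : Θi < 1) (hLe : 1 < Le) :
    (Le : ℂ) ^ 2 + 4 * Le * (coeffA Θi Le + 0) ∈ Complex.slitPlane := by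
  have hA := coeffA_pos h0 h1 hLe
  rw [add_zero, show (Le : ℂ) ^ 2 + 4 * Le * coeffA Θi Le =
    ((Le ^ 2 + 4 * Le * coeffA Θi Le : ℝ) : ℂ) by push_cast; ring, Complex.ofReal_mem_slitPlane]
  positivity

theorem hasDerivAt_H1_zero : HasDerivAt H1 2 0 := by
  have h1 : HasDerivAt (fun lam : ℂ => 1 + 4 * lam) 4 0 := by
    simpa using ((hasDerivAt_id (0 : ℂ)).const_mul 4).const_add 1
  have h2 := (hasDerivAt_csqrt (mem_slitPlane_H1 zero_notMem_halfLine)).comp 0 h1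
  refine h2.congr_deriv ?_
  change 1 / (2 * H1 0) * 4 = 2
  rw [H1_zero]
  norm_num

theorem hasDerivAt_H3_zero {Le : ℝ} (hLe : 1 < Le) : HasDerivAt (H3 Le) 2 0 := by
  have h1 : HasDerivAt (fun lam : ℂ => (Le : ℂ) ^ 2 + 4 * Le * lam) (4 * Le : ℂ) 0 := by
    simpa using ((hasDerivAt_id (0 : ℂ)).const_mul (4 * (Le : ℂ))).const_add ((Le : ℂ) ^ 2)
  have h2 := (hasDerivAt_csqrt (mem_slitPlane_H3 hLe zero_notMem_halfLine)).comp 0 h1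
  refine h2.congr_deriv ?_
  change 1 / (2 * H3 Le 0) * (4 * Le) = 2
  have : (Le : ℂ) ≠ 0 := by exact_mod_cast (by linarith : Le ≠ 0)
  rw [H3_zero hLe]
  field_simp
  norm_num

theorem hasDerivAt_H2_zero {Θi Le : ℝ} (h0 : 0 < Θi) (h1 : Θi < 1) (hLe : 1 < Le) :
    HasDerivAt (H2 Θi Le) (((2 * Le / (Le + 2 * (Θi / (1 - Θi))) : ℝ)) : ℂ) 0 := by
  have h2 : HasDerivAt (fun lam : ℂ => (Le : ℂ) ^ 2 + 4 * Le * (coeffA Θi Le + lam))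
      (4 * Le : ℂ) 0 := by
    simpa using (((hasDerivAt_id (0 : ℂ)).const_add (coeffA Θi Le : ℂ)).const_mul
      (4 * (Le : ℂ))).const_add ((Le : ℂ) ^ 2)
  have h3 := (hasDerivAt_csqrt (slitPlane_H2_zero h0 h1 hLe)).comp 0 h2
  refine h3.congr_deriv ?_
  change 1 / (2 * H2 Θi Le 0) * (4 * Le) = _
  rw [H2_zero h0 h1 hLe, Complex.ofReal_div]
  have : 0 < Le + 2 * (Θi / (1 - Θi)) := by
    have := div_pos h0 (sub_pos.2 h1)
    linarith
  have h5 : ((Le + 2 * (Θi / (1 - Θi)) : ℝ) : ℂ) ≠ 0 := by exact_mod_cast this.ne'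
  generalize ((Le + 2 * (Θi / (1 - Θi)) : ℝ) : ℂ) = w at *
  push_cast
  field_simp
  norm_num

/-- With ρ = Θi/(1 - Θi), at 0 one has k6 = -Le, k3 = ρ, k2 = -1, so the product is -(Le + ρ)(ρ +
1)Θi = -ρ(Le + ρ), which is -A Le. -/
theorem dispersion_zero {Θi Le : ℝ} (h0 : 0 < Θi) (h1 : Θi < 1) (hLe : 1 < Le) :
    dispersion Θi Le 0 = 0 := by
  have hr : 1 - Θi ≠ 0 := by linarith
  have hle : Le ≠ 0 := by linarith
  have hH : csqrt (1 + 4 * 0) = 1 := H1_zero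
  rw [dispersion, k2, k3, k6, H1_zero, H2_zero h0 h1 hLe, H3_zero hLe, hH]
  have : (((-Le - Le) / 2 - (-Le + (Le + 2 * (Θi / (1 - Θi)))) / 2) *
      ((-Le + (Le + 2 * (Θi / (1 - Θi)))) / 2 - (-1 - 1) / 2) * (1 - (1 - Θi) * 1) +
      coeffA Θi Le * Le : ℝ) = 0 := by
    unfold coeffA
    field_simp
    ring
  exact_mod_cast this

/-- What matters is that this value is positive: the zero at 0 is simple, and this becomes the
simplicity of the pole of the resolvent. -/
theorem hasDerivAt_dispersion_zero {Θi Le : ℝ} (h0 : 0 < Θi) (h1 : Θi < 1) (hLe : 1 < Le) :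
    HasDerivAt (dispersion Θi Le)
      ((2 * (Le + Θi / (1 - Θi)) ^ 2 * (1 - Θi) / (Le + 2 * (Θi / (1 - Θi))) : ℝ) : ℂ) 0 := by
  have hr : 0 < 1 - Θi := by linarith
  have d1 := hasDerivAt_H1_zero
  have d2 := hasDerivAt_H2_zero h0 h1 hLe
  have d3 := hasDerivAt_H3_zero hLe
  have hk2 : HasDerivAt k2 (-1) 0 := by
    refine ((d1.const_sub (-1)).div_const 2).congr_deriv ?_
    norm_num
  have hk3 : HasDerivAt (k3 Θi Le) (((2 * Le / (Le + 2 * (Θi / (1 - Θi))) : ℝ) : ℂ) / 2) 0 :=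
    (d2.const_add (-(Le : ℂ))).div_const 2
  have hk6 : HasDerivAt (k6 Le) (-1) 0 := by
    refine ((d3.const_sub (-(Le : ℂ))).div_const 2).congr_deriv ?_
    norm_num
  have hD := (((hk6.sub hk3).mul (hk3.sub hk2)).mul
    ((d1.const_mul (1 - Θi : ℂ)).const_sub 1)).add_const ((coeffA Θi Le : ℂ) * Le)
  refine hD.congr_deriv ?_
  simp only [Pi.sub_apply, Pi.mul_apply]
  rw [k2, k3, k6, H1_zero, H2_zero h0 h1 hLe, H3_zero hLe]
  have hpos : 0 < Le + 2 * (Θi / (1 - Θi)) := by positivity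
  have hpos2 : Le * (1 - Θi) + 2 * Θi ≠ 0 := by
    have : 0 < Le * (1 - Θi) + 2 * Θi := by positivity
    exact this.ne'
  have key : ((-1 - 2 * Le / (Le + 2 * (Θi / (1 - Θi))) / 2) *
      ((-Le + (Le + 2 * (Θi / (1 - Θi)))) / 2 - (-1 - 1) / 2) +
      ((-Le - Le) / 2 - (-Le + (Le + 2 * (Θi / (1 - Θi)))) / 2) *
      (2 * Le / (Le + 2 * (Θi / (1 - Θi))) / 2 - -1)) * (1 - (1 - Θi) * 1) +
      ((-Le - Le) / 2 - (-Le + (Le + 2 * (Θi / (1 - Θi)))) / 2) *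
      ((-Le + (Le + 2 * (Θi / (1 - Θi)))) / 2 - (-1 - 1) / 2) * -((1 - Θi) * 2) =
      2 * (Le + Θi / (1 - Θi)) ^ 2 * (1 - Θi) / (Le + 2 * (Θi / (1 - Θi))) := by
    field_simp
    ring
  exact_mod_cast key

theorem dispersion_lower_bound {Θi Le : ℝ} (h0 : 0 < Θi) (h1 : Θi < 1) (hLe : 1 < Le) :
    ∃ c > 0, ∀ᶠ lam in 𝓝[≠] (0 : ℂ), c * ‖lam‖ ≤ ‖dispersion Θi Le lam‖ := by
  have hd := hasDerivAt_dispersion_zero h0 h1 hLe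
  set d : ℝ := 2 * (Le + Θi / (1 - Θi)) ^ 2 * (1 - Θi) / (Le + 2 * (Θi / (1 - Θi))) with hddef
  have hr : 0 < 1 - Θi := by linarith
  have hdpos : 0 < d := by positivity
  refine ⟨d / 2, by positivity, ?_⟩
  have h2 := (hasDerivAt_iff_tendsto_slope.1 hd).norm
  rw [Complex.norm_real, Real.norm_of_nonneg hdpos.le] at h2
  filter_upwards [h2.eventually (lt_mem_nhds (half_lt_self hdpos)), self_mem_nhdsWithin]
    with lam hlam hne
  have hn : 0 < ‖lam‖ := norm_pos_iff.2 hne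
  rw [slope_def_module, dispersion_zero h0 h1 hLe, sub_zero, sub_zero, norm_smul, norm_inv,
    inv_mul_eq_div, lt_div_iff₀ hn] at hlam
  exact hlam.le

/-! ### The resolvent equation -/

section ResolventEquation

variable {Θi Le : ℝ}

theorem W_bound_fst_neg (F : W Le) {ξ : ℝ} (h : ξ < 0) :
    Real.exp (1 / 2 * ξ) * ‖F.fst ξ‖ ≤ ‖F‖ := by
  rw [WithLp.prod_norm_eq_of_L1]
  exact (F.fst.le_norm_neg h).trans (le_add_of_nonneg_right (norm_nonneg _))

theorem W_bound_fst_pos (F : W Le) {ξ : ℝ} (h : 0 < ξ) :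
    Real.exp (1 / 2 * ξ) * ‖F.fst ξ‖ ≤ ‖F‖ := by
  rw [WithLp.prod_norm_eq_of_L1]
  exact (F.fst.le_norm_pos h).trans (le_add_of_nonneg_right (norm_nonneg _))

theorem W_bound_snd_neg (F : W Le) {ξ : ℝ} (h : ξ < 0) :
    Real.exp (1 / 2 * ξ) * ‖F.snd ξ‖ ≤ ‖F‖ := by
  rw [WithLp.prod_norm_eq_of_L1]
  exact (F.snd.le_norm_neg h).trans (le_add_of_nonneg_left (norm_nonneg _))

theorem W_bound_snd_pos (F : W Le) {ξ : ℝ} (h : 0 < ξ) :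
    Real.exp (Le / 2 * ξ) * ‖F.snd ξ‖ ≤ ‖F‖ := by
  rw [WithLp.prod_norm_eq_of_L1]
  exact (F.snd.le_norm_pos h).trans (le_add_of_nonneg_left (norm_nonneg _))

theorem norm_le_of_tendsto_left {α C : ℝ} {y : ℝ → ℂ} {y₀ : ℂ} (h : Tendsto y (𝓝[<] 0) (𝓝 y₀))
    (hC : ∀ ξ < 0, Real.exp (α * ξ) * ‖y ξ‖ ≤ C) : ‖y₀‖ ≤ C := by
  have h1 : Tendsto (fun ξ : ℝ => Real.exp (α * ξ) * ‖y ξ‖) (𝓝[<] 0)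
      (𝓝 (Real.exp (α * 0) * ‖y₀‖)) :=
    ((by fun_prop : Continuous fun ξ : ℝ => Real.exp (α * ξ)).tendsto 0 |>.mono_left
      nhdsWithin_le_nhds).mul h.norm
  have h2 := le_of_tendsto h1 (b := C) (by
    filter_upwards [self_mem_nhdsWithin] with x hx using hC x hx)
  simpa using h2

theorem tendsto_cexp_left (a c : ℂ) :
    Tendsto (fun ξ : ℝ => c * Complex.exp (a * ξ)) (𝓝[<] 0) (𝓝 c) := by
  have h : Tendsto (fun ξ : ℝ => c * Complex.exp (a * ξ)) (𝓝 0) (𝓝 _) :=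
    Continuous.tendsto (by fun_prop) 0
  simpa using h.mono_left nhdsWithin_le_nhds

/-- The equation `lam U - L U = F` on the two half-lines, solved for the second derivatives. -/
structure ResolventEq (Θi Le : ℝ) (lam : ℂ) (U V Z F : W Le) : Prop where
  fst_neg : ∀ ξ < 0, Z.fst ξ =
    lam * U.fst ξ - V.fst ξ - coeffA Θi Le * U.snd ξ - F.fst ξ
  fst_pos : ∀ ξ > 0, Z.fst ξ = lam * U.fst ξ - V.fst ξ - F.fst ξ
  snd_neg : ∀ ξ < 0, Z.snd ξ =
    Le * (lam * U.snd ξ - V.snd ξ + coeffA Θi Le * U.snd ξ - F.snd ξ)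
  snd_pos : ∀ ξ > 0, Z.snd ξ = Le * (lam * U.snd ξ - V.snd ξ - F.snd ξ)

theorem sub_formalL_fst (lam : ℂ) (U V Z : W Le) (ξ : ℝ) :
    (lam • U - formalL Θi Le U V Z).fst ξ = lam * U.fst ξ - (Z.fst ξ + V.fst ξ +
      coeffA Θi Le * if ξ < 0 then U.snd ξ else 0) := rfl

theorem sub_formalL_snd (lam : ℂ) (U V Z : W Le) (ξ : ℝ) :
    (lam • U - formalL Θi Le U V Z).snd ξ = lam * U.snd ξ - ((Le : ℂ)⁻¹ * Z.snd ξ + V.snd ξ -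
      coeffA Θi Le * if ξ < 0 then U.snd ξ else 0) := rfl

theorem resolventEq_iff (hLe : 1 < Le) {lam : ℂ} {U V Z F : W Le} :
    ResolventEq Θi Le lam U V Z F ↔ lam • U - formalL Θi Le U V Z = F := by
  have hL : (Le : ℂ) ≠ 0 := by exact_mod_cast (by linarith : Le ≠ 0)
  constructor
  · intro h
    have h1 : (lam • U - formalL Θi Le U V Z).fst = F.fst := by
      refine Weighted.ext_ne fun ξ hξ => ?_
      rw [sub_formalL_fst]
      rcases lt_or_gt_of_ne hξ with hξ | hξ
      · rw [if_pos hξ, h.fst_neg ξ hξ]; ring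
      · rw [if_neg (not_lt.2 hξ.le), h.fst_pos ξ hξ]; ring
    have h2 : (lam • U - formalL Θi Le U V Z).snd = F.snd := by
      refine Weighted.ext_ne fun ξ hξ => ?_
      rw [sub_formalL_snd]
      rcases lt_or_gt_of_ne hξ with hξ | hξ
      · rw [if_pos hξ, h.snd_neg ξ hξ, inv_mul_cancel_left₀ hL]; ring
      · rw [if_neg (not_lt.2 hξ.le), h.snd_pos ξ hξ, inv_mul_cancel_left₀ hL]; ring
    exact WithLp.ofLp_injective 1 (Prod.ext h1 h2)
  · rintro rfl
    refine ⟨fun ξ hξ => ?_, fun ξ hξ => ?_, fun ξ hξ => ?_, fun ξ hξ => ?_⟩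
    · rw [sub_formalL_fst, if_pos hξ]; ring
    · rw [sub_formalL_fst, if_neg (not_lt.2 (le_of_lt hξ))]; ring
    · rw [sub_formalL_snd, if_pos hξ]; field_simp; ring
    · rw [sub_formalL_snd, if_neg (not_lt.2 (le_of_lt hξ))]; field_simp; ring

/-- Lower bounds for the decay rates of the exponentials at `lam`. -/
structure RateBound (Θi Le : ℝ) (lam : ℂ) (e : ℝ) : Prop where
  pos : 0 < e
  h1 : 2 * e ≤ (H1 lam).re
  h2 : 2 * e + (Le - 1) ≤ (H2 Θi Le lam).re
  h3 : 2 * e ≤ (H3 Le lam).re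

theorem div_le_div_of_le_den {N d e : ℝ} (hN : 0 ≤ N) (he : 0 < e) (h : e ≤ d) : N / d ≤ N / e := by
  gcongr

namespace RateBound

variable {lam : ℂ} {e : ℝ} (he : RateBound Θi Le lam e)

include he

theorem le_k1 : e ≤ (k1 lam).re + 1 / 2 := by rw [k1_re]; linarith [he.h1]

theorem le_k2 : e ≤ -((k2 lam).re + 1 / 2) := by rw [k2_re]; linarith [he.h1]

theorem le_k3 : e ≤ (k3 Θi Le lam).re + 1 / 2 := by rw [k3_re]; linarith [he.h2]

theorem le_k4 (hLe : 1 < Le) : e ≤ -((k4 Θi Le lam).re + 1 / 2) := by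
  rw [k4_re]; linarith [he.h2]

theorem le_k5 : e ≤ (k5 Le lam).re + Le / 2 := by rw [k5_re]; linarith [he.h3]

theorem le_k6 : e ≤ -((k6 Le lam).re + Le / 2) := by rw [k6_re]; linarith [he.h3]

theorem le_norm_k3_sub_k2 : 2 * e ≤ ‖k3 Θi Le lam - k2 lam‖ := by
  refine le_trans ?_ (Complex.re_le_norm _)
  rw [Complex.sub_re]
  linarith [he.le_k3, he.le_k2]

theorem k3_sub_k2_ne : k3 Θi Le lam - k2 lam ≠ 0 := by
  rw [← norm_pos_iff]
  linarith [he.le_norm_k3_sub_k2, he.pos]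

theorem le_norm_k6_sub_k3 (hLe : 1 < Le) : 2 * e ≤ ‖k6 Le lam - k3 Θi Le lam‖ := by
  rw [norm_sub_rev]
  refine le_trans ?_ (Complex.re_le_norm _)
  rw [Complex.sub_re]
  linarith [he.le_k3, he.le_k6]

theorem k6_sub_k3_ne (hLe : 1 < Le) : k6 Le lam - k3 Θi Le lam ≠ 0 := by
  rw [← norm_pos_iff]
  linarith [he.le_norm_k6_sub_k3 hLe, he.pos]

end RateBound

/-- A priori estimates for the resolvent equation in terms of the values at the interface. -/
theorem apriori (hΘ0 : 0 < Θi) (hΘ1 : Θi < 1) (hLe : 1 < Le) {lam : ℂ} {e : ℝ}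
    (he : RateBound Θi Le lam e) {U V Z F : W Le} (h : IsDomainTriple Θi Le U V Z)
    (hE : ResolventEq Θi Le lam U V Z F) :
    ‖U.fst 0 * (1 / (1 - Θi) - H1 lam) +
      coeffA Θi Le * U.snd 0 / (k3 Θi Le lam - k2 lam)‖ ≤
        (2 + coeffA Θi Le * Le / e ^ 2) / e * ‖F‖ ∧
    ‖U.snd 0 * (k6 Le lam - k3 Θi Le lam) - Le * U.fst 0 / (1 - Θi)‖ ≤ 2 * Le / e * ‖F‖ ∧
    ‖U‖ ≤ 2 * ‖U.fst 0‖ + (2 + coeffA Θi Le / (2 * e ^ 2)) * ‖U.snd 0‖ +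
      (2 + coeffA Θi Le * Le / e ^ 2 + 2 * Le) / e ^ 2 * ‖F‖ := by
  have hA := coeffA_pos hΘ0 hΘ1 hLe
  have hL0 : 0 < Le := by linarith
  have hpos := he.pos
  have hs := he.k3_sub_k2_ne
  set N := ‖F‖ with hN
  have hN0 : 0 ≤ N := norm_nonneg F
  set a := U.fst 0 with ha
  set b := U.snd 0 with hb
  set A := coeffA Θi Le with hAdef
  have hnA : ‖(A : ℂ)‖ = A := by rw [Complex.norm_real, Real.norm_of_nonneg hA.le]
  have hnL : ‖(Le : ℂ)‖ = Le := by rw [Complex.norm_real, Real.norm_of_nonneg hL0.le]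
  have hua : Tendsto U.fst (𝓝[<] 0) (𝓝 a) := by
    have h1 := h.jump_fst
    rw [Weighted.jump_eq, sub_eq_zero] at h1
    rw [ha, h1]
    exact U.fst.tendsto_neg
  have hvb : Tendsto U.snd (𝓝[<] 0) (𝓝 b) := by
    have h1 := h.jump_snd
    rw [Weighted.jump_eq, sub_eq_zero] at h1
    rw [hb, h1]
    exact U.snd.tendsto_neg
  -- right half-line, first component
  let w₁ := V.fst + (-k2 lam) • U.fst
  have hw₁ : Weighted.HasDeriv w₁ (Z.fst + (-k2 lam) • V.fst) :=
    h.deriv2_fst.add (h.deriv_fst.smul _)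
  have e₁ : ∀ ξ, w₁ ξ = V.fst ξ + -k2 lam * U.fst ξ := fun ξ => rfl
  -- The factor w₁ = u' - k2 u satisfies w₁' = k1 w₁ - f with a growing exponent, so it is bounded
  -- by F alone. Then u' = k2 u + w₁ with a decaying exponent brings in the value a. The other
  -- components follow the same scheme.
  have b₁ : ∀ ξ > 0, Real.exp (1 / 2 * ξ) * ‖w₁ ξ‖ ≤ N / e := fun ξ hξ => by
    refine (right_growing_bound (a := k1 lam) (f := fun ξ => -F.fst ξ) (F := N)
      (hpos.trans_le he.le_k1) (fun x hx => ?_) (fun x hx => w₁.le_norm_pos hx)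
      (fun x hx => by simpa only [norm_neg] using W_bound_fst_pos F hx) hξ).trans
      (div_le_div_of_le_den hN0 hpos he.le_k1)
    refine (hw₁ x (ne_of_gt hx)).congr_deriv ?_
    rw [Weighted.add_apply, Weighted.smul_apply, hE.fst_pos x hx, e₁]
    linear_combination (-V.fst x) * k1_add_k2 lam + U.fst x * k1_mul_k2 lam
  have u₁ : ∀ ξ > 0, Real.exp (1 / 2 * ξ) * ‖U.fst ξ‖ ≤ ‖a‖ + N / e / e := fun ξ hξ => by
    refine (right_decaying_bound (a := k2 lam) (f := w₁) (F := N / e) (y₀ := a)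
      (by linarith [he.le_k2]) (fun x hx => ?_) U.fst.tendsto_pos b₁ hξ).trans
      (by gcongr; exact he.le_k2)
    refine (h.deriv_fst x (ne_of_gt hx)).congr_deriv ?_
    rw [e₁]
    ring
  -- right half-line, second component
  let w₂ := V.snd + (-k6 Le lam) • U.snd
  have hw₂ : Weighted.HasDeriv w₂ (Z.snd + (-k6 Le lam) • V.snd) :=
    h.deriv2_snd.add (h.deriv_snd.smul _)
  have e₂ : ∀ ξ, w₂ ξ = V.snd ξ + -k6 Le lam * U.snd ξ := fun ξ => rfl
  have b₂ : ∀ ξ > 0, Real.exp (Le / 2 * ξ) * ‖w₂ ξ‖ ≤ Le * N / e := fun ξ hξ => by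
    refine (right_growing_bound (a := k5 Le lam) (f := fun ξ => -(Le * F.snd ξ)) (F := Le * N)
      (hpos.trans_le he.le_k5) (fun x hx => ?_) (fun x hx => w₂.le_norm_pos hx)
      (fun x hx => ?_) hξ).trans
      (div_le_div_of_le_den (by positivity) hpos he.le_k5)
    · refine (hw₂ x (ne_of_gt hx)).congr_deriv ?_
      rw [Weighted.add_apply, Weighted.smul_apply, hE.snd_pos x hx, e₂]
      linear_combination (-V.snd x) * k5_add_k6 Le lam + U.snd x * k5_mul_k6 Le lam
    · rw [norm_neg, norm_mul, hnL, mul_left_comm]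
      exact mul_le_mul_of_nonneg_left (W_bound_snd_pos F hx) hL0.le
  have u₂ : ∀ ξ > 0, Real.exp (Le / 2 * ξ) * ‖U.snd ξ‖ ≤ ‖b‖ + Le * N / e / e := fun ξ hξ => by
    refine (right_decaying_bound (a := k6 Le lam) (f := w₂) (F := Le * N / e) (y₀ := b)
      (by linarith [he.le_k6]) (fun x hx => ?_) U.snd.tendsto_pos b₂ hξ).trans
      (by gcongr; exact he.le_k6)
    refine (h.deriv_snd x (ne_of_gt hx)).congr_deriv ?_
    rw [e₂]
    ring
  -- left half-line, second component
  let w₃ := V.snd + (-k3 Θi Le lam) • U.snd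
  have hw₃ : Weighted.HasDeriv w₃ (Z.snd + (-k3 Θi Le lam) • V.snd) :=
    h.deriv2_snd.add (h.deriv_snd.smul _)
  have e₃ : ∀ ξ, w₃ ξ = V.snd ξ + -k3 Θi Le lam * U.snd ξ := fun ξ => rfl
  have b₃ : ∀ ξ < 0, Real.exp (1 / 2 * ξ) * ‖w₃ ξ‖ ≤ Le * N / e := fun ξ hξ => by
    refine (left_growing_bound (a := k4 Θi Le lam) (f := fun ξ => -(Le * F.snd ξ)) (F := Le * N)
      (by linarith [he.le_k4 hLe]) (fun x hx => ?_) (fun x hx => w₃.le_norm_neg hx)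
      (fun x hx => ?_) hξ).trans
      (div_le_div_of_le_den (by positivity) hpos (he.le_k4 hLe))
    · refine (hw₃ x (ne_of_lt hx)).congr_deriv ?_
      rw [Weighted.add_apply, Weighted.smul_apply, hE.snd_neg x hx, e₃]
      linear_combination (-V.snd x) * k3_add_k4 Θi Le lam + U.snd x * k3_mul_k4 Θi Le lam
    · rw [norm_neg, norm_mul, hnL, mul_left_comm]
      exact mul_le_mul_of_nonneg_left (W_bound_snd_neg F hx) hL0.le
  -- The part of v with zero value at the interface, bounded by F alone; v is the source in the
  -- equation for u, so its b-dependence has to be tracked exactly.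
  let vp : ℝ → ℂ := fun ξ => U.snd ξ - b * Complex.exp (k3 Θi Le lam * ξ)
  have u₃ : ∀ ξ < 0, Real.exp (1 / 2 * ξ) * ‖vp ξ‖ ≤ Le * N / e / e := fun ξ hξ => by
    have h0 : Tendsto vp (𝓝[<] 0) (𝓝 0) := by
      simpa using hvb.sub (tendsto_cexp_left (k3 Θi Le lam) b)
    refine (left_decaying_bound (a := k3 Θi Le lam) (f := w₃) (F := Le * N / e)
      (by linarith [he.le_k3]) (fun x hx => ?_) h0 b₃ hξ).trans
      (by rw [norm_zero, zero_add]; gcongr; exact he.le_k3)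
    refine ((h.deriv_snd x (ne_of_lt hx)).sub
      ((hasDerivAt_cexp_mul_ofReal (k3 Θi Le lam) x).const_mul b)).congr_deriv ?_
    simp only [vp]
    rw [e₃]
    ring
  have u₃' : ∀ ξ < 0, Real.exp (1 / 2 * ξ) * ‖U.snd ξ‖ ≤ ‖b‖ + Le * N / e / e := fun ξ hξ => by
    refine (left_decaying_bound (a := k3 Θi Le lam) (f := w₃) (F := Le * N / e) (y₀ := b)
      (by linarith [he.le_k3]) (fun x hx => ?_) hvb b₃ hξ).trans
      (by gcongr; exact he.le_k3)
    refine (h.deriv_snd x (ne_of_lt hx)).congr_deriv ?_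
    rw [e₃]
    ring
  -- left half-line, first component
  let w₄ := V.fst + (-k1 lam) • U.fst
  have hw₄ : Weighted.HasDeriv w₄ (Z.fst + (-k1 lam) • V.fst) :=
    h.deriv2_fst.add (h.deriv_fst.smul _)
  have e₄ : ∀ ξ, w₄ ξ = V.fst ξ + -k1 lam * U.fst ξ := fun ξ => rfl
  -- Chosen so that adding c e^{k3 ξ} to w₄ cancels the source -A b e^{k3 ξ} in w₄' = k2 w₄ - f - A
  -- v. The corrected function w' is then bounded by F alone.
  set c := A * b / (k3 Θi Le lam - k2 lam) with hc
  have hcs : c * (k3 Θi Le lam - k2 lam) = A * b := div_mul_cancel₀ _ hs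
  let w' : ℝ → ℂ := fun ξ => w₄ ξ + c * Complex.exp (k3 Θi Le lam * ξ)
  have hnc : ‖c‖ ≤ A * ‖b‖ / (2 * e) := by
    rw [hc, norm_div, norm_mul, hnA]
    gcongr
    exact he.le_norm_k3_sub_k2
  have hexp : ∀ ξ < (0 : ℝ), Real.exp (1 / 2 * ξ) * ‖c * Complex.exp (k3 Θi Le lam * ξ)‖ ≤ ‖c‖ := by
    intro ξ hξ
    rw [norm_mul, norm_cexp_mul_ofReal, mul_left_comm, ← Real.exp_add]
    refine mul_le_of_le_one_right (norm_nonneg _) (Real.exp_le_one_iff.2 ?_)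
    nlinarith [he.le_k3]
  have b₄ : ∀ ξ < 0, Real.exp (1 / 2 * ξ) * ‖w' ξ‖ ≤ (N + A * (Le * N / e / e)) / e := fun ξ hξ => by
    refine (left_growing_bound (a := k2 lam) (f := fun ξ => -F.fst ξ - A * vp ξ)
      (F := N + A * (Le * N / e / e)) (Y := ‖w₄‖ + ‖c‖)
      (by linarith [he.le_k2]) (fun x hx => ?_) (fun x hx => ?_)
      (fun x hx => ?_) hξ).trans
      (div_le_div_of_le_den (by positivity) hpos he.le_k2)
    · refine ((hw₄ x (ne_of_lt hx)).add
        ((hasDerivAt_cexp_mul_ofReal (k3 Θi Le lam) x).const_mul c)).congr_deriv ?_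
      simp only [w', vp]
      rw [Weighted.add_apply, Weighted.smul_apply, hE.fst_neg x hx, e₄]
      linear_combination (-V.fst x) * k1_add_k2 lam + U.fst x * k1_mul_k2 lam +
        Complex.exp (k3 Θi Le lam * x) * hcs
    · have := mul_le_mul_of_nonneg_left
        (norm_add_le (w₄ x) (c * Complex.exp (k3 Θi Le lam * x))) (Real.exp_pos (1 / 2 * x)).le
      linarith [w₄.le_norm_neg hx, hexp x hx]
    · have h1 := mul_le_mul_of_nonneg_left
        (norm_sub_le (-F.fst x) (A * vp x)) (Real.exp_pos (1 / 2 * x)).le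
      rw [norm_neg, norm_mul, hnA, mul_add, mul_left_comm _ A] at h1
      have h2 := mul_le_mul_of_nonneg_left (u₃ x hx) hA.le
      linarith [W_bound_fst_neg F hx]
  have u₄ : ∀ ξ < 0, Real.exp (1 / 2 * ξ) * ‖U.fst ξ‖ ≤
      ‖a‖ + ((N + A * (Le * N / e / e)) / e + ‖c‖) / e := fun ξ hξ => by
    refine (left_decaying_bound (a := k1 lam) (f := w₄)
      (F := (N + A * (Le * N / e / e)) / e + ‖c‖) (y₀ := a)
      (by linarith [he.le_k1]) (fun x hx => ?_) hua (fun x hx => ?_) hξ).trans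
      (by gcongr; exact he.le_k1)
    · refine (h.deriv_fst x (ne_of_lt hx)).congr_deriv ?_
      rw [e₄]
      ring
    · have h1 : w₄ x = w' x - c * Complex.exp (k3 Θi Le lam * x) := by simp [w']
      rw [h1]
      have h2 := mul_le_mul_of_nonneg_left
        (norm_sub_le (w' x) (c * Complex.exp (k3 Θi Le lam * x))) (Real.exp_pos (1 / 2 * x)).le
      linarith [b₄ x hx, hexp x hx]
  -- interface conditions
  have ht₄ : Tendsto w' (𝓝[<] 0) (𝓝 (Function.leftLim V.fst 0 - k1 lam * a + c)) := by
    have h1 := (V.fst.tendsto_neg.add (hua.const_mul (-k1 lam))).add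
      (tendsto_cexp_left (k3 Θi Le lam) c)
    rw [neg_mul, ← sub_eq_add_neg] at h1
    exact h1
  have ht₃ : Tendsto w₃ (𝓝[<] 0) (𝓝 (Function.leftLim V.snd 0 - k3 Θi Le lam * b)) := by
    have h1 := V.snd.tendsto_neg.add (hvb.const_mul (-k3 Θi Le lam))
    rw [neg_mul, ← sub_eq_add_neg] at h1
    exact h1
  have n₁ := w₁.norm_zero_le b₁
  have n₂ := w₂.norm_zero_le b₂
  have n₃ := norm_le_of_tendsto_left ht₃ b₃
  have n₄ := norm_le_of_tendsto_left ht₄ b₄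
  have j₁ := h.jump_deriv_fst
  have j₂ := h.jump_deriv_snd
  rw [Weighted.jump_eq] at j₁ j₂
  have hH : H1 lam = k1 lam - k2 lam := by simp only [k1, k2]; ring
  -- Expressing the one-sided traces of u' and v' through w', w₁, w₃, w₂ turns the jump conditions
  -- into two linear equations for (a, b), whose right-hand sides are differences of traces already
  -- bounded by F.
  refine ⟨?_, ?_, ?_⟩
  · have h1 : a * (1 / (1 - Θi) - H1 lam) + c =
        (Function.leftLim V.fst 0 - k1 lam * a + c) - w₁ 0 := by
      rw [e₁, hH]
      linear_combination j₁
    rw [h1]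
    refine (norm_sub_le _ _).trans ((add_le_add n₄ n₁).trans (le_of_eq ?_))
    field_simp
    ring
  · have h1 : b * (k6 Le lam - k3 Θi Le lam) - Le * a / (1 - Θi) =
        (Function.leftLim V.snd 0 - k3 Θi Le lam * b) - w₂ 0 := by
      rw [e₂]
      linear_combination j₂
    rw [h1]
    refine (norm_sub_le _ _).trans ((add_le_add n₃ n₂).trans (le_of_eq ?_))
    ring
  · have h1 := U.fst.norm_le_of_bounds u₄ u₁
    have h2 := U.snd.norm_le_of_bounds u₃' u₂
    have h3 : ‖U‖ = ‖U.fst‖ + ‖U.snd‖ := WithLp.prod_norm_eq_of_L1 U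
    have h4 : ‖c‖ / e ≤ A * ‖b‖ / (2 * e) / e := by gcongr
    have h5 : A * ‖b‖ / (2 * e) / e = A / (2 * e ^ 2) * ‖b‖ := by field_simp
    have h6 : (2 + A * Le / e ^ 2 + 2 * Le) / e ^ 2 * N =
        ((N + A * (Le * N / e / e)) / e) / e + N / e / e + 2 * (Le * N / e / e) := by
      field_simp
      ring
    rw [h5] at h4
    rw [add_div] at h1
    rw [h3, h6]
    linarith

end ResolventEquation

/-! ### Construction of solutions with prescribed interface values. -/

section ResolventEquation

variable {Θi Le : ℝ}

/-- Solutions of the first-order equations for the auxiliary functions, with right-hand side `F`: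
`w₁`, `w₂` on the right half-line, `w₃`, `w₄` and the particular solution `vp` on the left one. -/
structure AuxSolution (Θi Le : ℝ) (lam : ℂ) (F : W Le) (w₁ w₂ w₃ w₄ vp : ℝ → ℂ) : Prop where
  right_w₁ : IsRight (1 / 2) w₁
  right_w₂ : IsRight (Le / 2) w₂
  left_w₃ : IsLeft (1 / 2) w₃
  left_w₄ : IsLeft (1 / 2) w₄
  left_vp : IsLeft (1 / 2) vp
  vp_zero : vp 0 = 0
  deriv_w₁ : ∀ ξ > 0, HasDerivAt w₁ (k1 lam * w₁ ξ + -1 * F.fst ξ) ξ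
  deriv_w₂ : ∀ ξ > 0, HasDerivAt w₂ (k5 Le lam * w₂ ξ + -Le * F.snd ξ) ξ
  deriv_w₃ : ∀ ξ < 0, HasDerivAt w₃ (k4 Θi Le lam * w₃ ξ + -Le * F.snd.leftExt ξ) ξ
  deriv_vp : ∀ ξ < 0, HasDerivAt vp (k3 Θi Le lam * vp ξ + w₃ ξ) ξ
  deriv_w₄ : ∀ ξ < 0, HasDerivAt w₄
    (k2 lam * w₄ ξ + (-1 * F.fst.leftExt ξ + -coeffA Θi Le * vp ξ)) ξ

/-- The system is triangular: v feeds into u only on the left and not conversely. So w₃ comes before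
vp, and vp before w₄. -/
theorem exists_auxSolution (hLe : 1 < Le) {lam : ℂ} {e : ℝ} (he : RateBound Θi Le lam e)
    (F : W Le) : ∃ w₁ w₂ w₃ w₄ vp : ℝ → ℂ, AuxSolution Θi Le lam F w₁ w₂ w₃ w₄ vp := by
  have hpos := he.pos
  obtain ⟨w₁, r₁, d₁⟩ := exists_right_growing (a := k1 lam) (β := 1 / 2)
    (by linarith [he.le_k1]) (F.fst.isRight.const_mul (-1))
  obtain ⟨w₂, r₂, d₂⟩ := exists_right_growing (a := k5 Le lam) (β := Le / 2)
    (by linarith [he.le_k5]) (F.snd.isRight.const_mul (-Le))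
  obtain ⟨w₃, l₃, d₃⟩ := exists_left_growing (a := k4 Θi Le lam) (α := 1 / 2)
    (by linarith [he.le_k4 hLe]) (F.snd.isLeft.const_mul (-Le))
  obtain ⟨vp, lv, v0, dv⟩ := exists_left_decaying (a := k3 Θi Le lam) (α := 1 / 2)
    (by linarith [he.le_k3]) l₃ 0
  obtain ⟨w₄, l₄, d₄⟩ := exists_left_growing (a := k2 lam) (α := 1 / 2)
    (by linarith [he.le_k2]) ((F.fst.isLeft.const_mul (-1)).add (lv.const_mul (-coeffA Θi Le)))
  exact ⟨w₁, w₂, w₃, w₄, vp, r₁, r₂, l₃, l₄, lv, v0, d₁, d₂, d₃, dv, d₄⟩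

/-- With zero data, `AuxSolution.exists_triple` becomes a construction of eigenfunctions from null
vectors of the interface system. -/
theorem auxSolution_zero (Θi Le : ℝ) (lam : ℂ) :
    AuxSolution Θi Le lam 0 (fun _ => 0) (fun _ => 0) (fun _ => 0) (fun _ => 0) (fun _ => 0) := by
  have hr : ∀ β : ℝ, IsRight β fun _ => 0 := fun β => ⟨continuousOn_const, 0, by simp⟩
  have hl : ∀ β : ℝ, IsLeft β fun _ => 0 := fun β => ⟨continuousOn_const, 0, by simp⟩
  have h1 : ∀ ξ, (0 : W Le).fst ξ = 0 := fun ξ => rfl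
  have h2 : ∀ ξ, (0 : W Le).snd ξ = 0 := fun ξ => rfl
  have hd : ∀ ξ c, c = 0 → HasDerivAt (fun _ : ℝ => (0 : ℂ)) c ξ := fun ξ c hc => by
    rw [hc]; exact hasDerivAt_const ξ 0
  refine ⟨hr _, hr _, hl _, hl _, hl _, rfl, fun ξ _ => hd _ _ ?_, fun ξ _ => hd _ _ ?_,
    fun ξ hξ => hd _ _ ?_, fun ξ _ => hd _ _ ?_, fun ξ hξ => hd _ _ ?_⟩
  · rw [h1]; ring
  · rw [h2]; ring
  · rw [Weighted.leftExt_of_neg _ hξ, h2]; ring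
  · ring
  · rw [Weighted.leftExt_of_neg _ hξ, h1]; ring

/-- The solution of the resolvent equation with given values at the interface. -/
theorem AuxSolution.exists_triple {lam : ℂ} {e : ℝ} (he : RateBound Θi Le lam e)
    {F : W Le} {w₁ w₂ w₃ w₄ vp : ℝ → ℂ} (h : AuxSolution Θi Le lam F w₁ w₂ w₃ w₄ vp) {a b : ℂ}
    (hp : a * (1 / (1 - Θi) - H1 lam) + coeffA Θi Le * b / (k3 Θi Le lam - k2 lam) = w₄ 0 - w₁ 0)
    (hq : b * (k6 Le lam - k3 Θi Le lam) - Le * a / (1 - Θi) = w₃ 0 - w₂ 0) :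
    ∃ U V Z : W Le, IsDomainTriple Θi Le U V Z ∧ ResolventEq Θi Le lam U V Z F ∧
      U.fst 0 = a ∧ U.snd 0 = b := by
  have hpos := he.pos
  have hs := he.k3_sub_k2_ne
  set A : ℂ := (coeffA Θi Le : ℂ) with hA
  set K1 := k1 lam with hK1
  set K2 := k2 lam with hK2
  set K3 := k3 Θi Le lam with hK3
  set K4 := k4 Θi Le lam with hK4
  set K5 := k5 Le lam with hK5
  set K6 := k6 Le lam with hK6
  set c := A * b / (K3 - K2) with hc
  have hcs : c * (K3 - K2) = A * b := div_mul_cancel₀ _ hs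
  have hexp : IsLeft (1 / 2) fun ξ => Complex.exp (K3 * ξ) :=
    isLeft_cexp (by linarith [he.le_k3])
  -- right half-line
  obtain ⟨u, ur, u0, ud⟩ := exists_right_decaying (a := K2) (β := 1 / 2)
    (by linarith [he.le_k2]) h.right_w₁ a
  obtain ⟨v, vr, v0, vd⟩ := exists_right_decaying (a := K6) (β := Le / 2)
    (by linarith [he.le_k6]) h.right_w₂ b
  -- First and second derivatives are read off from the first-order equations, so their weighted
  -- bounds follow from those of the functions already built.
  have ur' := (ur.const_mul K2).add h.right_w₁
  have vr' := (vr.const_mul K6).add h.right_w₂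
  have ur'' := (ur'.const_mul K2).add ((h.right_w₁.const_mul K1).add (F.fst.isRight.const_mul (-1)))
  have vr'' := (vr'.const_mul K6).add ((h.right_w₂.const_mul K5).add
    (F.snd.isRight.const_mul (-Le)))
  -- left half-line
  have vl := h.left_vp.add (hexp.const_mul b)
  have vl' := (vl.const_mul K3).add h.left_w₃
  have vl'' := (vl'.const_mul K3).add ((h.left_w₃.const_mul K4).add
    (F.snd.isLeft.const_mul (-Le)))
  -- The term -c e^{k3 ξ} is the response to the part b e^{k3 ξ} of v, so this is the full
  -- first-order quantity u' - k1 u on the left.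
  have wl := h.left_w₄.add (hexp.const_mul (-c))
  obtain ⟨y, yl, y0, yd⟩ := exists_left_decaying (a := K1) (α := 1 / 2)
    (by linarith [he.le_k1]) wl a
  have yl' := (yl.const_mul K1).add wl
  have yl'' := (yl'.const_mul K1).add ((wl.const_mul K2).add ((F.fst.isLeft.const_mul (-1)).add
    (vl.const_mul (-A))))
  let U : W Le := WithLp.toLp 1 (Weighted.glue yl ur, Weighted.glue vl vr)
  let V : W Le := WithLp.toLp 1 (Weighted.glue yl' ur', Weighted.glue vl' vr')
  let Z : W Le := WithLp.toLp 1 (Weighted.glue yl'' ur'', Weighted.glue vl'' vr'')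
  have hvd : ∀ ξ < 0, HasDerivAt (fun ξ : ℝ => vp ξ + b * Complex.exp (K3 * ξ))
      (K3 * (vp ξ + b * Complex.exp (K3 * ξ)) + w₃ ξ) ξ := fun ξ hξ => by
    refine ((h.deriv_vp ξ hξ).add
      ((hasDerivAt_cexp_mul_ofReal K3 ξ).const_mul b)).congr_deriv ?_
    ring
  have hwd : ∀ ξ < 0, HasDerivAt (fun ξ : ℝ => w₄ ξ + -c * Complex.exp (K3 * ξ))
      (K2 * (w₄ ξ + -c * Complex.exp (K3 * ξ)) + (-1 * F.fst.leftExt ξ +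
        -A * (vp ξ + b * Complex.exp (K3 * ξ)))) ξ := fun ξ hξ => by
    refine ((h.deriv_w₄ ξ hξ).add
      ((hasDerivAt_cexp_mul_ofReal K3 ξ).const_mul (-c))).congr_deriv ?_
    linear_combination -Complex.exp (K3 * ξ) * hcs
  have hH : H1 lam = K1 - K2 := by simp only [hK1, hK2, k1, k2]; ring
  refine ⟨U, V, Z, ⟨?_, ?_, ?_, ?_, ?_, ?_, ?_, ?_⟩, ⟨?_, ?_, ?_, ?_⟩, ?_, ?_⟩
  · exact Weighted.hasDeriv_glue yl ur yl' ur' yd ud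
  · exact Weighted.hasDeriv_glue vl vr vl' vr' hvd vd
  · exact Weighted.hasDeriv_glue yl' ur' yl'' ur''
      (fun ξ hξ => ((yd ξ hξ).const_mul K1).add (hwd ξ hξ))
      (fun ξ hξ => ((ud ξ hξ).const_mul K2).add (h.deriv_w₁ ξ hξ))
  · exact Weighted.hasDeriv_glue vl' vr' vl'' vr''
      (fun ξ hξ => ((hvd ξ hξ).const_mul K3).add (h.deriv_w₃ ξ hξ))
      (fun ξ hξ => ((vd ξ hξ).const_mul K6).add (h.deriv_w₂ ξ hξ))
  · refine (Weighted.jump_glue yl ur).trans ?_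
    rw [u0, y0, sub_self]
  · refine (Weighted.jump_glue vl vr).trans ?_
    rw [v0, h.vp_zero]
    simp
  · refine (Weighted.jump_glue yl' ur').trans ?_
    have hU : U.fst 0 = a := (Weighted.glue_of_nonneg yl ur le_rfl).trans u0
    rw [hU, u0, y0]
    simp only [Complex.ofReal_zero, mul_zero, Complex.exp_zero, mul_one]
    rw [hH] at hp
    linear_combination hp
  · refine (Weighted.jump_glue vl' vr').trans ?_
    have hU : U.fst 0 = a := (Weighted.glue_of_nonneg yl ur le_rfl).trans u0
    rw [hU, v0, h.vp_zero]
    simp only [Complex.ofReal_zero, mul_zero, Complex.exp_zero, mul_one, zero_add]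
    linear_combination hq
  · intro ξ hξ
    have e1 : Z.fst ξ = _ := Weighted.glue_of_neg yl'' ur'' hξ
    have e2 : V.fst ξ = _ := Weighted.glue_of_neg yl' ur' hξ
    have e3 : U.fst ξ = _ := Weighted.glue_of_neg yl ur hξ
    have e4 : U.snd ξ = _ := Weighted.glue_of_neg vl vr hξ
    rw [e1, e2, e3, e4, Weighted.leftExt_of_neg _ hξ]
    have hsum : K1 + K2 = -1 := k1_add_k2 lam
    have hprod : K1 * K2 = -lam := k1_mul_k2 lam
    linear_combination (K1 * y ξ + (w₄ ξ + -c * Complex.exp (K3 * ξ))) * hsum - y ξ * hprod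
  · intro ξ hξ
    have e1 : Z.fst ξ = _ := Weighted.glue_of_nonneg yl'' ur'' (le_of_lt hξ)
    have e2 : V.fst ξ = _ := Weighted.glue_of_nonneg yl' ur' (le_of_lt hξ)
    have e3 : U.fst ξ = _ := Weighted.glue_of_nonneg yl ur (le_of_lt hξ)
    rw [e1, e2, e3]
    have hsum : K1 + K2 = -1 := k1_add_k2 lam
    have hprod : K1 * K2 = -lam := k1_mul_k2 lam
    linear_combination (K2 * u ξ + w₁ ξ) * hsum - u ξ * hprod
  · intro ξ hξ
    have e1 : Z.snd ξ = _ := Weighted.glue_of_neg vl'' vr'' hξ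
    have e2 : V.snd ξ = _ := Weighted.glue_of_neg vl' vr' hξ
    have e4 : U.snd ξ = _ := Weighted.glue_of_neg vl vr hξ
    rw [e1, e2, e4, Weighted.leftExt_of_neg _ hξ]
    have hsum : K3 + K4 = -Le := k3_add_k4 Θi Le lam
    have hprod : K3 * K4 = -(Le * (A + lam)) := k3_mul_k4 Θi Le lam
    linear_combination (K3 * (vp ξ + b * Complex.exp (K3 * ξ)) + w₃ ξ) * hsum -
      (vp ξ + b * Complex.exp (K3 * ξ)) * hprod
  · intro ξ hξ
    have e1 : Z.snd ξ = _ := Weighted.glue_of_nonneg vl'' vr'' (le_of_lt hξ)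
    have e2 : V.snd ξ = _ := Weighted.glue_of_nonneg vl' vr' (le_of_lt hξ)
    have e4 : U.snd ξ = _ := Weighted.glue_of_nonneg vl vr (le_of_lt hξ)
    rw [e1, e2, e4]
    have hsum : K5 + K6 = -Le := k5_add_k6 Le lam
    have hprod : K5 * K6 = -(Le * lam) := k5_mul_k6 Le lam
    linear_combination (K6 * v ξ + w₂ ξ) * hsum - v ξ * hprod
  · exact (Weighted.glue_of_nonneg yl ur le_rfl).trans u0
  · exact (Weighted.glue_of_nonneg vl vr le_rfl).trans v0

end ResolventEquation

/-! ### Resolvent set and eigenvalues off the half-line and 𝒫. -/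

section Resolvent

variable {Θi Le : ℝ}

theorem mem_domain_L {U V Z : W Le} (h : IsDomainTriple Θi Le U V Z) : U ∈ (L Θi Le).domain :=
  ⟨V, Z, h⟩

theorem resolventEq_L (hLe : 1 < Le) (lam : ℂ) (x : (L Θi Le).domain) :
    ∃ V Z : W Le, IsDomainTriple Θi Le (x : W Le) V Z ∧
      ResolventEq Θi Le lam x V Z (lam • (x : W Le) - L Θi Le x) := by
  obtain ⟨V, Z, h⟩ := x.2
  exact ⟨V, Z, h, (resolventEq_iff hLe).2 (by rw [← L_apply h x.2])⟩

theorem ResolventEq.sub_L (hLe : 1 < Le) {lam : ℂ} {U V Z F : W Le}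
    (h : IsDomainTriple Θi Le U V Z) (hE : ResolventEq Θi Le lam U V Z F) :
    lam • U - L Θi Le ⟨U, mem_domain_L h⟩ = F := by
  rw [L_apply h]
  exact (resolventEq_iff hLe).1 hE

theorem one_sub_ne_zero (hΘ1 : Θi < 1) : (1 - Θi : ℂ) ≠ 0 := by
  have : (1 - Θi : ℝ) ≠ 0 := by linarith
  exact_mod_cast this

/-- With r = 1/(1 - Θi), s = k3 - k2, t = k6 - k3, the interface system has rows (r - H1, A/s) and
(-Le r, t). The right-hand side is s times its determinant. -/
theorem dispersion_eq (hΘ1 : Θi < 1) (lam : ℂ) :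
    1 / (1 - Θi) * dispersion Θi Le lam =
      (k6 Le lam - k3 Θi Le lam) * (k3 Θi Le lam - k2 lam) * (1 / (1 - Θi) - H1 lam) +
        coeffA Θi Le * Le * (1 / (1 - Θi)) := by
  have h := one_sub_ne_zero hΘ1
  rw [dispersion, H1]
  field_simp

/-- Away from the zeros of the dispersion relation, the resolvent equation is solvable, and a
priori bounds are bounds for the resolvent. -/
theorem L_resolvent (hΘ1 : Θi < 1) (hLe : 1 < Le) {lam : ℂ} {e : ℝ}
    (he : RateBound Θi Le lam e) (hD : dispersion Θi Le lam ≠ 0) {C : ℝ}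
    (hC : ∀ U V Z F : W Le, IsDomainTriple Θi Le U V Z → ResolventEq Θi Le lam U V Z F →
      ‖U‖ ≤ C * ‖F‖) :
    lam ∈ opResolventSet (L Θi Le) ∧ (0 ≤ C → ‖opResolvent (L Θi Le) lam‖ ≤ C) := by
  refine mem_opResolventSet_of_bound (fun x => ?_) (fun F => ?_)
  · obtain ⟨V, Z, h, hE⟩ := resolventEq_L hLe lam x
    exact hC _ V Z _ h hE
  · obtain ⟨w₁, w₂, w₃, w₄, vp, hw⟩ := exists_auxSolution hLe he F
    have h1 := one_sub_ne_zero hΘ1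
    have hs := he.k3_sub_k2_ne
    have hDe := dispersion_eq (Le := Le) hΘ1 lam
    have hΔ : 1 / (1 - Θi) * dispersion Θi Le lam ≠ 0 := mul_ne_zero (one_div_ne_zero h1) hD
    set Δ := 1 / (1 - Θi) * dispersion Θi Le lam with hΔdef
    set s := k3 Θi Le lam - k2 lam
    set t := k6 Le lam - k3 Θi Le lam
    set r : ℂ := 1 / (1 - Θi) with hr
    set p := w₄ 0 - w₁ 0 with hp
    set q := w₃ 0 - w₂ 0 with hq
    -- The values a and b are given by Cramer's rule; Δ is s times the determinant of the interface
    -- system.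
    obtain ⟨U, V, Z, hT, hE, -, -⟩ := hw.exists_triple he
      (a := (t * s * p - coeffA Θi Le * q) / Δ)
      (b := s * ((r - H1 lam) * q + Le * r * p) / Δ) (by
        rw [← hp, ← hr]
        change _ + _ / s = p
        field_simp
        rw [hDe]
        ring) (by
        rw [← hq, show ∀ x : ℂ, Le * x / (1 - Θi) = Le * x * r by intro x; rw [hr]; ring]
        change _ * t - _ = q
        field_simp
        rw [hDe]
        ring)
    exact ⟨⟨U, mem_domain_L hT⟩, hE.sub_L hLe hT⟩

/-- Resolvent bound on regions where the decay rates are bounded below and the exponents above. -/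
theorem exists_resolvent_bound (hΘ0 : 0 < Θi) (hΘ1 : Θi < 1) (hLe : 1 < Le) {e : ℝ} (h0 : 0 < e)
    {B : ℝ} (hB0 : 0 ≤ B) :
    ∃ C : ℝ, 0 ≤ C ∧ ∀ lam : ℂ, RateBound Θi Le lam e → ‖k3 Θi Le lam - k2 lam‖ ≤ B →
      ‖k6 Le lam - k3 Θi Le lam‖ ≤ B → ‖1 / (1 - Θi) - H1 lam‖ ≤ B →
      dispersion Θi Le lam ≠ 0 → lam ∈ opResolventSet (L Θi Le) ∧
        ‖opResolvent (L Θi Le) lam‖ ≤ C * (1 + 1 / ‖dispersion Θi Le lam‖) := by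
  have hA := coeffA_pos hΘ0 hΘ1 hLe
  have hL0 : 0 < Le := by linarith
  set A := coeffA Θi Le with hAdef
  set R : ℝ := 1 / (1 - Θi) with hR
  have hR1 : 1 ≤ R := by rw [hR, le_div_iff₀ (by linarith)]; linarith
  set P := (2 + A * Le / e ^ 2) / e with hP
  set Q := 2 * Le / e with hQ
  set S := (2 + A * Le / e ^ 2 + 2 * Le) / e ^ 2 with hS
  set G := 2 + A / (2 * e ^ 2) with hG
  have hP0 : 0 < P := by positivity
  have hQ0 : 0 < Q := by positivity
  have hS0 : 0 < S := by positivity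
  have hG0 : 0 < G := by positivity
  -- The Cramer bounds for a and b, inserted into the last estimate of `apriori`.
  set C := 2 * (B * B * P + A * Q) + G * (B * (B * Q + Le * R * P)) + S with hCdef
  have hC0 : 0 ≤ C := by positivity
  refine ⟨C, hC0, fun lam he hs ht hr hD => ?_⟩
  have hDp : 0 < ‖dispersion Θi Le lam‖ := norm_pos_iff.2 hD
  have key := L_resolvent hΘ1 hLe he hD (C := C * (1 + 1 / ‖dispersion Θi Le lam‖)) ?_
  · exact ⟨key.1, key.2 (by positivity)⟩
  intro U V Z F hT hE
  obtain ⟨hp, hq, hU⟩ := apriori hΘ0 hΘ1 hLe he hT hE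
  have hs0 := he.k3_sub_k2_ne
  have hDe := dispersion_eq (Le := Le) hΘ1 lam
  set N := ‖F‖
  have hN : 0 ≤ N := norm_nonneg F
  set a := U.fst 0
  set b := U.snd 0
  set D := dispersion Θi Le lam
  set s := k3 Θi Le lam - k2 lam
  set t := k6 Le lam - k3 Θi Le lam
  have hnr : ‖(1 / (1 - Θi) : ℂ)‖ = R := by
    rw [show (1 / (1 - Θi) : ℂ) = (R : ℂ) by rw [hR]; push_cast; rfl, Complex.norm_real,
      Real.norm_of_nonneg (by linarith)]
  have hnA : ‖(A : ℂ)‖ = A := by rw [Complex.norm_real, Real.norm_of_nonneg hA.le]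
  have hnL : ‖(Le : ℂ)‖ = Le := by rw [Complex.norm_real, Real.norm_of_nonneg hL0.le]
  set r : ℂ := 1 / (1 - Θi) with hrdef
  set p := a * (r - H1 lam) + A * b / s with hpdef
  set q := b * t - Le * a / (1 - Θi) with hqdef
  have hq' : q = b * t - Le * a * r := by rw [hqdef, hrdef]; ring
  have ha : a * (r * D) = t * s * p - A * q := by
    rw [hDe, hpdef, hq']
    field_simp
    ring
  have hb : b * (r * D) = s * ((r - H1 lam) * q + Le * r * p) := by
    rw [hDe, hpdef, hq']
    field_simp
    ring
  -- The factor r can be dropped because |r| = 1/(1 - Θi) ≥ 1.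
  have hD1 : ∀ x : ℂ, ‖x‖ * ‖D‖ ≤ ‖x * (r * D)‖ := fun x => by
    rw [norm_mul, norm_mul, hnr]
    have : 0 ≤ ‖x‖ * ‖D‖ := by positivity
    nlinarith
  have ha' : ‖a‖ * ‖D‖ ≤ (B * B * P + A * Q) * N := by
    refine (hD1 a).trans ?_
    rw [ha]
    calc _ ≤ ‖t * s * p‖ + ‖A * q‖ := norm_sub_le _ _
      _ = ‖t‖ * ‖s‖ * ‖p‖ + A * ‖q‖ := by rw [norm_mul, norm_mul, norm_mul, hnA]
      _ ≤ B * B * (P * N) + A * (Q * N) := by gcongr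
      _ = _ := by ring
  have hb' : ‖b‖ * ‖D‖ ≤ (B * (B * Q + Le * R * P)) * N := by
    refine (hD1 b).trans ?_
    rw [hb]
    calc _ = ‖s‖ * ‖(r - H1 lam) * q + Le * r * p‖ := norm_mul _ _
      _ ≤ ‖s‖ * (‖r - H1 lam‖ * ‖q‖ + Le * R * ‖p‖) := by
        gcongr
        refine (norm_add_le _ _).trans (le_of_eq ?_)
        rw [norm_mul, norm_mul, norm_mul, hnL, hnr]
      _ ≤ B * (B * (Q * N) + Le * R * (P * N)) := by gcongr
      _ = _ := by ring
  rw [← le_div_iff₀ hDp] at ha' hb'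
  calc ‖U‖ ≤ 2 * ‖a‖ + G * ‖b‖ + S * N := hU
    _ ≤ 2 * ((B * B * P + A * Q) * N / ‖D‖) + G * ((B * (B * Q + Le * R * P)) * N / ‖D‖) + S * N := by
      gcongr
    _ = (C - S) * N / ‖D‖ + S * N := by rw [hCdef]; ring
    _ ≤ C * N / ‖D‖ + C * N := by
      have : 0 ≤ C - S := by rw [hCdef, add_sub_cancel_right]; positivity
      gcongr <;> linarith
    _ = _ := by ring

theorem exists_rateBound (hLe : 1 < Le) {lam : ℂ} (h : lam ∉ halfLine ∪ regionP Θi Le) :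
    ∃ e, RateBound Θi Le lam e := by
  have h1 := H1_re_pos fun h' => h (Or.inl h')
  have h3 := H3_re_pos hLe fun h' => h (Or.inl h')
  have h2 : Le - 1 < (H2 Θi Le lam).re := by
    by_contra hc
    exact h (Or.inr ((mem_regionP_iff hLe lam).2 (not_lt.1 hc)))
  refine ⟨min ((H1 lam).re) (min ((H2 Θi Le lam).re - (Le - 1)) ((H3 Le lam).re)) / 2, ?_, ?_, ?_, ?_⟩
  · exact half_pos (lt_min h1 (lt_min (by linarith) h3))
  all_goals
    have e1 := min_le_left ((H1 lam).re) (min ((H2 Θi Le lam).re - (Le - 1)) ((H3 Le lam).re))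
    have e2 := min_le_right ((H1 lam).re) (min ((H2 Θi Le lam).re - (Le - 1)) ((H3 Le lam).re))
    have e3 := min_le_left ((H2 Θi Le lam).re - (Le - 1)) ((H3 Le lam).re)
    have e4 := min_le_right ((H2 Θi Le lam).re - (Le - 1)) ((H3 Le lam).re)
    linarith

theorem mem_opResolventSet_L (hΘ0 : 0 < Θi) (hΘ1 : Θi < 1) (hLe : 1 < Le) {lam : ℂ}
    (h : lam ∉ halfLine ∪ regionP Θi Le) (hD : dispersion Θi Le lam ≠ 0) :
    lam ∈ opResolventSet (L Θi Le) := by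
  obtain ⟨e, he⟩ := exists_rateBound hLe h
  set B := max ‖k3 Θi Le lam - k2 lam‖ (max ‖k6 Le lam - k3 Θi Le lam‖ ‖1 / (1 - Θi) - H1 lam‖)
    with hB
  obtain ⟨C, -, hC⟩ := exists_resolvent_bound hΘ0 hΘ1 hLe he.pos
    (B := B) (le_max_of_le_left (norm_nonneg _))
  exact (hC lam he (le_max_left _ _) ((le_max_left _ _).trans (le_max_right _ _))
    ((le_max_right _ _).trans (le_max_right _ _)) hD).1

/-- Zeros of the dispersion relation are eigenvalues. -/
theorem exists_eigenvector (hΘ1 : Θi < 1) (hLe : 1 < Le) {lam : ℂ} {e : ℝ}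
    (he : RateBound Θi Le lam e) (hD : dispersion Θi Le lam = 0) :
    ∃ x ∈ opEigenspace (L Θi Le) lam, x ≠ 0 := by
  have h1 := one_sub_ne_zero hΘ1
  have hs := he.k3_sub_k2_ne
  have ht := he.k6_sub_k3_ne hLe
  have hDe := dispersion_eq (Le := Le) hΘ1 lam
  rw [hD, mul_zero] at hDe
  -- A null vector normalized by a = 1: the second interface equation determines b, and the first
  -- then says that the dispersion function vanishes.
  obtain ⟨U, V, Z, hT, hE, hU, -⟩ := (auxSolution_zero Θi Le lam).exists_triple he
    (a := 1) (b := Le * (1 / (1 - Θi)) / (k6 Le lam - k3 Θi Le lam)) (by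
      rw [sub_zero, ← mul_div_assoc, div_div, ← sub_eq_zero]
      field_simp at hDe ⊢
      linear_combination -hDe) (by field_simp; ring)
  have h2 := hE.sub_L hLe hT
  refine ⟨U, ⟨mem_domain_L hT, (sub_eq_zero.1 h2).symm⟩, fun h0 => ?_⟩
  rw [h0] at hU
  exact zero_ne_one hU

/-- Eigenfunctions are determined by the value of the first component at the interface. -/
theorem eq_zero_of_mem_opEigenspace (hΘ0 : 0 < Θi) (hΘ1 : Θi < 1) (hLe : 1 < Le) {lam : ℂ} {e : ℝ}
    (he : RateBound Θi Le lam e) {x : W Le} (hx : x ∈ opEigenspace (L Θi Le) lam)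
    (h0 : x.fst 0 = 0) : x = 0 := by
  obtain ⟨hd, hx⟩ := hx
  obtain ⟨V, Z, hT, hE⟩ := resolventEq_L hLe lam ⟨x, hd⟩
  rw [hx, sub_self] at hE
  obtain ⟨-, hq, hU⟩ := apriori hΘ0 hΘ1 hLe he hT hE
  simp only [norm_zero, mul_zero, h0, zero_div, sub_zero, add_zero, zero_add] at hq hU
  have hb : x.snd 0 = 0 := by
    have := norm_le_zero_iff.1 hq
    exact (mul_eq_zero.1 this).resolve_right (he.k6_sub_k3_ne hLe)
  rw [hb, norm_zero, mul_zero] at hU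
  exact norm_le_zero_iff.1 hU

theorem isEigenvalue_iff (hΘ0 : 0 < Θi) (hΘ1 : Θi < 1) (hLe : 1 < Le) {lam : ℂ}
    (h : lam ∉ halfLine ∪ regionP Θi Le) :
    IsEigenvalue (L Θi Le) lam ↔ dispersion Θi Le lam = 0 := by
  refine ⟨fun hev => ?_, fun hD => ?_⟩
  · by_contra hD
    exact hev (isResolventOf_opResolvent
      (mem_opResolventSet_L hΘ0 hΘ1 hLe h hD)).opEigenspace_eq_bot
  · obtain ⟨e, he⟩ := exists_rateBound hLe h
    obtain ⟨x, hx, hx0⟩ := exists_eigenvector hΘ1 hLe he hD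
    exact fun hbot => hx0 ((Submodule.mem_bot ℂ).1 (hbot ▸ hx))

end Resolvent

/-! ### Sectoriality -/

section Sectorial

variable {Θi Le : ℝ}

/-- For large decay rates the interface equations are uniquely solvable, with estimates. -/
theorem interface_bound (hΘ0 : 0 < Θi) (hΘ1 : Θi < 1) (hLe : 1 < Le) {lam : ℂ} {e : ℝ}
    (he : RateBound Θi Le lam e) (h1 : 1 ≤ e) (hr : 1 / (1 - Θi) ≤ e)
    (hA : coeffA Θi Le * Le * (1 / (1 - Θi)) ≤ e) {a b : ℂ} {P Q : ℝ}
    (hp : ‖a * (1 / (1 - Θi) - H1 lam) + coeffA Θi Le * b / (k3 Θi Le lam - k2 lam)‖ ≤ P)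
    (hq : ‖b * (k6 Le lam - k3 Θi Le lam) - Le * a / (1 - Θi)‖ ≤ Q) :
    e * ‖a‖ ≤ 2 * (P + coeffA Θi Le * Q) ∧ 2 * e * ‖b‖ ≤ Q + Le * (1 / (1 - Θi)) * ‖a‖ := by
  have hA0 := coeffA_pos hΘ0 hΘ1 hLe
  have hL0 : 0 < Le := by linarith
  set A := coeffA Θi Le
  set s := k3 Θi Le lam - k2 lam
  set t := k6 Le lam - k3 Θi Le lam
  have hs : 2 * e ≤ ‖s‖ := he.le_norm_k3_sub_k2
  have ht : 2 * e ≤ ‖t‖ := he.le_norm_k6_sub_k3 hLe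
  set R : ℝ := 1 / (1 - Θi) with hR
  have hR0 : 0 < R := by rw [hR]; exact one_div_pos.2 (by linarith)
  have hrc : (1 / (1 - Θi) : ℂ) = (R : ℂ) := by rw [hR]; push_cast; rfl
  have hQ0 : 0 ≤ Q := (norm_nonneg _).trans hq
  have hb : 2 * e * ‖b‖ ≤ Q + Le * R * ‖a‖ := by
    have e1 : ‖(Le * a / (1 - Θi) : ℂ)‖ = Le * R * ‖a‖ := by
      rw [show (Le * a / (1 - Θi) : ℂ) = ((Le * R : ℝ) : ℂ) * a by
        rw [Complex.ofReal_mul, ← hrc]; ring, norm_mul, Complex.norm_real,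
        Real.norm_of_nonneg (by positivity)]
    have e2 : ‖b * t‖ ≤ Q + Le * R * ‖a‖ := by
      rw [← e1]
      have := norm_add_le (b * t - Le * a / (1 - Θi)) (Le * a / (1 - Θi))
      rw [sub_add_cancel] at this
      linarith
    rw [norm_mul] at e2
    nlinarith [norm_nonneg b]
  refine ⟨?_, hb⟩
  -- Re H1 ≥ 2e while 1/(1 - Θi) ≤ e, so the diagonal entry has size at least e.
  have hx : e ≤ ‖(1 / (1 - Θi) - H1 lam : ℂ)‖ := by
    rw [hrc, norm_sub_rev]
    refine le_trans ?_ (Complex.re_le_norm _)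
    rw [Complex.sub_re, Complex.ofReal_re]
    linarith [he.h1]
  have hq' : ‖(A * b / s : ℂ)‖ ≤ A * ‖b‖ / (2 * e) := by
    rw [norm_div, norm_mul, Complex.norm_real, Real.norm_of_nonneg hA0.le]
    gcongr
  have h2 : e * ‖a‖ ≤ P + A * ‖b‖ / (2 * e) := by
    have := norm_sub_le (a * (1 / (1 - Θi) - H1 lam) + A * b / s) (A * b / s)
    rw [add_sub_cancel_right, norm_mul] at this
    nlinarith [norm_nonneg a]
  -- The bound for b is fed back; since A Le/(1 - Θi) ≤ e, the coupling costs at most half of e‖a‖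
  -- and is absorbed on the left.
  have h3 : A * ‖b‖ / (2 * e) ≤ A * Q + e / 2 * ‖a‖ := by
    rw [div_le_iff₀ (by linarith)]
    have g1 : A * ‖b‖ ≤ A * (2 * e * ‖b‖) := by
      have : 0 ≤ A * ‖b‖ := by positivity
      nlinarith
    have g2 : A * (2 * e * ‖b‖) ≤ A * (Q + Le * R * ‖a‖) := by gcongr
    have g3 : A * Le * R * ‖a‖ ≤ e * ‖a‖ := by gcongr
    have g4 : 0 ≤ A * Q := by positivity
    have g5 : 0 ≤ e * ‖a‖ := by positivity
    nlinarith [mul_le_mul_of_nonneg_right h1 g4, mul_le_mul_of_nonneg_right h1 g5]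
  linarith

/-- For large e the interface system is diagonally dominant, so the dispersion function cannot
vanish. The right-hand sides are O(1/e) and the diagonal entries at least of order e, so a and b are
O(1/e²) times ‖F‖, like the remaining term of `apriori`. -/
theorem exists_resolvent_bound_large (hΘ0 : 0 < Θi) (hΘ1 : Θi < 1) (hLe : 1 < Le) :
    ∃ e₀ C : ℝ, 0 < e₀ ∧ 0 < C ∧ ∀ (lam : ℂ) (e : ℝ), RateBound Θi Le lam e → e₀ ≤ e →
      lam ∈ opResolventSet (L Θi Le) ∧ ‖opResolvent (L Θi Le) lam‖ ≤ C / e ^ 2 := by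
  have hA := coeffA_pos hΘ0 hΘ1 hLe
  have hL0 : 0 < Le := by linarith
  set R : ℝ := 1 / (1 - Θi) with hR
  have hR0 : 0 < R := by rw [hR]; exact one_div_pos.2 (by linarith)
  set K : ℝ := 2 * (2 + 3 * coeffA Θi Le * Le) with hK
  set K' : ℝ := 2 * Le + Le * R * K with hK'
  have hK0 : 0 < K := by positivity
  refine ⟨max 1 (max R (coeffA Θi Le * Le * R)),
    2 * K + (2 + coeffA Θi Le) * K' + (2 + coeffA Θi Le * Le + 2 * Le),
    lt_max_of_lt_left one_pos, by positivity, fun lam e he hle => ?_⟩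
  have h1 : 1 ≤ e := (le_max_left _ _).trans hle
  have h2 : R ≤ e := ((le_max_left _ _).trans (le_max_right _ _)).trans hle
  have h3 : coeffA Θi Le * Le * R ≤ e := ((le_max_right _ _).trans (le_max_right _ _)).trans hle
  have h0 : 0 < e := by linarith
  -- A zero would give a null vector with a = 1, contradicting `interface_bound` with P = Q = 0.
  have hD : dispersion Θi Le lam ≠ 0 := by
    intro hD
    have hs := he.k3_sub_k2_ne
    have ht := he.k6_sub_k3_ne hLe
    have h1' := one_sub_ne_zero hΘ1
    have hDe := dispersion_eq (Le := Le) hΘ1 lam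
    rw [hD, mul_zero] at hDe
    have key := (interface_bound hΘ0 hΘ1 hLe he h1 h2 h3 (a := 1)
      (b := Le * (1 / (1 - Θi)) / (k6 Le lam - k3 Θi Le lam)) (P := 0) (Q := 0) (by
        rw [norm_le_zero_iff, ← mul_div_assoc, div_div]
        field_simp at hDe ⊢
        linear_combination -hDe) (by
        rw [norm_le_zero_iff]; field_simp; ring)).1
    rw [norm_one] at key
    linarith
  set C := 2 * K + (2 + coeffA Θi Le) * K' + (2 + coeffA Θi Le * Le + 2 * Le) with hC
  have key := L_resolvent hΘ1 hLe he hD (C := C / e ^ 2) ?_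
  · exact ⟨key.1, key.2 (by positivity)⟩
  intro U V Z F hT hE
  obtain ⟨hp, hq, hU⟩ := apriori hΘ0 hΘ1 hLe he hT hE
  obtain ⟨ha, hb⟩ := interface_bound hΘ0 hΘ1 hLe he h1 h2 h3 hp hq
  rw [← hR] at hb
  set A := coeffA Θi Le
  set N := ‖F‖
  have hN : 0 ≤ N := norm_nonneg F
  have he2 : 1 ≤ e ^ 2 := one_le_pow₀ h1
  have d1 : A * Le / e ^ 2 ≤ A * Le := div_le_self (by positivity) he2
  have d2 : A / (2 * e ^ 2) ≤ A := div_le_self hA.le (by linarith)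
  have ha' : ‖U.fst 0‖ ≤ K / e ^ 2 * N := by
    have : e * ‖U.fst 0‖ ≤ e * (K / e ^ 2 * N) := by
      refine ha.trans ?_
      calc 2 * ((2 + A * Le / e ^ 2) / e * N + A * (2 * Le / e * N))
          ≤ 2 * ((2 + A * Le) / e * N + A * (2 * Le / e * N)) := by gcongr
        _ = e * (K / e ^ 2 * N) := by rw [hK]; field_simp; ring
    exact le_of_mul_le_mul_left this h0
  have hb' : ‖U.snd 0‖ ≤ K' / e ^ 2 * N := by
    have : 2 * e * ‖U.snd 0‖ ≤ 2 * e * (K' / e ^ 2 * N) := by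
      refine hb.trans ?_
      calc 2 * Le / e * N + Le * R * ‖U.fst 0‖
          ≤ 2 * Le / e * N + Le * R * (K / e ^ 2 * N) := by gcongr
        _ ≤ 2 * Le / e * N + Le * R * (K / e * N) := by
          gcongr
          nlinarith
        _ = e * (K' / e ^ 2 * N) := by rw [hK']; field_simp
        _ ≤ 2 * e * (K' / e ^ 2 * N) := by
          have : 0 ≤ e * (K' / e ^ 2 * N) := by positivity
          linarith
    exact le_of_mul_le_mul_left this (by linarith)
  calc ‖U‖ ≤ 2 * ‖U.fst 0‖ + (2 + A / (2 * e ^ 2)) * ‖U.snd 0‖ +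
        (2 + A * Le / e ^ 2 + 2 * Le) / e ^ 2 * N := hU
    _ ≤ 2 * (K / e ^ 2 * N) + (2 + A) * (K' / e ^ 2 * N) +
        (2 + A * Le + 2 * Le) / e ^ 2 * N := by gcongr
    _ = C / e ^ 2 * N := by rw [hC]; ring

theorem neg_half_norm_le_re_of_abs_arg_lt {ν : ℂ} (h : |ν.arg| < 2 * Real.pi / 3) :
    -(‖ν‖ / 2) ≤ ν.re := by
  have h1 : Real.cos (2 * Real.pi / 3) ≤ Real.cos |ν.arg| :=
    Real.cos_le_cos_of_nonneg_of_le_pi (abs_nonneg _) (by linarith [Real.pi_pos]) h.le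
  rw [Real.cos_abs, show 2 * Real.pi / 3 = Real.pi - Real.pi / 3 by ring, Real.cos_pi_sub,
    Real.cos_pi_div_three] at h1
  have h2 := Complex.norm_mul_cos_arg ν
  nlinarith [norm_nonneg ν]

/-- Growth of the square root of an affine function in a sector of half-angle `2π/3`. -/
theorem csqrt_re_sq_lower_bound {ν : ℂ} (h : -(‖ν‖ / 2) ≤ ν.re) {s m : ℝ} (hs : 0 ≤ s)
    (hm : 0 ≤ m) : max s (m * ‖ν‖) / 8 ≤ (csqrt (s + m * ν)).re ^ 2 := by
  have hre : ((s : ℂ) + m * ν).re = s + m * ν.re := by simp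
  have him : ((s : ℂ) + m * ν).im = m * ν.im := by simp
  have hn : ‖(s : ℂ) + m * ν‖ ^ 2 = (s + m * ν.re) ^ 2 + (m * ν.im) ^ 2 := by
    rw [← Complex.normSq_eq_norm_sq, Complex.normSq_apply, hre, him]; ring
  have hν : ‖ν‖ ^ 2 = ν.re ^ 2 + ν.im ^ 2 := by
    rw [← Complex.normSq_eq_norm_sq, Complex.normSq_apply]; ring
  rw [csqrt_re_sq, hre]
  set n := ‖(s : ℂ) + m * ν‖
  set N := ‖ν‖
  have hn0 : 0 ≤ n := norm_nonneg _
  have hN0 : 0 ≤ N := norm_nonneg _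
  have hmN : 0 ≤ m * N := by positivity
  have hmr : -(m * N / 2) ≤ m * ν.re := by nlinarith
  -- Law of cosines: Re ν ≥ -|ν|/2 limits the cancellation between s and mν. It gives n ≥ s/2 and n
  -- ≥ m|ν|/2 below.
  have hn2 : s ^ 2 - s * (m * N) + (m * N) ^ 2 ≤ n ^ 2 := by
    rw [hn]
    have : (m * N) ^ 2 = (m * ν.re) ^ 2 + (m * ν.im) ^ 2 := by rw [mul_pow, hν]; ring
    rw [this]
    nlinarith [mul_le_mul_of_nonneg_left hmr hs]
  -- The sum s + mν satisfies the same sector condition, so (n + Re)/2 ≥ n/4.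
  have hnr : -(n / 2) ≤ s + m * ν.re := by
    by_contra hc
    rw [not_le] at hc
    have g1 : s + n / 2 ≤ m * N / 2 := by linarith
    nlinarith [mul_le_mul_of_nonneg_left hmr hs]
  have e1 : s / 2 ≤ n := by
    refine le_of_sq_le_sq ?_ hn0
    nlinarith [sq_nonneg (s - 2 * (m * N)), sq_nonneg s]
  have e2 : m * N / 2 ≤ n := by
    refine le_of_sq_le_sq ?_ hn0
    nlinarith [sq_nonneg (2 * s - (m * N)), sq_nonneg (m * N)]
  have e3 : max s (m * N) / 2 ≤ n := by
    rcases max_cases s (m * N) with ⟨h, -⟩ | ⟨h, -⟩ <;> rw [h] <;> assumption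
  linarith

/-- In a sector of half-angle 2π/3 all three square roots have real part at least τ, where τ² =
max(ω, |lam - ω|)/2. Taking e = τ/4 turns the bound C/e² into 32C/|lam - ω|. -/
theorem isSectorial_L (hΘ0 : 0 < Θi) (hΘ1 : Θi < 1) (hLe : 1 < Le) : IsSectorial (L Θi Le) := by
  have hA := coeffA_pos hΘ0 hΘ1 hLe
  obtain ⟨e₀, C, he₀, hC, hR⟩ := exists_resolvent_bound_large hΘ0 hΘ1 hLe
  -- Ensures τ/4 ≥ e₀ and τ/2 ≥ Le - 1, the latter to absorb the shift in the rate of H2. The shift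
  -- ω = 2τ₀² is what forces τ ≥ τ₀.
  set τ₀ : ℝ := 4 * e₀ + 2 * Le with hτ₀
  have hτ₀p : 0 < τ₀ := by positivity
  refine ⟨2 * τ₀ ^ 2, 2 * Real.pi / 3, 32 * C, by linarith [Real.pi_pos],
    by linarith [Real.pi_pos], by positivity, fun lam hne harg => ?_⟩
  set ω : ℝ := 2 * τ₀ ^ 2 with hω
  have hω0 : 0 < ω := by positivity
  set ν := lam - ω with hν
  have hν0 : 0 < ‖ν‖ := norm_pos_iff.2 (sub_ne_zero.2 hne)
  have hlam : lam = ω + ν := by rw [hν]; ring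
  have hre := neg_half_norm_le_re_of_abs_arg_lt harg
  set X : ℝ := max ω ‖ν‖ / 2 with hX
  have hX0 : 0 < X := by positivity
  have hmax : 4 * max ω ‖ν‖ = max (4 * ω) (4 * ‖ν‖) := by
    rw [mul_max_of_nonneg _ _ (by norm_num)]
  have bound : ∀ s m : ℝ, 4 * ω ≤ s → 4 ≤ m → X ≤ (csqrt (s + m * ν)).re ^ 2 := by
    intro s m h1 h2
    refine le_trans ?_ (csqrt_re_sq_lower_bound hre (by linarith) (by linarith))
    have : max (4 * ω) (4 * ‖ν‖) ≤ max s (m * ‖ν‖) := by gcongr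
    rw [hX]
    linarith
  set τ := Real.sqrt X with hτ
  have hroot : ∀ z : ℂ, X ≤ (csqrt z).re ^ 2 → τ ≤ (csqrt z).re := fun z hz =>
    Real.sqrt_le_iff.2 ⟨csqrt_re_nonneg z, hz⟩
  have b1 : τ ≤ (H1 lam).re := hroot _ (by
    have := bound (1 + 4 * ω) 4 (by linarith) le_rfl
    rw [hlam]
    convert this using 4
    push_cast; ring)
  have b2 : τ ≤ (H2 Θi Le lam).re := hroot _ (by
    have := bound (Le ^ 2 + 4 * Le * (coeffA Θi Le + ω)) (4 * Le) (by nlinarith) (by linarith)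
    rw [hlam]
    convert this using 4
    push_cast; ring)
  have b3 : τ ≤ (H3 Le lam).re := hroot _ (by
    have := bound (Le ^ 2 + 4 * Le * ω) (4 * Le) (by nlinarith) (by linarith)
    rw [hlam]
    convert this using 4
    push_cast; ring)
  have hττ : τ₀ ≤ τ := by
    refine Real.le_sqrt_of_sq_le ?_
    have := le_max_left ω ‖ν‖
    rw [hX]
    linarith
  have hsq : τ ^ 2 = X := Real.sq_sqrt hX0.le
  have hrate : RateBound Θi Le lam (τ / 4) :=
    ⟨by linarith, by linarith, by linarith, by linarith⟩
  obtain ⟨hmem, hle⟩ := hR lam _ hrate (by linarith)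
  refine ⟨hmem, hle.trans ?_⟩
  have hν2 : ‖ν‖ ≤ 32 * (τ / 4) ^ 2 := by
    have := le_max_right ω ‖ν‖
    rw [div_pow, hsq, hX]
    linarith
  rw [div_le_div_iff₀ (by positivity) hν0]
  nlinarith

end Sectorial

/-! ### The essential part of the spectrum -/

section Spectrum

variable {Θi Le : ℝ}

theorem mem_opSpectrum_of_mem_opEigenspace {X : Type*} [NormedAddCommGroup X] [NormedSpace ℂ X]
    {A : X →ₗ.[ℂ] X} {lam : ℂ} {x : X} (hx : x ∈ opEigenspace A lam) (h0 : x ≠ 0) :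
    lam ∈ opSpectrum A := fun ⟨_, hR⟩ =>
  h0 ((Submodule.mem_bot ℂ).1 (hR.opEigenspace_eq_bot ▸ hx))

/-- Closedness of the spectrum, in the form needed here: moving to the left sends the half-line and
𝒫 into their relative and topological interiors, where the arguments below apply. -/
theorem mem_opSpectrum_of_sub_ofReal {X : Type*} [NormedAddCommGroup X] [NormedSpace ℂ X]
    [CompleteSpace X] {A : X →ₗ.[ℂ] X} {lam : ℂ}
    (h : ∀ ε : ℝ, 0 < ε → lam - ε ∈ opSpectrum A) : lam ∈ opSpectrum A := by
  have ht : Tendsto (fun ε : ℝ => lam - ε) (𝓝[>] 0) (𝓝 lam) := by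
    have : Tendsto (fun ε : ℝ => lam - ε) (𝓝 0) (𝓝 (lam - (0 : ℝ))) :=
      Continuous.tendsto (by fun_prop) 0
    rw [Complex.ofReal_zero, sub_zero] at this
    exact this.mono_left nhdsWithin_le_nhds
  refine mem_opSpectrum_of_frequently (ht.frequently (Eventually.frequently ?_))
  filter_upwards [self_mem_nhdsWithin] with ε hε using h ε hε

theorem hasDerivAt_exp_add_exp (a b c d : ℂ) (x : ℝ) :
    HasDerivAt (fun x : ℝ => c * Complex.exp (a * x) + d * Complex.exp (b * x))
      (c * a * Complex.exp (a * x) + d * b * Complex.exp (b * x)) x := by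
  refine (((hasDerivAt_cexp_mul_ofReal a x).const_mul c).add
    ((hasDerivAt_cexp_mul_ofReal b x).const_mul d)).congr_deriv ?_
  ring

theorem jump_zero (α β : ℝ) : jump (0 : Weighted α β) = 0 := by
  simpa using Weighted.jump_smul 0 (0 : Weighted α β)

/-- The exponents -1/2 ± iw have constant modulus in the weight, so both exponentials are admissible
on both half-lines. Their difference vanishes at 0 and is smooth there; paired with zero second
component it meets all interface conditions. -/
theorem halfLine_interior_subset (hLe : 1 < Le) {w : ℝ} (hw : 0 < w) :
    (-(1 / 4) - w ^ 2 : ℂ) ∈ opSpectrum (L Θi Le) := by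
  set a : ℂ := -(1 / 2) + w * Complex.I with ha
  set b : ℂ := -(1 / 2) - w * Complex.I with hb
  have hare : a.re + 1 / 2 = 0 := by simp [ha]
  have hbre : b.re + 1 / 2 = 0 := by simp [hb]
  have hasq : a ^ 2 = (-(1 / 4) - w ^ 2 : ℂ) - a := by
    rw [ha]; linear_combination (w : ℂ) ^ 2 * Complex.I_sq
  have hbsq : b ^ 2 = (-(1 / 4) - w ^ 2 : ℂ) - b := by
    rw [hb]; linear_combination (w : ℂ) ^ 2 * Complex.I_sq
  have hl : ∀ c d : ℂ, IsLeft (1 / 2) fun x : ℝ =>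
      c * Complex.exp (a * x) + d * Complex.exp (b * x) := fun c d =>
    ((isLeft_cexp hare.ge).const_mul c).add ((isLeft_cexp hbre.ge).const_mul d)
  have hr : ∀ c d : ℂ, IsRight (1 / 2) fun x : ℝ =>
      c * Complex.exp (a * x) + d * Complex.exp (b * x) := fun c d =>
    ((isRight_cexp hare.le).const_mul c).add ((isRight_cexp hbre.le).const_mul d)
  let g : ℂ → ℂ → Weighted (1 / 2) (1 / 2) := fun c d => Weighted.glue (hl c d) (hr c d)
  have hg : ∀ c d (ξ : ℝ), g c d ξ = c * Complex.exp (a * ξ) + d * Complex.exp (b * ξ) := by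
    intro c d ξ
    rcases lt_or_ge ξ 0 with h | h
    · exact Weighted.glue_of_neg _ _ h
    · exact Weighted.glue_of_nonneg _ _ h
  have hgd : ∀ c d, Weighted.HasDeriv (g c d) (g (c * a) (d * b)) := fun c d =>
    Weighted.hasDeriv_glue _ _ _ _ (fun ξ _ => hasDerivAt_exp_add_exp a b c d ξ)
      (fun ξ _ => hasDerivAt_exp_add_exp a b c d ξ)
  have hgj : ∀ c d, jump (g c d) = 0 := fun c d =>
    (Weighted.jump_glue _ _).trans (sub_self _)
  let U : W Le := WithLp.toLp 1 (g 1 (-1), 0)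
  let V : W Le := WithLp.toLp 1 (g (1 * a) (-1 * b), 0)
  let Z : W Le := WithLp.toLp 1 (g (1 * a * a) (-1 * b * b), 0)
  have hU0 : U.fst 0 = 0 := (hg 1 (-1) 0).trans (by simp)
  have hT : IsDomainTriple Θi Le U V Z := by
    refine ⟨hgd _ _, .zero, hgd _ _, .zero, hgj _ _, jump_zero _ _, ?_, ?_⟩
    · rw [hU0, zero_div, neg_zero]; exact hgj _ _
    · rw [hU0, mul_zero, zero_div]; exact jump_zero _ _
  have hfst : ∀ ξ : ℝ, Z.fst ξ = (-(1 / 4) - w ^ 2) * U.fst ξ - V.fst ξ := by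
    intro ξ
    have e1 : Z.fst ξ = _ := hg _ _ ξ
    have e2 : V.fst ξ = _ := hg _ _ ξ
    have e3 : U.fst ξ = _ := hg _ _ ξ
    rw [e1, e2, e3]
    linear_combination Complex.exp (a * ξ) * hasq - Complex.exp (b * ξ) * hbsq
  have hU2 : ∀ ξ : ℝ, U.snd ξ = 0 := fun ξ => rfl
  have hV2 : ∀ ξ : ℝ, V.snd ξ = 0 := fun ξ => rfl
  have hZ2 : ∀ ξ : ℝ, Z.snd ξ = 0 := fun ξ => rfl
  have hF1 : ∀ ξ : ℝ, (0 : W Le).fst ξ = 0 := fun ξ => rfl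
  have hF2 : ∀ ξ : ℝ, (0 : W Le).snd ξ = 0 := fun ξ => rfl
  have hE : ResolventEq Θi Le (-(1 / 4) - w ^ 2) U V Z 0 := by
    refine ⟨fun ξ _ => ?_, fun ξ _ => ?_, fun ξ _ => ?_, fun ξ _ => ?_⟩
    · rw [hfst, hU2, hF1]; ring
    · rw [hfst, hF1]; ring
    · rw [hZ2, hU2, hV2, hF2]; ring
    · rw [hZ2, hU2, hV2, hF2]; ring
  refine mem_opSpectrum_of_mem_opEigenspace (x := U)
    ⟨mem_domain_L hT, (sub_eq_zero.1 (hE.sub_L hLe hT)).symm⟩ fun h0 => ?_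
  -- the derivative at the interface does not vanish
  have hV0 : V = 0 := by
    have h1 := hT
    rw [h0] at h1
    exact (h1.unique (.zero Θi Le)).1
  have e1 : V.fst 0 = _ := hg _ _ 0
  rw [hV0, hF1] at e1
  have e2 : (w : ℂ) * Complex.I = 0 := by
    simp only [Complex.ofReal_zero, mul_zero, Complex.exp_zero, mul_one, one_mul, ha, hb] at e1
    linear_combination -e1 / 2
  simp [hw.ne'] at e2

theorem halfLine_subset (hLe : 1 < Le) : halfLine ⊆ opSpectrum (L Θi Le) := by
  rintro lam ⟨him, hre⟩
  refine mem_opSpectrum_of_sub_ofReal fun ε hε => ?_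
  have hw : 0 < -(1 / 4) - lam.re + ε := by linarith
  have h := halfLine_interior_subset (Θi := Θi) hLe (Real.sqrt_pos.2 hw)
  rw [← Complex.ofReal_pow, Real.sq_sqrt hw.le] at h
  convert h using 1
  apply Complex.ext
  · simp only [one_div, Complex.sub_re, Complex.ofReal_re, Complex.neg_re, Complex.inv_re,
      Complex.re_ofNat, Complex.normSq_ofNat]
    ring
  · simp [him]

theorem left_eq_zero {a : ℂ} {y : ℝ → ℂ} {Y : ℝ} (ha : a.re + 1 / 2 < 0)
    (hy : ∀ x < 0, HasDerivAt y (a * y x) x)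
    (hyb : ∀ x < 0, Real.exp (1 / 2 * x) * ‖y x‖ ≤ Y) {x : ℝ} (hx : x < 0) : y x = 0 := by
  have h := left_growing_bound (f := fun _ => 0) (F := 0) ha (by simpa using hy) hyb (by simp) hx
  rw [zero_div] at h
  exact norm_le_zero_iff.1 (nonpos_of_mul_nonpos_right h (Real.exp_pos _))

theorem right_eq_zero {a : ℂ} {β : ℝ} {y : ℝ → ℂ} {Y : ℝ} (ha : 0 < a.re + β)
    (hy : ∀ x > 0, HasDerivAt y (a * y x) x)
    (hyb : ∀ x > 0, Real.exp (β * x) * ‖y x‖ ≤ Y) {x : ℝ} (hx : 0 < x) : y x = 0 := by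
  have h := right_growing_bound (f := fun _ => 0) (F := 0) ha (by simpa using hy) hyb (by simp) hx
  rw [zero_div] at h
  exact norm_le_zero_iff.1 (nonpos_of_mul_nonpos_right h (Real.exp_pos _))

/-- On the right half-line, the homogeneous equation forces a relation at the interface. -/
theorem Weighted.right_relation {β : ℝ} {u v z : Weighted (1 / 2) β} {p q : ℂ}
    (hp : 0 < p.re + β) (huv : HasDeriv u v) (hvz : HasDeriv v z)
    (hz : ∀ ξ > 0, z ξ = (p + q) * v ξ - p * q * u ξ) : v 0 = q * u 0 := by
  have h0 : ∀ ξ > 0, v ξ - q * u ξ = 0 := by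
    intro ξ hξ
    refine right_eq_zero (y := fun ξ => v ξ - q * u ξ) (Y := ‖v‖ + ‖q‖ * ‖u‖) hp
      (fun x hx => ?_) (fun x hx => ?_) hξ
    · refine ((hvz x (ne_of_gt hx)).sub ((huv x (ne_of_gt hx)).const_mul q)).congr_deriv ?_
      rw [hz x hx]; ring
    · calc _ ≤ Real.exp (β * x) * (‖v x‖ + ‖q‖ * ‖u x‖) := by
            gcongr
            exact (norm_sub_le _ _).trans_eq (by rw [norm_mul])
        _ = Real.exp (β * x) * ‖v x‖ + ‖q‖ * (Real.exp (β * x) * ‖u x‖) := by ring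
        _ ≤ _ := by
          gcongr
          · exact v.le_norm_pos hx
          · exact u.le_norm_pos hx
  have ht : Tendsto (fun ξ => v ξ - q * u ξ) (𝓝[>] 0) (𝓝 (v 0 - q * u 0)) :=
    v.tendsto_pos.sub (u.tendsto_pos.const_mul q)
  have ht' : Tendsto (fun ξ => v ξ - q * u ξ) (𝓝[>] 0) (𝓝 0) := by
    refine tendsto_const_nhds.congr' ?_
    filter_upwards [self_mem_nhdsWithin] with ξ hξ using (h0 ξ hξ).symm
  exact sub_eq_zero.1 (tendsto_nhds_unique ht ht')

theorem Weighted.left_sub_bound {β : ℝ} (u v : Weighted (1 / 2) β) (q : ℂ) {x : ℝ} (hx : x < 0) :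
    Real.exp (1 / 2 * x) * ‖v x - q * u x‖ ≤ ‖v‖ + ‖q‖ * ‖u‖ := by
  calc _ ≤ Real.exp (1 / 2 * x) * (‖v x‖ + ‖q‖ * ‖u x‖) := by
        gcongr
        exact (norm_sub_le _ _).trans_eq (by rw [norm_mul])
    _ = Real.exp (1 / 2 * x) * ‖v x‖ + ‖q‖ * (Real.exp (1 / 2 * x) * ‖u x‖) := by ring
    _ ≤ _ := by
      gcongr
      · exact v.le_norm_neg hx
      · exact u.le_norm_neg hx

/-- If both exponents are inadmissible, a homogeneous solution vanishes on the left half-line. -/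
theorem Weighted.left_eq_zero_of_rates {β : ℝ} {u v z : Weighted (1 / 2) β} {p q : ℂ}
    (hp : p.re + 1 / 2 < 0) (hq : q.re + 1 / 2 < 0) (huv : HasDeriv u v) (hvz : HasDeriv v z)
    (hz : ∀ ξ < 0, z ξ = (p + q) * v ξ - p * q * u ξ) {ξ : ℝ} (hξ : ξ < 0) : u ξ = 0 := by
  have h0 : ∀ ξ < 0, v ξ - q * u ξ = 0 := by
    intro ξ hξ
    refine left_eq_zero (y := fun ξ => v ξ - q * u ξ) hp
      (fun x hx => ?_) (fun x hx => left_sub_bound u v q hx) hξ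
    refine ((hvz x (ne_of_lt hx)).sub ((huv x (ne_of_lt hx)).const_mul q)).congr_deriv ?_
    rw [hz x hx]; ring
  refine left_eq_zero (y := u) hq (fun x hx => ?_) (fun x hx => u.le_norm_neg hx) hξ
  rw [← sub_eq_zero.1 (h0 x hx)]
  exact huv x (ne_of_lt hx)

theorem leftLim_eq_zero {α β : ℝ} {u : Weighted α β} (h : ∀ ξ < 0, u ξ = 0) :
    Function.leftLim u 0 = 0 := by
  refine leftLim_eq_of_tendsto (tendsto_const_nhds.congr' ?_)
  filter_upwards [self_mem_nhdsWithin] with ξ hξ using (h ξ hξ).symm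

/-- In the interior of `𝒫` the range of `lam - L` misses the characteristic function of the left
half-line. -/
theorem mem_opSpectrum_of_H2_lt (hΘ1 : Θi < 1) (hLe : 1 < Le) {lam : ℂ} (hl : lam ∉ halfLine)
    (hP : (H2 Θi Le lam).re < Le - 1) : lam ∈ opSpectrum (L Θi Le) := by
  have hL : (Le : ℂ) ≠ 0 := by exact_mod_cast (by linarith : Le ≠ 0)
  have hH1 := H1_re_pos hl
  have hH3 := H3_re_pos hLe hl
  have hH2 : 0 ≤ (H2 Θi Le lam).re := csqrt_re_nonneg _
  have hone : IsLeft (1 / 2) fun _ : ℝ => (1 : ℂ) := by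
    simpa using isLeft_cexp (α := 1 / 2) (a := 0) (by norm_num)
  have hzero : IsRight (1 / 2) fun _ : ℝ => (0 : ℂ) := ⟨continuousOn_const, 0, by simp⟩
  let F : W Le := WithLp.toLp 1 (Weighted.glue hone hzero, 0)
  have hF1 : ∀ ξ < 0, F.fst ξ = 1 := fun ξ hξ => Weighted.glue_of_neg hone hzero hξ
  have hF1' : ∀ ξ > 0, F.fst ξ = 0 := fun ξ hξ => Weighted.glue_of_nonneg hone hzero (le_of_lt hξ)
  have hF2 : ∀ ξ : ℝ, F.snd ξ = 0 := fun ξ => rfl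
  rintro ⟨R, hR, -⟩
  obtain ⟨⟨U, hd⟩, hsol⟩ : ∃ x : (L Θi Le).domain, lam • (x : W Le) - L Θi Le x = F :=
    ⟨⟨R F, (hR F).1⟩, (hR F).2⟩
  obtain ⟨V, Z, hT, hE⟩ := resolventEq_L hLe lam ⟨U, hd⟩
  rw [hsol] at hE
  dsimp only at hT hE
  have hs12 := k1_add_k2 lam
  have hp12 := k1_mul_k2 lam
  -- Inside 𝒫 both k3 and k4 are inadmissible, so v = 0 on the left. Then v and v' have zero trace
  -- at 0⁺, the jump of v' forces u(0) = 0, and the remaining conditions force u' to vanish on both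
  -- sides of 0.
  have hv : ∀ ξ < 0, U.snd ξ = 0 := fun ξ hξ =>
    Weighted.left_eq_zero_of_rates (p := k4 Θi Le lam) (q := k3 Θi Le lam)
      (by rw [k4_re]; linarith) (by rw [k3_re]; linarith) hT.deriv_snd hT.deriv2_snd
      (fun x hx => by
        rw [hE.snd_neg x hx, hF2]
        linear_combination -V.snd x * k3_add_k4 Θi Le lam + U.snd x * k3_mul_k4 Θi Le lam) hξ
  have hv' : ∀ ξ < 0, V.snd ξ = 0 := fun ξ hξ => by
    refine (hT.deriv_snd ξ (ne_of_lt hξ)).unique ((hasDerivAt_const ξ (0 : ℂ)).congr_of_eventuallyEq ?_)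
    filter_upwards [Iio_mem_nhds hξ] with x hx using hv x hx
  have hv0 : U.snd 0 = 0 := by
    have := hT.jump_snd
    rwa [Weighted.jump_eq, leftLim_eq_zero hv, sub_zero] at this
  have hv0' : V.snd 0 = 0 := by
    rw [Weighted.right_relation (p := k5 Le lam) (q := k6 Le lam) (by rw [k5_re]; linarith)
      hT.deriv_snd hT.deriv2_snd (fun x hx => by
        rw [hE.snd_pos x hx, hF2, k5_add_k6, k5_mul_k6]; ring), hv0, mul_zero]
  have hu0 : U.fst 0 = 0 := by
    have := hT.jump_deriv_snd
    rw [Weighted.jump_eq, leftLim_eq_zero hv', hv0', sub_zero] at this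
    simpa [hL, one_sub_ne_zero hΘ1] using this.symm
  have hu0' : V.fst 0 = 0 := by
    rw [Weighted.right_relation (p := k1 lam) (q := k2 lam) (by rw [k1_re]; linarith)
      hT.deriv_fst hT.deriv2_fst (fun x hx => by
        rw [hE.fst_pos x hx, hF1' x hx, hs12, hp12]; ring), hu0, mul_zero]
  have htu : Tendsto U.fst (𝓝[<] 0) (𝓝 0) := by
    have h1 := hT.jump_fst
    rw [Weighted.jump_eq, hu0, zero_sub, neg_eq_zero] at h1
    rw [← h1]
    exact U.fst.tendsto_neg
  have htv : Tendsto V.fst (𝓝[<] 0) (𝓝 0) := by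
    have h1 := hT.jump_deriv_fst
    rw [Weighted.jump_eq, hu0', hu0, zero_sub, zero_div, neg_inj] at h1
    rw [← h1]
    exact V.fst.tendsto_neg
  have hk2 : (k2 lam).re + 1 / 2 < 0 := by rw [k2_re]; linarith
  have hk20 : k2 lam ≠ 0 := fun h => by rw [h] at hk2; norm_num at hk2
  -- The quantity w = u' - k1 u satisfies w' = k2 w - 1, whose only bounded solution in the weight
  -- is the constant 1/k2. Its trace at 0⁻ should be 0, a contradiction.
  have hw : ∀ ξ < 0, V.fst ξ - k1 lam * U.fst ξ - 1 / k2 lam = 0 := by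
    intro ξ hξ
    refine left_eq_zero (y := fun ξ => V.fst ξ - k1 lam * U.fst ξ - 1 / k2 lam)
      (Y := ‖V.fst‖ + ‖k1 lam‖ * ‖U.fst‖ + ‖1 / k2 lam‖) hk2 (fun x hx => ?_) (fun x hx => ?_) hξ
    · refine (((hT.deriv2_fst x (ne_of_lt hx)).sub
        ((hT.deriv_fst x (ne_of_lt hx)).const_mul (k1 lam))).sub_const _).congr_deriv ?_
      rw [hE.fst_neg x hx, hF1 x hx, hv x hx]
      field_simp
      linear_combination -V.fst x * hs12 + U.fst x * hp12
    · refine (mul_le_mul_of_nonneg_left (norm_sub_le _ _) (Real.exp_pos _).le).trans ?_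
      rw [mul_add]
      refine add_le_add (Weighted.left_sub_bound _ _ _ hx) ?_
      refine mul_le_of_le_one_left (norm_nonneg _) (Real.exp_le_one_iff.2 ?_)
      linarith
  have ht : Tendsto (fun ξ => V.fst ξ - k1 lam * U.fst ξ - 1 / k2 lam) (𝓝[<] 0)
      (𝓝 (0 - k1 lam * 0 - 1 / k2 lam)) := (htv.sub (htu.const_mul _)).sub_const _
  have ht' : Tendsto (fun ξ => V.fst ξ - k1 lam * U.fst ξ - 1 / k2 lam) (𝓝[<] 0) (𝓝 0) := by
    refine tendsto_const_nhds.congr' ?_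
    filter_upwards [self_mem_nhdsWithin] with ξ hξ using (hw ξ hξ).symm
  have := tendsto_nhds_unique ht ht'
  simp [hk20] at this

/-- The coefficient of Re lam is positive, so a shift to the left makes the defining inequality
strict, and by `regionP_expr` also Re H2 < Le - 1. Shifted points on the half-line are already
covered. -/
theorem regionP_subset (hΘ1 : Θi < 1) (hLe : 1 < Le) :
    regionP Θi Le ⊆ opSpectrum (L Θi Le) := by
  intro lam hlam
  refine mem_opSpectrum_of_sub_ofReal fun ε hε => ?_
  by_cases hl : lam - ε ∈ halfLine
  · exact halfLine_subset hLe hl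
  refine mem_opSpectrum_of_H2_lt hΘ1 hLe hl ?_
  have hε' : (lam - ε : ℂ) ∈ regionP Θi Le ∧ ((1 - 1 / Le) ^ 2 * (lam - ε : ℂ).re +
      1 / Le * (lam - ε : ℂ).im ^ 2 + ((2 * coeffA Θi Le + 1) / 2 - (8 * coeffA Θi Le + 5) / (4 * Le)
        + (1 + coeffA Θi Le) / Le ^ 2 - 1 / (4 * Le ^ 3))) < 0 := by
    rw [and_iff_right_of_imp fun h => h.le]
    rw [regionP, Set.mem_ofPred_eq] at hlam
    have h1 : 0 < (1 - 1 / Le) ^ 2 := by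
      have : 1 / Le < 1 := by rw [div_lt_one (by linarith)]; exact hLe
      have : 0 < 1 - 1 / Le := by linarith
      positivity
    rw [Complex.sub_re, Complex.sub_im, Complex.ofReal_re, Complex.ofReal_im, sub_zero]
    nlinarith
  obtain ⟨h1, h2⟩ := hε'
  refine ((mem_regionP_iff hLe _).1 h1).lt_of_ne fun heq => h2.ne ?_
  have h3 := regionP_expr (Θi := Θi) hLe (lam - ε)
  rw [heq, sub_self, zero_mul] at h3
  exact (mul_eq_zero.1 h3).resolve_left (by positivity)

/-- Zeros of the dispersion function in the half-line or 𝒫 need no eigenfunction, as those sets are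
in the spectrum anyway; elsewhere a zero yields one. -/
theorem opSpectrum_L (hΘ0 : 0 < Θi) (hΘ1 : Θi < 1) (hLe : 1 < Le) :
    opSpectrum (L Θi Le) =
      halfLine ∪ regionP Θi Le ∪ {0} ∪ {lam : ℂ | dispersion Θi Le lam = 0} := by
  have hz := dispersion_zero hΘ0 hΘ1 hLe
  apply Set.Subset.antisymm
  · intro lam hlam
    by_contra hc
    simp only [Set.mem_union, not_or] at hc
    exact hlam (mem_opResolventSet_L hΘ0 hΘ1 hLe (not_or.2 hc.1.1) hc.2)
  · have hD : ∀ lam, dispersion Θi Le lam = 0 → lam ∈ opSpectrum (L Θi Le) := by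
      intro lam hlam
      by_cases h : lam ∈ halfLine ∪ regionP Θi Le
      · exact h.elim (fun h => halfLine_subset hLe h) (fun h => regionP_subset hΘ1 hLe h)
      · obtain ⟨e, he⟩ := exists_rateBound hLe h
        obtain ⟨x, hx, hx0⟩ := exists_eigenvector hΘ1 hLe he hlam
        exact mem_opSpectrum_of_mem_opEigenspace hx hx0
    refine Set.union_subset (Set.union_subset (Set.union_subset (halfLine_subset hLe)
      (regionP_subset hΘ1 hLe)) ?_) hD
    rw [Set.singleton_subset_iff]
    exact hD 0 hz

end Spectrum

/-! ### The eigenvalue zero -/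

section Zero

variable {Θi Le : ℝ}

/-- Near zero, the resolvent has at most a simple pole. -/
theorem resolvent_bound_near_zero (hΘ0 : 0 < Θi) (hΘ1 : Θi < 1) (hLe : 1 < Le) :
    ∃ C : ℝ, ∀ᶠ lam in 𝓝[≠] (0 : ℂ), lam ∈ opResolventSet (L Θi Le) ∧
      ‖opResolvent (L Θi Le) lam‖ ≤ C / ‖lam - 0‖ := by
  have c1 : ContinuousAt H1 0 := hasDerivAt_H1_zero.continuousAt
  have c2 : ContinuousAt (H2 Θi Le) 0 := (hasDerivAt_H2_zero hΘ0 hΘ1 hLe).continuousAt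
  have c3 : ContinuousAt (H3 Le) 0 := (hasDerivAt_H3_zero hLe).continuousAt
  have c1r : ContinuousAt (fun lam => (H1 lam).re) 0 := Complex.continuous_re.continuousAt.comp c1
  have c2r : ContinuousAt (fun lam => (H2 Θi Le lam).re) 0 :=
    Complex.continuous_re.continuousAt.comp c2
  have c3r : ContinuousAt (fun lam => (H3 Le lam).re) 0 := Complex.continuous_re.continuousAt.comp c3
  have hρ : 0 < Θi / (1 - Θi) := div_pos hΘ0 (by linarith)
  have r1 : (1 / 2 : ℝ) < (H1 0).re := by rw [H1_zero, Complex.one_re]; norm_num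
  have r2 : 1 / 2 + (Le - 1) < (H2 Θi Le 0).re := by
    rw [H2_zero hΘ0 hΘ1 hLe, Complex.ofReal_re]
    linarith
  have r3 : (1 / 2 : ℝ) < (H3 Le 0).re := by rw [H3_zero hLe, Complex.ofReal_re]; linarith
  have hrate : ∀ᶠ lam in 𝓝 (0 : ℂ), RateBound Θi Le lam (1 / 4) := by
    filter_upwards [c1r.eventually (lt_mem_nhds r1), c2r.eventually (lt_mem_nhds r2),
      c3r.eventually (lt_mem_nhds r3)] with lam h1 h2 h3
    exact ⟨by norm_num, by linarith, by linarith, by linarith⟩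
  have n1 : ContinuousAt (fun lam => ‖k3 Θi Le lam - k2 lam‖) 0 := by
    simp only [k3, k2]; fun_prop
  have n2 : ContinuousAt (fun lam => ‖k6 Le lam - k3 Θi Le lam‖) 0 := by
    simp only [k3, k6]; fun_prop
  have n3 : ContinuousAt (fun lam => ‖1 / (1 - Θi) - H1 lam‖) 0 := by fun_prop
  -- The added 1 makes the bounds at 0 strict, so by continuity they persist nearby.
  set B := ‖k3 Θi Le 0 - k2 0‖ + ‖k6 Le 0 - k3 Θi Le 0‖ + ‖1 / (1 - Θi) - H1 0‖ + 1 with hB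
  obtain ⟨C, hC0, hC⟩ := exists_resolvent_bound hΘ0 hΘ1 hLe (e := 1 / 4) (by norm_num)
    (B := B) (by positivity)
  obtain ⟨c, hc, hlow⟩ := dispersion_lower_bound hΘ0 hΘ1 hLe
  refine ⟨C * (1 + 1 / c), ?_⟩
  have b1 : ‖k3 Θi Le 0 - k2 0‖ < B := by
    rw [hB]
    linarith [norm_nonneg (k6 Le 0 - k3 Θi Le 0), norm_nonneg (1 / (1 - Θi) - H1 0)]
  have b2 : ‖k6 Le 0 - k3 Θi Le 0‖ < B := by
    rw [hB]
    linarith [norm_nonneg (k3 Θi Le 0 - k2 0), norm_nonneg (1 / (1 - Θi) - H1 0)]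
  have b3 : ‖1 / (1 - Θi) - H1 0‖ < B := by
    rw [hB]
    linarith [norm_nonneg (k3 Θi Le 0 - k2 0), norm_nonneg (k6 Le 0 - k3 Θi Le 0)]
  filter_upwards [hrate.filter_mono nhdsWithin_le_nhds, hlow, self_mem_nhdsWithin,
    (n1.eventually (gt_mem_nhds b1)).filter_mono nhdsWithin_le_nhds,
    (n2.eventually (gt_mem_nhds b2)).filter_mono nhdsWithin_le_nhds,
    (n3.eventually (gt_mem_nhds b3)).filter_mono nhdsWithin_le_nhds,
    mem_nhdsWithin_of_mem_nhds (Metric.ball_mem_nhds (0 : ℂ) one_pos)]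
    with lam h1 h2 h3 h4 h5 h6 h7
  have hn : 0 < ‖lam‖ := norm_pos_iff.2 h3
  have hn1 : ‖lam‖ < 1 := by simpa using h7
  have hDp : 0 < ‖dispersion Θi Le lam‖ := lt_of_lt_of_le (by positivity) h2
  obtain ⟨g1, g2⟩ := hC lam h1 h4.le h5.le h6.le (norm_pos_iff.1 hDp)
  refine ⟨g1, g2.trans ?_⟩
  -- For |lam| < 1 the term 1 is at most 1/|lam|, and 1/|D| ≤ 1/(c|lam|) by
  -- `dispersion_lower_bound`.
  rw [sub_zero, mul_div_assoc]
  gcongr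
  rw [add_div, div_div]
  gcongr
  exact (one_le_div hn).2 hn1.le

theorem hasDerivAt_const_mul_cexp (a c : ℂ) (x : ℝ) :
    HasDerivAt (fun x : ℝ => c * Complex.exp (a * x)) (c * a * Complex.exp (a * x)) x :=
  ((hasDerivAt_cexp_mul_ofReal a x).const_mul c).congr_deriv (by ring)

/-- The derivative of the travelling wave is an eigenfunction for the eigenvalue zero. -/
theorem exists_waveDerivative (hΘ0 : 0 < Θi) (hΘ1 : Θi < 1) (hLe : 1 < Le) :
    ∃ E : W Le, IsWaveDerivative Θi Le E ∧ E ∈ opEigenspace (L Θi Le) 0 ∧ E.fst 0 ≠ 0 := by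
  have hA0 := coeffA_pos hΘ0 hΘ1 hLe
  have hL0 : 0 < Le := by linarith
  have hr0 : 0 < 1 - Θi := by linarith
  set A := coeffA Θi Le with hAdef
  -- Here ρ is the exponent of the wave on the left and m is its concentration at the interface; the
  -- relations q1 to q4 contain all the algebra, in particular m = Le/(Le + ρ).
  set ρ : ℝ := Θi / (1 - Θi) with hρ
  set m : ℝ := Θi / (A * (1 - Θi)) with hm
  have hρ0 : 0 < ρ := div_pos hΘ0 hr0
  have q1 : ρ * (1 - Θi) = Θi := div_mul_cancel₀ _ hr0.ne'
  have q2 : A * m = ρ := by rw [hm, hρ]; field_simp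
  have q3 : Le * A = ρ * (Le + ρ) := by rw [hAdef, coeffA, hρ]; field_simp
  have q4 : m * (Le + ρ) = Le := by
    have : ρ * (m * (Le + ρ)) = ρ * Le := by
      linear_combination Le * q2 - m * q3
    exact mul_left_cancel₀ hρ0.ne' this
  have q1' : (ρ : ℂ) * (1 - Θi) = Θi := by exact_mod_cast q1
  have q2' : (A : ℂ) * m = ρ := by exact_mod_cast q2
  have q3' : (Le : ℂ) * A = ρ * (Le + ρ) := by exact_mod_cast q3
  have q4' : (m : ℂ) * (Le + ρ) = Le := by exact_mod_cast q4
  have hΘc := one_sub_ne_zero hΘ1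
  have hl : ∀ c : ℂ, IsLeft (1 / 2) fun x : ℝ => c * Complex.exp ((ρ : ℂ) * x) := fun c =>
    (isLeft_cexp (by rw [Complex.ofReal_re]; linarith)).const_mul c
  have hr₁ : ∀ c : ℂ, IsRight (1 / 2) fun x : ℝ => c * Complex.exp ((-1 : ℂ) * x) := fun c =>
    (isRight_cexp (by norm_num)).const_mul c
  have hr₂ : ∀ c : ℂ, IsRight (Le / 2) fun x : ℝ => c * Complex.exp ((-Le : ℂ) * x) := fun c =>
    (isRight_cexp (by rw [Complex.neg_re, Complex.ofReal_re]; linarith)).const_mul c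
  let g₁ : ℂ → ℂ → Weighted (1 / 2) (1 / 2) := fun c d => Weighted.glue (hl c) (hr₁ d)
  let g₂ : ℂ → ℂ → Weighted (1 / 2) (Le / 2) := fun c d => Weighted.glue (hl c) (hr₂ d)
  have hg₁ : ∀ c d, Weighted.HasDeriv (g₁ c d) (g₁ (c * ρ) (d * (-1))) := fun c d =>
    Weighted.hasDeriv_glue _ _ _ _ (fun ξ _ => hasDerivAt_const_mul_cexp _ c ξ)
      (fun ξ _ => hasDerivAt_const_mul_cexp _ d ξ)
  have hg₂ : ∀ c d, Weighted.HasDeriv (g₂ c d) (g₂ (c * ρ) (d * (-Le))) := fun c d =>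
    Weighted.hasDeriv_glue _ _ _ _ (fun ξ _ => hasDerivAt_const_mul_cexp _ c ξ)
      (fun ξ _ => hasDerivAt_const_mul_cexp _ d ξ)
  have hj₁ : ∀ c d, jump (g₁ c d) = d - c := fun c d =>
    (Weighted.jump_glue _ _).trans (by simp)
  have hj₂ : ∀ c d, jump (g₂ c d) = d - c := fun c d =>
    (Weighted.jump_glue _ _).trans (by simp)
  have hneg₁ : ∀ c d, ∀ ξ < 0, g₁ c d ξ = c * Complex.exp (ρ * ξ) := fun c d ξ hξ =>
    Weighted.glue_of_neg _ _ hξ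
  have hneg₂ : ∀ c d, ∀ ξ < 0, g₂ c d ξ = c * Complex.exp (ρ * ξ) := fun c d ξ hξ =>
    Weighted.glue_of_neg _ _ hξ
  have hpos₁ : ∀ c d (ξ : ℝ), 0 ≤ ξ → g₁ c d ξ = d * Complex.exp (-1 * ξ) := fun c d ξ hξ =>
    Weighted.glue_of_nonneg _ _ hξ
  have hpos₂ : ∀ c d (ξ : ℝ), 0 ≤ ξ → g₂ c d ξ = d * Complex.exp (-Le * ξ) := fun c d ξ hξ =>
    Weighted.glue_of_nonneg _ _ hξ
  -- Differentiating the wave on the two sides gives the coefficients -(1 - Θi)ρ and -Θi for the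
  -- first component, mρ and -Le(m - 1) for the second. They agree in pairs by q1 and q4, so the
  -- derivative is continuous at 0.
  let U : W Le := WithLp.toLp 1 (g₁ (-Θi) (-Θi), g₂ (m * ρ) (m * ρ))
  let V : W Le := WithLp.toLp 1 (g₁ (-Θi * ρ) (-Θi * (-1)), g₂ (m * ρ * ρ) (m * ρ * (-Le)))
  let Z : W Le := WithLp.toLp 1 (g₁ (-Θi * ρ * ρ) (-Θi * (-1) * (-1)),
    g₂ (m * ρ * ρ * ρ) (m * ρ * (-Le) * (-Le)))
  have hU0 : U.fst 0 = -Θi := (hpos₁ _ _ 0 le_rfl).trans (by simp)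
  have hT : IsDomainTriple Θi Le U V Z := by
    refine ⟨hg₁ _ _, hg₂ _ _, hg₁ _ _, hg₂ _ _, (hj₁ _ _).trans (sub_self _),
      (hj₂ _ _).trans (sub_self _), (hj₁ _ _).trans ?_, (hj₂ _ _).trans ?_⟩
    · rw [hU0]
      field_simp
      linear_combination Θi * q1'
    · rw [hU0]
      field_simp
      linear_combination -ρ * (1 - Θi) * q4' - Le * q1'
  have hE : ResolventEq Θi Le 0 U V Z 0 := by
    have hF1 : ∀ ξ : ℝ, (0 : W Le).fst ξ = 0 := fun ξ => rfl
    have hF2 : ∀ ξ : ℝ, (0 : W Le).snd ξ = 0 := fun ξ => rfl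
    refine ⟨fun ξ hξ => ?_, fun ξ hξ => ?_, fun ξ hξ => ?_, fun ξ hξ => ?_⟩
    · have e1 : Z.fst ξ = _ := hneg₁ _ _ ξ hξ
      have e2 : V.fst ξ = _ := hneg₁ _ _ ξ hξ
      have e3 : U.snd ξ = _ := hneg₂ _ _ ξ hξ
      rw [e1, e2, e3, hF1, ← hAdef]
      linear_combination Complex.exp (ρ * ξ) * ρ * q2' + Complex.exp (ρ * ξ) * ρ * q1'
    · have e1 : Z.fst ξ = _ := hpos₁ _ _ ξ (le_of_lt hξ)
      have e2 : V.fst ξ = _ := hpos₁ _ _ ξ (le_of_lt hξ)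
      rw [e1, e2, hF1]
      ring
    · have e1 : Z.snd ξ = _ := hneg₂ _ _ ξ hξ
      have e2 : V.snd ξ = _ := hneg₂ _ _ ξ hξ
      have e3 : U.snd ξ = _ := hneg₂ _ _ ξ hξ
      rw [e1, e2, e3, hF2, ← hAdef]
      linear_combination -Complex.exp (ρ * ξ) * m * ρ * q3'
    · have e1 : Z.snd ξ = _ := hpos₂ _ _ ξ (le_of_lt hξ)
      have e2 : V.snd ξ = _ := hpos₂ _ _ ξ (le_of_lt hξ)
      rw [e1, e2, hF2]
      ring
  have hexp : ∀ a c ξ : ℝ, HasDerivAt (fun z : ℝ => c * Real.exp (a * z))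
      (c * a * Real.exp (a * ξ)) ξ := fun a c ξ => by
    refine ((((hasDerivAt_id ξ).const_mul a).exp).const_mul c).congr_deriv ?_
    simp only [id, mul_one]
    ring
  refine ⟨U, fun ξ hξ => ?_, ⟨mem_domain_L hT, (sub_eq_zero.1 (hE.sub_L hLe hT)).symm⟩, ?_⟩
  · rcases lt_or_gt_of_ne hξ with hξ | hξ
    · have e1 : U.fst ξ = _ := hneg₁ _ _ ξ hξ
      have e2 : U.snd ξ = _ := hneg₂ _ _ ξ hξ
      rw [e1, e2]
      constructor
      · refine (((hexp ρ (1 - Θi) ξ).const_sub 1).ofReal_comp.congr_deriv ?_).congr_of_eventuallyEq ?_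
        · push_cast
          linear_combination -Complex.exp (ρ * ξ) * q1'
        · filter_upwards [Iio_mem_nhds hξ] with z hz
          rw [waveTheta, if_pos (Set.mem_Iio.1 hz)]
      · refine ((hexp ρ m ξ).ofReal_comp.congr_deriv ?_).congr_of_eventuallyEq ?_
        · push_cast
          ring
        · filter_upwards [Iio_mem_nhds hξ] with z hz
          rw [wavePhi, if_pos (Set.mem_Iio.1 hz)]
    · have e1 : U.fst ξ = _ := hpos₁ _ _ ξ (le_of_lt hξ)
      have e2 : U.snd ξ = _ := hpos₂ _ _ ξ (le_of_lt hξ)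
      rw [e1, e2]
      constructor
      · refine ((hexp (-1) Θi ξ).ofReal_comp.congr_deriv ?_).congr_of_eventuallyEq ?_
        · push_cast
          ring
        · filter_upwards [Ioi_mem_nhds hξ] with z hz
          rw [waveTheta, if_neg (not_lt.2 (le_of_lt hz)), neg_one_mul]
      · refine (((hexp (-Le) (m - 1) ξ).const_add 1).ofReal_comp.congr_deriv
          ?_).congr_of_eventuallyEq ?_
        · push_cast
          linear_combination -Complex.exp (-Le * ξ) * q4'
        · filter_upwards [Ioi_mem_nhds hξ] with z hz
          rw [wavePhi, if_neg (not_lt.2 (le_of_lt hz))]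
  · rw [hU0, neg_ne_zero]
    exact_mod_cast hΘ0.ne'

/-- Subtracting the multiple of E with the same value u(0) leaves an eigenfunction with u(0) = 0,
which is zero by `eq_zero_of_mem_opEigenspace`. -/
theorem opEigenspace_zero_eq_span (hΘ0 : 0 < Θi) (hΘ1 : Θi < 1) (hLe : 1 < Le) {E : W Le}
    (hE : E ∈ opEigenspace (L Θi Le) 0) (h0 : E.fst 0 ≠ 0) :
    opEigenspace (L Θi Le) 0 = Submodule.span ℂ {E} := by
  obtain ⟨e, he⟩ := exists_rateBound (Θi := Θi) hLe
    (not_or.2 ⟨zero_notMem_halfLine, zero_notMem_regionP hΘ0 hΘ1 hLe⟩)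
  refine le_antisymm (fun x hx => ?_) ((Submodule.span_singleton_le_iff_mem _ _).2 hE)
  have hsub : x - (x.fst 0 / E.fst 0) • E ∈ opEigenspace (L Θi Le) 0 :=
    Submodule.sub_mem _ hx (Submodule.smul_mem _ _ hE)
  have hval : (x - (x.fst 0 / E.fst 0) • E).fst 0 = 0 := by
    rw [WithLp.sub_fst, Weighted.sub_apply, WithLp.smul_fst, Weighted.smul_apply,
      div_mul_cancel₀ _ h0, sub_self]
  exact Submodule.mem_span_singleton.2 ⟨_, (sub_eq_zero.1
    (eq_zero_of_mem_opEigenspace hΘ0 hΘ1 hLe he hsub hval)).symm⟩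

theorem isSimpleIsolatedEigenvalue_zero (hΘ0 : 0 < Θi) (hΘ1 : Θi < 1) (hLe : 1 < Le) :
    IsSimpleIsolatedEigenvalue (L Θi Le) 0 := by
  obtain ⟨E, -, hE, h0⟩ := exists_waveDerivative hΘ0 hΘ1 hLe
  obtain ⟨C, hC⟩ := resolvent_bound_near_zero hΘ0 hΘ1 hLe
  have hE0 : E ≠ 0 := by rintro rfl; exact h0 rfl
  refine ⟨hC.mono fun _ h => h.1, ?_, meromorphicOrderAt_opResolvent hE hE0 hC⟩
  rw [opEigenspace_zero_eq_span hΘ0 hΘ1 hLe hE h0]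
  exact finrank_span_singleton hE0

end Zero

end Flame

theorem theorem2p3 (Θi Le : ℝ) (hΘ0 : 0 < Θi) (hΘ1 : Θi < 1) (hLe : 1 < Le) :
    Flame.IsSectorial (Flame.L Θi Le) ∧
    Flame.GeneratesAnalyticSemigroup (Flame.L Θi Le) ∧
    Flame.opSpectrum (Flame.L Θi Le) =
      Flame.halfLine ∪ Flame.regionP Θi Le ∪ {0} ∪ {lam : ℂ | Flame.dispersion Θi Le lam = 0} ∧
    Flame.IsSimpleIsolatedEigenvalue (Flame.L Θi Le) 0 ∧
    (∃ E : Flame.W Le, Flame.IsWaveDerivative Θi Le E ∧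
      Flame.opEigenspace (Flame.L Θi Le) 0 = Submodule.span ℂ {E}) ∧
    (∀ lam : ℂ, lam ∉ Flame.halfLine ∪ Flame.regionP Θi Le →
      (Flame.IsEigenvalue (Flame.L Θi Le) lam ↔ Flame.dispersion Θi Le lam = 0)) := by
  have hS := Flame.isSectorial_L hΘ0 hΘ1 hLe
  obtain ⟨E, hE, hmem, h0⟩ := Flame.exists_waveDerivative hΘ0 hΘ1 hLe
  exact ⟨hS, hS.generatesAnalyticSemigroup, Flame.opSpectrum_L hΘ0 hΘ1 hLe,
    Flame.isSimpleIsolatedEigenvalue_zero hΘ0 hΘ1 hLe,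
    ⟨E, hE, Flame.opEigenspace_zero_eq_span hΘ0 hΘ1 hLe hmem h0⟩,
    fun _ h => Flame.isEigenvalue_iff hΘ0 hΘ1 hLe h⟩
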